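/- All manifolds and maps are $C^\infty$. Let $(E,[\cdot,\cdot],\rho)$ be a Lie algebroid of rank $m$ over an $n$-dimensional manifold $Q$, with projections $\pi\colon E\times\mathbb R\to Q$ and $\pi\colon E^*\times\mathbb R\to Q$. For $P=E\times\mathbb R$ or $P=E^*\times\mathbb R$ let $\mathcal T^EP=\{(a,v)\in E_{\pi(p)}\times T_pP : p\in P,\ \rho(a)=T\pi(v)\}$ be the prolongation of $E$ over $\pi\colon P\to Q$. It is a Lie algebroid over $P$ with anchor $\rho^\pi(a,v)=v$; its bracket is determined by the Leibniz rule and $[(\sigma\circ\pi,X),(\tau\circ\pi,Y)]=([\sigma,\tau]\circ\pi,[X,Y])$. Let $d$ be its exterior differential. Let $L\colon E\times\mathbb R\to\mathbb R$ be a smooth Lagrangian. For $a,b\in E_q$ let $a^V_{(b,s)}$ be the velocity at $t=0$ of $t\mapsto(b+ta,s)$, and put $S(a,v)=(0,a^V)$, $\Delta(b,s)=(0,b^V_{(b,s)})$, $\Theta_L=dL\circ S$, $\eta_L=ds-\Theta_L$ and $E_L=\rho^\pi(\Delta)L-L$. On $\mathcal T^E(E^*\times\mathbb R)$ put $\Theta_{(b^*,s)}(a,v)=b^*(a)$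 and $\eta=ds-\Theta$. The Legendre transformation is $\mathrm{Leg}_L\colon E\times\mathbb R\to E^*\times\mathbb R$, $\mathrm{Leg}_L(a,s)=(\mu(a,s),s)$ with $\mu(a,s)(b)=\frac{d}{dt}\big|_{t=0}L(a+tb,s)$, and its prolongation is $\mathcal T^E\mathrm{Leg}_L(a,v)=(a,(\mathrm{Leg}_L)_*v)$. A Reeb section $R$ of $\eta_L$ (or $\eta$) is a section with $i_R\,d\eta_L=0$, $i_R\eta_L=1$ (resp. with $\eta$). Assume that $L$ is hyperregular, i.e. $\mathrm{Leg}_L$ is a global diffeomorphism, and let $H=E_L\circ\mathrm{Leg}_L^{-1}$. Then there is a unique section $\Gamma_L$ of $\mathcal T^E(E\times\mathbb R)$ (the Lagrangian section) with $$i_{\Gamma_L}\eta_L=-E_L,\qquad i_{\Gamma_L}d\eta_L=dE_L-\rho^\pi(\mathcal R_L)(E_L)\,\eta_L,$$ where $\mathcal R_L$ is the Reeb section of $\eta_L$, and a unique section $\xi_H$ of $\mathcal T^E(E^*\times\mathbb R)$ (the Hamiltonian section) with $$i_{\xi_H}\eta=-H,\qquad i_{\xi_H}d\eta=dH-\rho^\pi(\mathcal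 R)(H)\,\eta,$$ where $\mathcal R$ is the Reeb section of $\eta$, and they are related by the prolonged Legendre map: $$\xi_H\circ\mathrm{Leg}_L=\mathcal T^E\mathrm{Leg}_L\circ\Gamma_L .$$ Moreover, let $I\subset\mathbb R$ be an interval with more than one point. If a smooth curve $c\colon I\to E\times\mathbb R$ is a solution of the Herglotz equations associated to $L$, then $\mathrm{Leg}_L\circ c$ is a solution of the contact Hamilton equations associated to $H$; conversely, if a smooth curve $\sigma\colon I\to E^*\times\mathbb R$ is a solution of the contact Hamilton equations, then $\mathrm{Leg}_L^{-1}\circ\sigma$ is a solution of the Herglotz equations. Thus $c\mapsto\mathrm{Leg}_L\circ c$ is a bijection between the two sets of solutions on $I$. Here, for local coordinates $(q^i)$ on $Q$ and a local basis $(e_\alpha)$ of sections of $E$ with $\rho(e_\alpha)=\rho^i_\alpha\,\partial/\partial q^i$ and $[e_\alpha,e_\beta]=C^\gamma_{\alpha\beta}e_\gamma$, with induced coordinates $(q^i,y^\alpha,s)$ on $E\times\mathbb R$ and $(q^i,y_\alpha,s)$ on $E^*\times\mathbb R$, the Herglotz equations are $$\frac{d}{dt}\frac{\partial L}{\partial y^\alpha}=\rho^i_\alpha\frac{\partial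 L}{\partial q^i}-y^\beta C^\gamma_{\alpha\beta}\frac{\partial L}{\partial y^\gamma}+\frac{\partial L}{\partial y^\alpha}\frac{\partial L}{\partial s},\qquad \frac{dq^i}{dt}=y^\alpha\rho^i_\alpha,\qquad \frac{ds}{dt}=L,$$ and the contact Hamilton equations are $$\frac{dq^i}{dt}=\rho^i_\alpha\frac{\partial H}{\partial y_\alpha},\qquad \frac{dy_\alpha}{dt}=-\Big(\rho^i_\alpha\frac{\partial H}{\partial q^i}+C^\gamma_{\alpha\beta}y_\gamma\frac{\partial H}{\partial y_\beta}+y_\alpha\frac{\partial H}{\partial s}\Big),\qquad \frac{ds}{dt}=y_\alpha\frac{\partial H}{\partial y_\alpha}-H;$$ a curve is a solution if these hold in all such coordinates. -/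

import Mathlib

open Bundle Manifold Set Filter Topology Module
open scoped ContDiff

noncomputable section

namespace ContactAlgebroid

/-! ### Lie algebroids

`Q` is a smooth `n`-dimensional manifold and `E → Q` a smooth real vector bundle with model
fibre `F`. -/

section Algebroid

variable (n : ℕ) {Q : Type*} [TopologicalSpace Q] [ChartedSpace (EuclideanSpace ℝ (Fin n)) Q]
  (F : Type*) [NormedAddCommGroup F] [NormedSpace ℝ F]
  (E : Q → Type*) [∀ q, AddCommGroup (E q)] [∀ q, Module ℝ (E q)]
  [∀ q, TopologicalSpace (E q)] [TopologicalSpace (TotalSpace F E)]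
  [FiberBundle F E] [VectorBundle ℝ F E]

/-- The smooth sections of `E → Q`. -/
abbrev Sec := Cₛ^∞⟮𝓡 n; F, E⟯

variable {n F E}

/-- The product `f σ` of a smooth function and a smooth section. -/
def smulSec (f : C^∞⟮𝓡 n, Q; ℝ⟯) (σ : Sec n F E) : Sec n F E :=
  ⟨fun q => f q • σ q, f.contMDiff.smul_section σ.contMDiff⟩

variable (n F E)

/-- A Lie algebroid structure on the vector bundle `E → Q`: a smooth vector bundle map
`anchor : E → TQ` and a Lie bracket on the real vector space of smooth sections of `E` which satisfy
`[σ, f τ] = f [σ, τ] + (ρ(σ) f) τ`. -/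
structure LieAlgebroid [IsManifold (𝓡 n) ∞ Q] where
  anchor : ∀ q, E q →ₗ[ℝ] TangentSpace (𝓡 n) q
  contMDiff_anchor : ContMDiff ((𝓡 n).prod 𝓘(ℝ, F)) (𝓡 n).tangent ∞
    (fun v : TotalSpace F E => (⟨v.proj, anchor v.proj v.2⟩ : TangentBundle (𝓡 n) Q))
  bracket : Sec n F E →ₗ[ℝ] Sec n F E →ₗ[ℝ] Sec n F E
  bracket_self : ∀ σ, bracket σ σ = 0
  jacobi : ∀ σ τ υ, bracket σ (bracket τ υ) + bracket τ (bracket υ σ) + bracket υ (bracket σ τ) = 0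
  leibniz : ∀ (f : C^∞⟮𝓡 n, Q; ℝ⟯) (σ τ : Sec n F E) (q : Q),
    bracket σ (smulSec f τ) q
      = f q • bracket σ τ q + mvfderiv (𝓡 n) f q (anchor q (σ q)) • τ q

variable {n F E}

/-- A section which is smooth near `q₀` agrees near `q₀` with a globally defined smooth section. -/
theorem exists_extension [IsManifold (𝓡 n) ∞ Q] [T2Space Q] (σ : ∀ q, E q) {u : Set Q}
    (hu : IsOpen u) {q₀ : Q} (hq : q₀ ∈ u)
    (hσ : ContMDiffOn (𝓡 n) ((𝓡 n).prod 𝓘(ℝ, F)) ∞ (fun q => (⟨q, σ q⟩ : TotalSpace F E)) u) :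
    ∃ s : Sec n F E, ∀ᶠ q in 𝓝 q₀, s q = σ q := by
  obtain ⟨f, hf, -⟩ := (SmoothBumpFunction.nhds_basis_support (I := 𝓡 n)
    (hu.mem_nhds hq)).mem_iff.1 (Filter.univ_mem (f := 𝓝 q₀))
  refine ⟨⟨_, ContMDiffOn.smul_section_of_tsupport (f.contMDiff.contMDiffOn) hu hf hσ⟩, ?_⟩
  filter_upwards [f.eventuallyEq_one] with q hq
  change f q • σ q = σ q
  rw [hq, Pi.one_apply, one_smul]

open Classical in
/-- A global smooth section which agrees near `q₀` with the given local section `σ`. -/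
def extendSec (σ : ∀ q, E q) (q₀ : Q) : Sec n F E :=
  if h : ∃ s : Sec n F E, ∀ᶠ q in 𝓝 q₀, s q = σ q then h.choose else 0

/-- The value at `q` of the bracket of two sections `σ`, `τ` of `E` which are defined and smooth
near `q` (the bracket of sections is a local operation). -/
def LieAlgebroid.localBracket [IsManifold (𝓡 n) ∞ Q] (A : LieAlgebroid n F E)
    (σ τ : ∀ q, E q) (q : Q) : E q :=
  A.bracket (extendSec σ q) (extendSec τ q) q

end Algebroid

/-! ### The prolongation of a Lie algebroid over a fibration `pr : P → Q` -/

section Prolongation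

variable {n : ℕ} {Q : Type*} [TopologicalSpace Q] [ChartedSpace (EuclideanSpace ℝ (Fin n)) Q]
  [IsManifold (𝓡 n) ∞ Q]
  {F : Type*} [NormedAddCommGroup F] [NormedSpace ℝ F]
  {E : Q → Type*} [∀ q, AddCommGroup (E q)] [∀ q, Module ℝ (E q)]
  [∀ q, TopologicalSpace (E q)] [TopologicalSpace (TotalSpace F E)]
  [FiberBundle F E] [VectorBundle ℝ F E]
  {V H : Type*} [NormedAddCommGroup V] [NormedSpace ℝ V] [TopologicalSpace H]
  (J : ModelWithCorners ℝ V H)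
  {P : Type*} [TopologicalSpace P] [ChartedSpace H P] [IsManifold J ∞ P]
  (A : LieAlgebroid n F E) (pr : P → Q)

/-- The fibre at `p` of the prolongation: all `(a, v) ∈ E_{pr(p)} × T_p P` with `ρ(a) = T pr(v)`. -/
def prolFiber (p : P) : Submodule ℝ (E (pr p) × TangentSpace J p) where
  carrier := {z | A.anchor (pr p) z.1 = mfderiv J (𝓡 n) pr p z.2}
  add_mem' {z w} hz hw := by
    simp only [Set.mem_ofPred_eq, Prod.fst_add, Prod.snd_add, map_add] at *
    rw [hz, hw]
  zero_mem' := by simp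
  smul_mem' c z hz := by
    simp only [Set.mem_ofPred_eq, Prod.smul_fst, Prod.smul_snd, map_smul] at *
    rw [hz]

/-- Smooth sections of the prolongation `T^E P → P`. -/
structure ProlSec where
  toFun : ∀ p, E (pr p) × TangentSpace J p
  mem : ∀ p, toFun p ∈ prolFiber J A pr p
  contMDiff_fst : ContMDiff J ((𝓡 n).prod 𝓘(ℝ, F)) ∞
    (fun p => (⟨pr p, (toFun p).1⟩ : TotalSpace F E))
  contMDiff_snd : ContMDiff J J.tangent ∞
    (fun p => (⟨p, (toFun p).2⟩ : TangentBundle J P))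

variable {J A pr}

instance : CoeFun (ProlSec J A pr) (fun _ => ∀ p, E (pr p) × TangentSpace J p) := ⟨ProlSec.toFun⟩

/-- The vector field `ρ(Z)` on `P`, the anchor of `T^E P` being `(a, v) ↦ v`. -/
def ProlSec.vectorField (Z : ProlSec J A pr) (p : P) : TangentSpace J p := (Z p).2

/-- The derivative `ρ(Z) f` of a function along a section of the prolongation. -/
def ProlSec.deriv (Z : ProlSec J A pr) (f : P → ℝ) (p : P) : ℝ := mvfderiv J f p (Z.vectorField p)

/-- The first component of `Z`, read as a function `P → F` (near `p₀`) in a trivialization of `E`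
around `pr(p₀)`. -/
def ProlSec.localRep (Z : ProlSec J A pr) (p₀ p : P) : F :=
  (trivializationAt F E (pr p₀) ⟨pr p, (Z p).1⟩).2

/-- The local section of `E` around `q₀` with constant coordinates `c` in a trivialization. -/
def constSec (q₀ : Q) (c : F) (q : Q) : E q := (trivializationAt F E q₀).symm q c

/-- The Lie bracket of two sections `Z = (a, X)` and `W = (b, Y)` of the prolongation. If `(e_α)` is
a local frame of `E` and `a = a^α (e_α ∘ pr)`, `b = b^α (e_α ∘ pr)`, it is
`((X(b^γ) - Y(a^γ)) e_γ + a^α b^β [e_α, e_β], [X, Y])`, which lies in the prolongation again. -/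
def prolBracket (Z W : ProlSec J A pr) (p : P) : E (pr p) × TangentSpace J p :=
  (constSec (pr p)
      (mvfderiv J (W.localRep p) p (Z.vectorField p) - mvfderiv J (Z.localRep p) p (W.vectorField p))
      (pr p)
    + A.localBracket (constSec (pr p) (Z.localRep p p)) (constSec (pr p) (W.localRep p p)) (pr p),
   VectorField.mlieBracket J Z.vectorField W.vectorField p)

variable (E J pr) in
/-- The `1`-sections of the prolongation: at each `p` a linear form in the pair `(a, v)`. It is written
on the whole sum `E_{pr(p)} × T_p P`; only its values on the subspace `prolFiber` are ever used. -/
abbrev OneSec := ∀ p : P, (E (pr p) × TangentSpace J p) →ₗ[ℝ] ℝ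

/-- The exterior differential of a `1`-section `η`:
`dη(Z, W) = ρ(Z)(η(W)) - ρ(W)(η(Z)) - η([Z, W])`. -/
def extDeriv (η : OneSec E J pr) (Z W : ProlSec J A pr) (p : P) : ℝ :=
  Z.deriv (fun p => η p (W p)) p - W.deriv (fun p => η p (Z p)) p - η p (prolBracket Z W p)

/-- `R` is a Reeb section of `η`: `i_R dη = 0` and `i_R η = 1`. -/
def IsReeb (η : OneSec E J pr) (R : ProlSec J A pr) : Prop :=
  (∀ (Z : ProlSec J A pr) (p : P), extDeriv η R Z p = 0) ∧ ∀ p, η p (R p) = 1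

/-- `X` satisfies `i_X η = -h` and `i_X dη = dh - ρ(R)(h) η`, where `R` is the Reeb section
of `η`. -/
def IsContactSection (η : OneSec E J pr) (h : P → ℝ) (X : ProlSec J A pr) : Prop :=
  (∀ p, η p (X p) = - h p) ∧
    ∃ R : ProlSec J A pr, IsReeb η R ∧
      ∀ (Z : ProlSec J A pr) (p : P), extDeriv η X Z p = Z.deriv h p - R.deriv h p * η p (Z p)

end Prolongation

/-! ### The Lagrangian and the Hamiltonian formalism -/

section Phase

variable (n : ℕ) {Q : Type*} [TopologicalSpace Q] [ChartedSpace (EuclideanSpace ℝ (Fin n)) Q]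
  (F : Type*) [NormedAddCommGroup F] [NormedSpace ℝ F]
  (E : Q → Type*) [∀ q, AddCommGroup (E q)] [∀ q, Module ℝ (E q)]
  [∀ q, TopologicalSpace (E q)] [TopologicalSpace (TotalSpace F E)]
  [FiberBundle F E] [VectorBundle ℝ F E]

/-- The manifold `E × ℝ`. -/
abbrev LagSpace := TotalSpace F E × ℝ

/-- The dual bundle `E* → Q`. -/
abbrev DualBundle (q : Q) := E q →L[ℝ] Bundle.Trivial Q ℝ q

/-- The manifold `E* × ℝ`. -/
abbrev HamSpace := TotalSpace (F →L[ℝ] ℝ) (DualBundle E) × ℝ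

/-- The model of the manifold `E × ℝ`. -/
abbrev lagModel := ((𝓡 n).prod 𝓘(ℝ, F)).prod 𝓘(ℝ, ℝ)

/-- The model of the manifold `E* × ℝ`. -/
abbrev hamModel := ((𝓡 n).prod 𝓘(ℝ, F →L[ℝ] ℝ)).prod 𝓘(ℝ, ℝ)

/-- The projection `E × ℝ → Q`. -/
abbrev lagProj (p : LagSpace F E) : Q := p.1.proj

/-- The projection `E* × ℝ → Q`. -/
abbrev hamProj (p : HamSpace F E) : Q := p.1.proj

/-- The smooth functions on `E × ℝ`. -/
abbrev Lagrangian := C^∞⟮lagModel n F, LagSpace F E; ℝ⟯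

variable {n F E}

/-- The curve `t ↦ (b + t a, s)` in `E × ℝ` through `p = (b, s)`. -/
def fiberLine (p : LagSpace F E) (a : E (lagProj F E p)) (t : ℝ) : LagSpace F E :=
  (⟨lagProj F E p, p.1.2 + t • a⟩, p.2)

/-- The inclusion of the model fibre. -/
def fiberIncl (p : LagSpace F E) (w : F) : LagSpace F E :=
  (⟨lagProj F E p, (trivializationAt F E (lagProj F E p)).symm (lagProj F E p) w⟩, p.2)

variable (n) in
theorem contMDiff_fiberIncl [IsManifold (𝓡 n) ∞ Q] [ContMDiffVectorBundle ∞ F E (𝓡 n)]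
    (p : LagSpace F E) : ContMDiff 𝓘(ℝ, F) (lagModel n F) ∞ (fiberIncl p) := by
  refine ContMDiff.prodMk ?_ contMDiff_const
  have h := (trivializationAt F E (lagProj F E p)).contMDiffOn_symm (IB := 𝓡 n) (n := ∞)
  have h2 : ContMDiff 𝓘(ℝ, F) ((𝓡 n).prod 𝓘(ℝ, F)) ∞ (fun w : F => (lagProj F E p, w)) :=
    contMDiff_const.prodMk contMDiff_id
  have hm := FiberBundle.mem_baseSet_trivializationAt' (F := F) (E := E) (lagProj F E p)
  refine (h.comp_contMDiff h2 (fun w => ?_)).congr fun w => ?_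
  · simp [Trivialization.mem_target, hm]
  · simp [Trivialization.mk_symm _ hm]

theorem fiberLine_eq (p : LagSpace F E) (a : E (lagProj F E p)) :
    fiberLine p a = fiberIncl p ∘ fun t : ℝ =>
      (trivializationAt F E (lagProj F E p)).continuousLinearMapAt ℝ (lagProj F E p) p.1.2 +
      t • (trivializationAt F E (lagProj F E p)).continuousLinearMapAt ℝ (lagProj F E p) a := by
  funext t
  have hm := FiberBundle.mem_baseSet_trivializationAt' (F := F) (E := E) (lagProj F E p)
  simp only [fiberLine, fiberIncl, Function.comp, ← map_smul, ← map_add]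
  simp [hm]

variable (n) in
theorem mfderiv_fiberLine [IsManifold (𝓡 n) ∞ Q] [ContMDiffVectorBundle ∞ F E (𝓡 n)]
    (p : LagSpace F E) (a : E (lagProj F E p)) :
    (mfderiv 𝓘(ℝ, ℝ) (lagModel n F) (fiberLine p a) 0 (1 : ℝ) : TangentSpace (lagModel n F) p) =
      mfderiv 𝓘(ℝ, F) (lagModel n F) (fiberIncl p)
        ((trivializationAt F E (lagProj F E p)).continuousLinearMapAt ℝ (lagProj F E p) p.1.2)
        ((trivializationAt F E (lagProj F E p)).continuousLinearMapAt ℝ (lagProj F E p) a) := by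
  rw [fiberLine_eq]
  set x := (trivializationAt F E (lagProj F E p)).continuousLinearMapAt ℝ (lagProj F E p) p.1.2
  set v := (trivializationAt F E (lagProj F E p)).continuousLinearMapAt ℝ (lagProj F E p) a
  have h1 : HasMFDerivAt 𝓘(ℝ, ℝ) 𝓘(ℝ, F) (fun t : ℝ => x + t • v) 0
      (ContinuousLinearMap.toSpanSingleton ℝ v) := by
    have := ((hasDerivAt_id (0:ℝ)).smul_const v).const_add x
    simpa using! this.hasFDerivAt.hasMFDerivAt
  have hx : x + (0:ℝ) • v = x := by simp
  have h2 : HasMFDerivAt 𝓘(ℝ, F) (lagModel n F) (fiberIncl p) (x + (0:ℝ) • v)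
      (mfderiv 𝓘(ℝ, F) (lagModel n F) (fiberIncl p) (x + (0:ℝ) • v)) :=
    ((contMDiff_fiberIncl n p).mdifferentiableAt (by simp)).hasMFDerivAt
  have h3 := (HasMFDerivAt.comp (0:ℝ) h2 h1).mfderiv
  rw [h3]
  change (mfderiv 𝓘(ℝ, F) (lagModel n F) (fiberIncl p) (x + (0 : ℝ) • v)) ((1 : ℝ) • v : F) = _
  rw [one_smul, hx]

/-- The vertical lift `a ↦ a^V ∈ T_p(E × ℝ)`, the velocity of `t ↦ (b + t a, s)` at `t = 0`, where
`p = (b, s)`. -/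
def vertLift [IsManifold (𝓡 n) ∞ Q] [ContMDiffVectorBundle ∞ F E (𝓡 n)] (p : LagSpace F E) :
    E (lagProj F E p) →ₗ[ℝ] TangentSpace (lagModel n F) p where
  toFun a := mfderiv 𝓘(ℝ, ℝ) (lagModel n F) (fiberLine p a) 0 (1 : ℝ)
  map_add' a b := by
    have h := mfderiv_fiberLine n p
    rw [h, h, h, map_add]
    exact map_add (mfderiv 𝓘(ℝ, F) (lagModel n F) (fiberIncl p) _) _ _
  map_smul' c a := by
    have h := mfderiv_fiberLine n p
    rw [h, h, map_smul]
    exact map_smul (mfderiv 𝓘(ℝ, F) (lagModel n F) (fiberIncl p) _) c _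

theorem deriv_fiberLine [IsManifold (𝓡 n) ∞ Q] [ContMDiffVectorBundle ∞ F E (𝓡 n)]
    (L : Lagrangian n F E) (p : LagSpace F E) (a : E (lagProj F E p)) :
    deriv (fun t : ℝ => L (fiberLine p a t)) 0 = mvfderiv (lagModel n F) L p (vertLift p a) := by
  have h1 : MDifferentiableAt 𝓘(ℝ, ℝ) (lagModel n F) (fiberLine p a) 0 := by
    rw [fiberLine_eq]
    refine ((contMDiff_fiberIncl n p).mdifferentiableAt (by simp)).comp (0 : ℝ) ?_
    exact DifferentiableAt.mdifferentiableAt (by fun_prop)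
  have h2 : MDifferentiableAt (lagModel n F) 𝓘(ℝ, ℝ) L (fiberLine p a 0) :=
    L.contMDiff.mdifferentiableAt (by simp)
  have h3 := mfderiv_comp (0 : ℝ) h2 h1
  have h4 : fiberLine p a 0 = p := by simp [fiberLine]
  rw [← fderiv_apply_one_eq_deriv, ← mfderiv_eq_fderiv]
  change mfderiv 𝓘(ℝ, ℝ) 𝓘(ℝ, ℝ) (L ∘ fiberLine p a) 0 (1 : ℝ) = _
  rw [h3]
  change mfderiv (lagModel n F) 𝓘(ℝ, ℝ) L (fiberLine p a 0)
    (mfderiv 𝓘(ℝ, ℝ) (lagModel n F) (fiberLine p a) 0 (1 : ℝ)) = _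
  rw [h4]
  rfl

/-- The vertical endomorphism `S(a, v) = (0, a^V)` of the prolongation of `E` over `E × ℝ`. -/
def vertEndo [IsManifold (𝓡 n) ∞ Q] [ContMDiffVectorBundle ∞ F E (𝓡 n)] (p : LagSpace F E) :
    (E (lagProj F E p) × TangentSpace (lagModel n F) p) →ₗ[ℝ]
      (E (lagProj F E p) × TangentSpace (lagModel n F) p) :=
  LinearMap.inr ℝ _ _ ∘ₗ vertLift p ∘ₗ LinearMap.fst ℝ _ _

variable [IsManifold (𝓡 n) ∞ Q] [ContMDiffVectorBundle ∞ F E (𝓡 n)]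

/-- The Liouville section `Δ(b, s) = (0, b^V)`. -/
def liouville (p : LagSpace F E) : E (lagProj F E p) × TangentSpace (lagModel n F) p :=
  (0, vertLift p p.1.2)

/-- The Poincaré–Cartan `1`-section `Θ_L = dL ∘ S`. -/
def cartanSec (L : Lagrangian n F E) : OneSec E (lagModel n F) (lagProj F E) := fun p =>
  (mvfderiv (lagModel n F) L p).toLinearMap ∘ₗ LinearMap.snd ℝ _ _ ∘ₗ vertEndo p

/-- The `1`-section `η_L = ds - Θ_L`. -/
def lagContact (L : Lagrangian n F E) : OneSec E (lagModel n F) (lagProj F E) := fun p =>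
  (mvfderiv (lagModel n F) (fun p : LagSpace F E => p.2) p).toLinearMap ∘ₗ LinearMap.snd ℝ _ _
    - cartanSec L p

/-- The energy `E_L = ρ(Δ) L - L`. -/
def energy (L : Lagrangian n F E) (p : LagSpace F E) : ℝ :=
  mvfderiv (lagModel n F) L p (liouville p).2 - L p

variable (n) in
/-- The Liouville `1`-section `Θ(a, v) = b*(a)` at `(b*, s) ∈ E* × ℝ`. -/
def liouvilleSec : OneSec E (hamModel n F) (hamProj F E) := fun p =>
  p.1.2.toLinearMap ∘ₗ LinearMap.fst ℝ _ _

variable (n F E) in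
/-- The contact `1`-section `η = ds - Θ`. -/
def hamContact : OneSec E (hamModel n F) (hamProj F E) := fun p =>
  (mvfderiv (hamModel n F) (fun p : HamSpace F E => p.2) p).toLinearMap ∘ₗ LinearMap.snd ℝ _ _
    - liouvilleSec n p

/-- The covector `b ↦ d/dt L(a + t b, s)` at `t = 0`, for `p = (a, s)`. -/
def legendreCovector (L : Lagrangian n F E) (p : LagSpace F E) : DualBundle E (lagProj F E p) where
  toFun b := deriv (fun t : ℝ => L (fiberLine p b t)) 0
  map_add' b c := by simp only [deriv_fiberLine, map_add]
  map_smul' r b := by simp only [deriv_fiberLine, map_smul, RingHom.id_apply]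
  cont := by
    simp only [deriv_fiberLine, vertLift, LinearMap.coe_mk, mfderiv_fiberLine]
    let D : F →L[ℝ] (EuclideanSpace ℝ (Fin n) × F) × ℝ :=
      mfderiv 𝓘(ℝ, F) (lagModel n F) (fiberIncl p)
        ((trivializationAt F E (lagProj F E p)).continuousLinearMapAt ℝ (lagProj F E p) p.1.2)
    exact (mvfderiv (lagModel n F) L p).continuous.comp
      (D.continuous.comp (ContinuousLinearMap.continuous _))

/-- The Legendre transformation `Leg_L : E × ℝ → E* × ℝ`. -/
def legendre (L : Lagrangian n F E) (p : LagSpace F E) : HamSpace F E :=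
  (⟨lagProj F E p, legendreCovector L p⟩, p.2)

/-- The prolongation `T^E Leg_L (a, v) = (a, (Leg_L)_* v)`. -/
def prolLegendre (L : Lagrangian n F E) (p : LagSpace F E)
    (z : E (lagProj F E p) × TangentSpace (lagModel n F) p) :
    E (hamProj F E (legendre L p)) × TangentSpace (hamModel n F) (legendre L p) :=
  (z.1, mfderiv (lagModel n F) (hamModel n F) (legendre L) p z.2)

/-- `Γ` is a Lagrangian section of `L`: `i_Γ η_L = -E_L` and `i_Γ dη_L = dE_L - ρ(R_L)(E_L) η_L`. -/
def IsLagrangianSection (A : LieAlgebroid n F E) (L : Lagrangian n F E)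
    (Γ : ProlSec (lagModel n F) A (lagProj F E)) : Prop :=
  IsContactSection (lagContact L) (energy L) Γ

/-- `ξ` is a Hamiltonian section of `H`: `i_ξ η = -H` and `i_ξ dη = dH - ρ(R)(H) η`. -/
def IsHamiltonianSection (A : LieAlgebroid n F E) (H : HamSpace F E → ℝ)
    (ξ : ProlSec (hamModel n F) A (hamProj F E)) : Prop :=
  IsContactSection (hamContact n F E) H ξ

end Phase

/-! ### The Herglotz equations and the contact Hamilton equations in local coordinates -/

section Equations

variable (n : ℕ) {Q : Type*} [TopologicalSpace Q] [ChartedSpace (EuclideanSpace ℝ (Fin n)) Q]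
  [IsManifold (𝓡 n) ∞ Q]
  (F : Type*) [NormedAddCommGroup F] [NormedSpace ℝ F] [FiniteDimensional ℝ F]
  (E : Q → Type*) [∀ q, AddCommGroup (E q)] [∀ q, Module ℝ (E q)]
  [∀ q, TopologicalSpace (E q)] [TopologicalSpace (TotalSpace F E)]
  [FiberBundle F E] [VectorBundle ℝ F E]

/-- Local coordinates `(q^i)` on an open set of `Q` together with a local basis `(e_α)` of sections
of `E` over it. -/
structure LocalCoords where
  chart : OpenPartialHomeomorph Q (EuclideanSpace ℝ (Fin n))
  chart_mem : chart ∈ IsManifold.maximalAtlas (𝓡 n) ∞ Q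
  frame : Fin (finrank ℝ F) → ∀ q, E q
  isLocalFrameOn : IsLocalFrameOn (𝓡 n) F ∞ frame chart.source

/-- The space of coordinates `(q^i, y^α, s)` or `(q^i, y_α, s)`. -/
abbrev CoordSpace := EuclideanSpace ℝ (Fin n) × (Fin (finrank ℝ F) → ℝ) × ℝ

variable {n F E}

/-- `∂f/∂q^i`. -/
def partialQ (f : CoordSpace n F → ℝ) (i : Fin n) (z : CoordSpace n F) : ℝ :=
  fderiv ℝ f z (EuclideanSpace.single i 1, 0, 0)

/-- `∂f/∂y^α`, or `∂f/∂y_α`. -/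
def partialY (f : CoordSpace n F → ℝ) (α : Fin (finrank ℝ F)) (z : CoordSpace n F) : ℝ :=
  fderiv ℝ f z (0, Pi.single α 1, 0)

/-- `∂f/∂s`. -/
def partialS (f : CoordSpace n F → ℝ) (z : CoordSpace n F) : ℝ :=
  fderiv ℝ f z (0, 0, 1)

/-- A linear form on a fibre of `E` is continuous. -/
def toDual (q : Q) (l : E q →ₗ[ℝ] ℝ) : DualBundle E q where
  toLinearMap := l
  cont := by
    have hm := FiberBundle.mem_baseSet_trivializationAt' (F := F) (E := E) q
    let e := (trivializationAt F E q).continuousLinearEquivAt ℝ q hm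
    have h : Continuous ((l ∘ₗ e.symm.toLinearEquiv.toLinearMap) ∘ e) :=
      (LinearMap.continuous_of_finiteDimensional _).comp e.continuous
    convert h using 1
    funext x
    simp

namespace LocalCoords

variable (κ : LocalCoords n F E)

/-- The functions `ρ^i_α` with `ρ(e_α) = ρ^i_α ∂/∂q^i`. -/
def anchorCoeff (A : LieAlgebroid n F E) (i : Fin n) (α : Fin (finrank ℝ F)) (q : Q) : ℝ :=
  mvfderiv (𝓡 n) κ.chart q (A.anchor q (κ.frame α q)) i

/-- The functions `C^γ_{αβ}` with `[e_α, e_β] = C^γ_{αβ} e_γ`. -/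
def structCoeff (A : LieAlgebroid n F E) (γ α β : Fin (finrank ℝ F)) (q : Q) : ℝ :=
  κ.isLocalFrameOn.coeff γ q (A.localBracket (κ.frame α) (κ.frame β) q)

/-- The coordinates `(q^i, y^α, s)` of a point of `E × ℝ`. -/
def lagCoords (p : LagSpace F E) : CoordSpace n F :=
  (κ.chart p.1.proj, fun α => κ.isLocalFrameOn.coeff α p.1.proj p.1.2, p.2)

/-- The point of `E × ℝ` with coordinates `(q^i, y^α, s)`. -/
def lagPoint (z : CoordSpace n F) : LagSpace F E :=
  (⟨κ.chart.symm z.1, ∑ α, z.2.1 α • κ.frame α (κ.chart.symm z.1)⟩, z.2.2)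

/-- The coordinates `(q^i, y_α, s)` of a point of `E* × ℝ`. -/
def hamCoords (p : HamSpace F E) : CoordSpace n F :=
  (κ.chart p.1.proj, fun α => p.1.2 (κ.frame α p.1.proj), p.2)

/-- The point of `E* × ℝ` with coordinates `(q^i, y_α, s)`. -/
def hamPoint (z : CoordSpace n F) : HamSpace F E :=
  (⟨κ.chart.symm z.1,
    toDual (F := F) _ (∑ α, z.2.1 α • κ.isLocalFrameOn.coeff α (κ.chart.symm z.1))⟩, z.2.2)

end LocalCoords

variable (A : LieAlgebroid n F E)

/-- The smooth curve `c : I → E × ℝ` solves the Herglotz equations: in all local coordinates,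
`d/dt (∂L/∂y^α) = ρ^i_α ∂L/∂q^i - y^β C^γ_{αβ} ∂L/∂y^γ + ∂L/∂y^α ∂L/∂s`,
`dq^i/dt = y^α ρ^i_α` and `ds/dt = L`. -/
def IsHerglotzSolution (L : LagSpace F E → ℝ) (I : Set ℝ) (c : ℝ → LagSpace F E) : Prop :=
  ContMDiffOn 𝓘(ℝ, ℝ) (lagModel n F) ∞ c I ∧
  ∀ (κ : LocalCoords n F E), ∀ t ∈ I, lagProj F E (c t) ∈ κ.chart.source →
    let q := lagProj F E (c t)
    let z := fun r => κ.lagCoords (c r)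
    let L' := fun w => L (κ.lagPoint w)
    (∀ α, HasDerivWithinAt (fun r => partialY L' α (z r))
      (∑ i, κ.anchorCoeff A i α q * partialQ L' i (z t)
        - ∑ β, ∑ γ, (z t).2.1 β * κ.structCoeff A γ α β q * partialY L' γ (z t)
        + partialY L' α (z t) * partialS L' (z t)) I t) ∧
    (∀ i, HasDerivWithinAt (fun r => (z r).1 i)
      (∑ α, (z t).2.1 α * κ.anchorCoeff A i α q) I t) ∧
    HasDerivWithinAt (fun r => (z r).2.2) (L (c t)) I t

/-- The smooth curve `c : I → E* × ℝ` solves the contact Hamilton equations: in all local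
coordinates, `dq^i/dt = ρ^i_α ∂H/∂y_α`,
`dy_α/dt = -(ρ^i_α ∂H/∂q^i + C^γ_{αβ} y_γ ∂H/∂y_β + y_α ∂H/∂s)` and
`ds/dt = y_α ∂H/∂y_α - H`. -/
def IsHamiltonSolution (H : HamSpace F E → ℝ) (I : Set ℝ) (c : ℝ → HamSpace F E) : Prop :=
  ContMDiffOn 𝓘(ℝ, ℝ) (hamModel n F) ∞ c I ∧
  ∀ (κ : LocalCoords n F E), ∀ t ∈ I, hamProj F E (c t) ∈ κ.chart.source →
    let q := hamProj F E (c t)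
    let z := fun r => κ.hamCoords (c r)
    let H' := fun w => H (κ.hamPoint w)
    (∀ i, HasDerivWithinAt (fun r => (z r).1 i)
      (∑ α, κ.anchorCoeff A i α q * partialY H' α (z t)) I t) ∧
    (∀ α, HasDerivWithinAt (fun r => (z r).2.1 α)
      (-(∑ i, κ.anchorCoeff A i α q * partialQ H' i (z t)
        + ∑ β, ∑ γ, κ.structCoeff A γ α β q * (z t).2.1 γ * partialY H' β (z t)
        + (z t).2.1 α * partialS H' (z t))) I t) ∧
    HasDerivWithinAt (fun r => (z r).2.2)
      (∑ α, (z t).2.1 α * partialY H' α (z t) - H (c t)) I t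

end Equations

end ContactAlgebroid

end

/-!
On `T^E(E* × ℝ)` everything can be written out in adapted coordinates: evaluated on a local frame,
the equations for the Reeb section and for the contact section form a linear system with exactly
one solution. Solving it pointwise gives uniqueness, and it gives existence because the local
solutions are smooth and glue. The integral curves of the Hamiltonian section found this way are
those of the contact Hamilton equations.

The Legendre transformation covers the identity of `Q` and pulls `η` back to `η_L`, so when it is a
diffeomorphism it carries the problem on `E × ℝ` to the one on `E* × ℝ`. In coordinates,
differentiating `H ∘ Leg = y ∂L/∂y - L` cancels the terms in `dy`, which gives
`∂H/∂y_α = y^α`, `∂H/∂q = -∂L/∂q` and `∂H/∂s = -∂L/∂s` along the Legendre transformation;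
under these identities the Herglotz equations and the contact Hamilton equations are the same
equations.
-/

noncomputable section

namespace ContactAlgebroid

section ManifoldDerivative

variable {𝕜 : Type*} [NontriviallyNormedField 𝕜]
  {V H P : Type*} [NormedAddCommGroup V] [NormedSpace 𝕜 V] [TopologicalSpace H]
  {J : ModelWithCorners 𝕜 V H} [TopologicalSpace P] [ChartedSpace H P]
  {G G' : Type*} [NormedAddCommGroup G] [NormedSpace 𝕜 G] [NormedAddCommGroup G']
  [NormedSpace 𝕜 G'] {p : P}

theorem mvfderiv_congr {f g : P → G} (h : f =ᶠ[𝓝 p] g) (v : TangentSpace J p) :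
    mvfderiv J f p v = mvfderiv J g p v := by
  change mfderiv J 𝓘(𝕜, G) f p v = mfderiv J 𝓘(𝕜, G) g p v
  rw [h.mfderiv_eq]
  rfl

theorem mvfderiv_clm_comp (l : G →L[𝕜] G') {f : P → G} (hf : MDifferentiableAt J 𝓘(𝕜, G) f p)
    (v : TangentSpace J p) : mvfderiv J (fun x => l (f x)) p v = l (mvfderiv J f p v) := by
  change mfderiv J 𝓘(𝕜, G') (l ∘ f) p v = _
  rw [(l.hasFDerivAt.hasMFDerivAt.comp p hf.hasMFDerivAt).mfderiv]
  rfl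

theorem mvfderiv_finset_sum {ι : Type} (s : Finset ι) {f : ι → P → G}
    (hf : ∀ i ∈ s, MDifferentiableAt J 𝓘(𝕜, G) (f i) p) (v : TangentSpace J p) :
    mvfderiv J (fun x => ∑ i ∈ s, f i x) p v = ∑ i ∈ s, mvfderiv J (f i) p v := by
  classical
  induction s using Finset.induction_on with
  | empty => simp [mvfderiv_const]
  | insert i s hi ih =>
    have hs := fun j hj => hf j (Finset.mem_insert_of_mem hj)
    have hsum : MDifferentiableAt J 𝓘(𝕜, G) (fun x => ∑ j ∈ s, f j x) p :=
      Finset.sum_fn s f ▸ MDifferentiableAt.sum hs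
    simp only [Finset.sum_insert hi]
    rw [mvfderiv_fun_add (hf i (Finset.mem_insert_self i s)) hsum, ← ih hs]
    rfl

end ManifoldDerivative

section LocalBracket

variable {n : ℕ} {Q : Type*} [TopologicalSpace Q] [ChartedSpace (EuclideanSpace ℝ (Fin n)) Q]
  {F : Type*} [NormedAddCommGroup F] [NormedSpace ℝ F]
  {E : Q → Type*} [∀ q, AddCommGroup (E q)] [∀ q, Module ℝ (E q)]
  [∀ q, TopologicalSpace (E q)] [TopologicalSpace (TotalSpace F E)]
  [FiberBundle F E]

/-- The coordinates of a section of `E` in the trivialization around `q₀`; the counterpart of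
`ProlSec.localRep` for sections over `Q`. -/
def secRep (F : Type*) [NormedAddCommGroup F] [NormedSpace ℝ F]
    {E : Q → Type*} [∀ q, TopologicalSpace (E q)] [TopologicalSpace (TotalSpace F E)]
    [FiberBundle F E] (σ : ∀ q, E q) (q₀ q : Q) : F :=
  (trivializationAt F E q₀ ⟨q, σ q⟩).2

variable [VectorBundle ℝ F E]

/-- Evaluation of smooth sections at a point. -/
def evalSec (q : Q) : Sec n F E →ₗ[ℝ] E q where
  toFun σ := σ q
  map_add' _ _ := rfl
  map_smul' _ _ := rfl

section ConstSec

omit [ChartedSpace (EuclideanSpace ℝ (Fin n)) Q]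

theorem secRep_eq_continuousLinearMapAt {q₀ q : Q}
    (hq : q ∈ (trivializationAt F E q₀).baseSet) (σ : ∀ q, E q) :
    secRep F σ q₀ q = (trivializationAt F E q₀).continuousLinearMapAt ℝ q (σ q) := by
  simp [secRep, Trivialization.continuousLinearMapAt_apply, Trivialization.linearMapAt_apply, hq]

theorem constSec_eq_symmL {q₀ q : Q} (hq : q ∈ (trivializationAt F E q₀).baseSet) (c : F) :
    constSec q₀ c q = ((trivializationAt F E q₀).symmL ℝ q c : E q) := by
  simp [constSec, Trivialization.symmL_apply _ hq]

theorem constSec_secRep {q₀ q : Q} (hq : q ∈ (trivializationAt F E q₀).baseSet) (σ : ∀ q, E q) :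
    constSec q₀ (secRep F σ q₀ q) q = σ q := by
  rw [constSec_eq_symmL hq, secRep_eq_continuousLinearMapAt hq,
    Trivialization.symmL_continuousLinearMapAt _ hq]

theorem secRep_sum_smul {ι : Type*} (s : Finset ι) {q₀ q : Q}
    (hq : q ∈ (trivializationAt F E q₀).baseSet) (a : ι → ℝ) (σ : ι → ∀ q, E q) :
    secRep F (fun x => ∑ i ∈ s, a i • σ i x) q₀ q = ∑ i ∈ s, a i • secRep F (σ i) q₀ q := by
  simp only [secRep_eq_continuousLinearMapAt hq, map_sum, map_smul]

theorem sum_repr_smul_constSec {ι : Type*} [Fintype ι] (b : Basis ι ℝ F) {q₀ q : Q}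
    (hq : q ∈ (trivializationAt F E q₀).baseSet) (c : F) :
    ∑ i, b.repr c i • (constSec q₀ (b i) q : E q) = constSec q₀ c q := by
  simp only [constSec_eq_symmL hq, ← map_smul, ← map_sum, b.sum_repr]

end ConstSec

theorem contMDiffOn_secRep [ContMDiffVectorBundle ∞ F E (𝓡 n)] {σ : ∀ q, E q} {u : Set Q} {q₀ : Q}
    (hσ : ContMDiffOn (𝓡 n) ((𝓡 n).prod 𝓘(ℝ, F)) ∞ (fun q => (⟨q, σ q⟩ : TotalSpace F E)) u) :
    ContMDiffOn (𝓡 n) 𝓘(ℝ, F) ∞ (secRep F σ q₀) ((trivializationAt F E q₀).baseSet ∩ u) :=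
  fun q hq => (((trivializationAt F E q₀).contMDiffWithinAt_section (n := ∞) (IB := 𝓡 n)
    _ hq.1).1 (hσ q hq.2)).mono Set.inter_subset_right

theorem contMDiffOn_constSec [ContMDiffVectorBundle ∞ F E (𝓡 n)] (q₀ : Q) (c : F) :
    ContMDiffOn (𝓡 n) ((𝓡 n).prod 𝓘(ℝ, F)) ∞
      (fun q => (⟨q, constSec q₀ c q⟩ : TotalSpace F E)) (trivializationAt F E q₀).baseSet := by
  refine ((trivializationAt F E q₀).contMDiffOn_section_baseSet_iff).2 ?_
  refine contMDiffOn_const (c := c) |>.congr fun q hq => ?_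
  simp [constSec, hq]

variable [IsManifold (𝓡 n) ∞ Q]

theorem LieAlgebroid.bracket_skew (A : LieAlgebroid n F E) (σ τ : Sec n F E) :
    A.bracket σ τ = - A.bracket τ σ := by
  have h := A.bracket_self (σ + τ)
  simp only [map_add, LinearMap.add_apply, A.bracket_self, zero_add, add_zero] at h
  exact eq_neg_of_add_eq_zero_right h

theorem LieAlgebroid.bracket_smulSec_left (A : LieAlgebroid n F E) (f : C^∞⟮𝓡 n, Q; ℝ⟯)
    (σ τ : Sec n F E) (q : Q) :
    A.bracket (smulSec f σ) τ q
      = f q • A.bracket σ τ q - mvfderiv (𝓡 n) f q (A.anchor q (τ q)) • σ q := by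
  rw [A.bracket_skew, ContMDiffSection.coe_neg, Pi.neg_apply, A.leibniz, A.bracket_skew τ σ,
    ContMDiffSection.coe_neg, Pi.neg_apply]
  module

theorem LieAlgebroid.bracket_smulSec_smulSec (A : LieAlgebroid n F E) (f g : C^∞⟮𝓡 n, Q; ℝ⟯)
    (σ τ : Sec n F E) (q : Q) :
    A.bracket (smulSec f σ) (smulSec g τ) q
      = (f q * g q) • A.bracket σ τ q
        + (f q * mvfderiv (𝓡 n) g q (A.anchor q (σ q))) • τ q
        - (g q * mvfderiv (𝓡 n) f q (A.anchor q (τ q))) • σ q := by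
  rw [A.leibniz, A.bracket_smulSec_left]
  change _ + mvfderiv (𝓡 n) g q (A.anchor q (f q • σ q)) • _ = _
  simp only [map_smul, smul_eq_mul]
  module

omit [IsManifold (𝓡 n) ∞ Q] in
theorem sum_smulSec_apply {ι : Type*} [Fintype ι] (f : ι → C^∞⟮𝓡 n, Q; ℝ⟯) (s : ι → Sec n F E)
    (q : Q) : (∑ i, smulSec (f i) (s i)) q = ∑ i, f i q • s i q := by
  change evalSec q (∑ i, smulSec (f i) (s i)) = _
  rw [map_sum]
  rfl

theorem LieAlgebroid.bracket_sum_smulSec (A : LieAlgebroid n F E) {ι : Type*} [Fintype ι]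
    (f g : ι → C^∞⟮𝓡 n, Q; ℝ⟯) (s : ι → Sec n F E) (q : Q) :
    A.bracket (∑ i, smulSec (f i) (s i)) (∑ i, smulSec (g i) (s i)) q =
      (∑ i, (mvfderiv (𝓡 n) (g i) q (A.anchor q (∑ j, f j q • s j q))
        - mvfderiv (𝓡 n) (f i) q (A.anchor q (∑ j, g j q • s j q))) • s i q)
      + ∑ i, ∑ j, (f i q * g j q) • A.bracket (s i) (s j) q := by
  have h : A.bracket (∑ i, smulSec (f i) (s i)) (∑ i, smulSec (g i) (s i)) q
      = ∑ i, ∑ j, A.bracket (smulSec (f i) (s i)) (smulSec (g j) (s j)) q := by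
    change evalSec q (A.bracket _ _) = _
    simp only [map_sum, LinearMap.sum_apply]
    exact Finset.sum_comm
  rw [h]
  simp only [A.bracket_smulSec_smulSec, map_sum, map_smul, Finset.sum_sub_distrib,
    Finset.sum_add_distrib, sub_smul, Finset.sum_smul, smul_eq_mul]
  rw [Finset.sum_comm
    (f := fun i j => (f i q * mvfderiv (𝓡 n) (g j) q (A.anchor q (s i q))) • s j q)]
  abel

variable [T2Space Q]

theorem exists_contMDiffMap_eventuallyEq_one (n : ℕ) {Q : Type*} [TopologicalSpace Q]
    [ChartedSpace (EuclideanSpace ℝ (Fin n)) Q] [IsManifold (𝓡 n) ∞ Q] [T2Space Q]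
    {u : Set Q} {q₀ : Q} (hu : u ∈ 𝓝 q₀) :
    ∃ f : C^∞⟮𝓡 n, Q; ℝ⟯, (∀ᶠ q in 𝓝 q₀, f q = 1) ∧ tsupport f ⊆ u := by
  obtain ⟨f, -, hf⟩ := (SmoothBumpFunction.nhds_basis_tsupport (I := 𝓡 n) q₀).mem_iff.1 hu
  exact ⟨⟨f, f.contMDiff⟩, f.eventuallyEq_one, hf⟩

theorem exists_contMDiffMap_eventuallyEq {f : Q → ℝ} {u : Set Q} (hu : IsOpen u) {q₀ : Q}
    (hq : q₀ ∈ u) (hf : ContMDiffOn (𝓡 n) 𝓘(ℝ, ℝ) ∞ f u) :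
    ∃ g : C^∞⟮𝓡 n, Q; ℝ⟯, ∀ᶠ q in 𝓝 q₀, g q = f q := by
  obtain ⟨b, hb, hbu⟩ := exists_contMDiffMap_eventuallyEq_one n (hu.mem_nhds hq)
  refine ⟨⟨fun q => b q • f q, fun q => ?_⟩, ?_⟩
  · by_cases hqu : q ∈ u
    · exact (b.contMDiff q).smul (hf.contMDiffAt (hu.mem_nhds hqu))
    · have : ∀ᶠ x in 𝓝 q, b x • f x = 0 := by
        filter_upwards [(isClosed_tsupport b).isOpen_compl.mem_nhds fun h => hqu (hbu h)] with x hx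
        rw [image_eq_zero_of_notMem_tsupport hx, zero_smul]
      exact contMDiffAt_const.congr_of_eventuallyEq this
  · filter_upwards [hb] with q h
    simp [h]

theorem LieAlgebroid.bracket_apply_eq_zero (A : LieAlgebroid n F E) (σ : Sec n F E)
    {τ : Sec n F E} {q : Q} (h : ∀ᶠ x in 𝓝 q, τ x = 0) : A.bracket σ τ q = 0 := by
  obtain ⟨f, hf, hfu⟩ := exists_contMDiffMap_eventuallyEq_one n h
  have h0 : smulSec f τ = 0 := by
    ext x
    change f x • τ x = 0
    by_cases hx : x ∈ tsupport f
    · rw [show τ x = 0 from hfu hx, smul_zero]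
    · rw [image_eq_zero_of_notMem_tsupport hx, zero_smul]
  have := A.leibniz f σ τ q
  rw [h0, map_zero, h.self_of_nhds, smul_zero, add_zero, hf.self_of_nhds, one_smul] at this
  exact this.symm

theorem LieAlgebroid.bracket_apply_congr (A : LieAlgebroid n F E) {σ σ' τ τ' : Sec n F E} {q : Q}
    (hσ : ∀ᶠ x in 𝓝 q, σ x = σ' x) (hτ : ∀ᶠ x in 𝓝 q, τ x = τ' x) :
    A.bracket σ τ q = A.bracket σ' τ' q := by
  have h1 := A.bracket_apply_eq_zero σ (τ := τ - τ') (q := q) <| by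
    filter_upwards [hτ] with x hx
    simp [hx]
  have h2 := A.bracket_apply_eq_zero τ' (τ := σ - σ') (q := q) <| by
    filter_upwards [hσ] with x hx
    simp [hx]
  rw [map_sub, ContMDiffSection.coe_sub, Pi.sub_apply, sub_eq_zero] at h1 h2
  rw [h1, A.bracket_skew, A.bracket_skew σ', ContMDiffSection.coe_neg, ContMDiffSection.coe_neg,
    Pi.neg_apply, Pi.neg_apply, h2]

omit [IsManifold (𝓡 n) ∞ Q] [T2Space Q] in
theorem extendSec_eventuallyEq {σ : ∀ q, E q} {s : Sec n F E} {q : Q}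
    (h : ∀ᶠ x in 𝓝 q, s x = σ x) : ∀ᶠ x in 𝓝 q, (extendSec σ q : Sec n F E) x = σ x := by
  have h' : ∃ s : Sec n F E, ∀ᶠ x in 𝓝 q, s x = σ x := ⟨s, h⟩
  rw [extendSec, dif_pos h']
  exact h'.choose_spec

theorem LieAlgebroid.localBracket_eq_bracket (A : LieAlgebroid n F E) {σ τ : ∀ q, E q}
    {s t : Sec n F E} {q : Q} (hs : ∀ᶠ x in 𝓝 q, s x = σ x) (ht : ∀ᶠ x in 𝓝 q, t x = τ x) :
    A.localBracket σ τ q = A.bracket s t q :=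
  A.bracket_apply_congr
    ((extendSec_eventuallyEq hs).mp (hs.mono fun _ h h' => h'.trans h.symm))
    ((extendSec_eventuallyEq ht).mp (ht.mono fun _ h h' => h'.trans h.symm))

omit [T2Space Q] in
theorem LieAlgebroid.localBracket_congr (A : LieAlgebroid n F E) {σ σ' τ τ' : ∀ q, E q} {q : Q}
    (hσ : ∀ᶠ x in 𝓝 q, σ x = σ' x) (hτ : ∀ᶠ x in 𝓝 q, τ x = τ' x) :
    A.localBracket σ τ q = A.localBracket σ' τ' q := by
  have extendSec_congr : ∀ {σ σ' : ∀ q, E q}, (∀ᶠ x in 𝓝 q, σ x = σ' x) →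
      (extendSec σ q : Sec n F E) = extendSec σ' q := fun {σ σ'} h => by
    have hiff : ∀ s : Sec n F E, (∀ᶠ x in 𝓝 q, s x = σ x) = ∀ᶠ x in 𝓝 q, s x = σ' x := fun s =>
      propext (Filter.eventually_congr (h.mono fun x hx => by rw [hx]))
    classical
    exact congrArg (fun p : Sec n F E → Prop => if h : ∃ s, p s then h.choose else 0) (funext hiff)
  rw [localBracket, localBracket, extendSec_congr hσ, extendSec_congr hτ]

variable [FiniteDimensional ℝ F] [ContMDiffVectorBundle ∞ F E (𝓡 n)]

theorem exists_linearMap_sec_eventuallyEq_constSec (q : Q) :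
    ∃ S : F →ₗ[ℝ] Sec n F E, ∀ c, ∀ᶠ x in 𝓝 q, S c x = constSec q c x := by
  have hq := FiberBundle.mem_baseSet_trivializationAt' (F := F) (E := E) q
  have ho := (trivializationAt F E q).open_baseSet
  let b := Module.finBasis ℝ F
  choose s hs using fun i => exists_extension (n := n) _ ho hq (contMDiffOn_constSec q (b i))
  refine ⟨b.constr ℝ s, fun c => ?_⟩
  filter_upwards [eventually_all.2 hs, ho.mem_nhds hq] with x hx hxq
  rw [← sum_repr_smul_constSec b hxq, Basis.constr_apply_fintype]
  change evalSec x _ = _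
  simp only [map_sum, map_smul, Basis.equivFun_apply]
  exact Finset.sum_congr rfl fun i _ => congrArg _ (hx i)

omit [ContMDiffVectorBundle ∞ F E (𝓡 n)] in
theorem exists_repr_eventuallyEq {ι : Type*} [Fintype ι] (b : Basis ι ℝ F) {q : Q}
    {S : F →ₗ[ℝ] Sec n F E} (hS : ∀ c, ∀ᶠ x in 𝓝 q, S c x = constSec q c x)
    {u : Set Q} (hu : IsOpen u) (hq : q ∈ u) {g : Q → F} (hg : ContMDiffOn (𝓡 n) 𝓘(ℝ, F) ∞ g u) :
    ∃ f : ι → C^∞⟮𝓡 n, Q; ℝ⟯,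
      (∀ i, f i q = b.repr (g q) i) ∧
      (∀ i v, mvfderiv (𝓡 n) (f i) q v = b.repr (mvfderiv (𝓡 n) g q v) i) ∧
      ∀ᶠ x in 𝓝 q, (∑ i, smulSec (f i) (S (b i))) x = constSec q (g x) x := by
  have hcoord : ∀ i, ∃ f : C^∞⟮𝓡 n, Q; ℝ⟯, ∀ᶠ x in 𝓝 q, f x = b.coord i (g x) := fun i =>
    exists_contMDiffMap_eventuallyEq hu hq
      ((LinearMap.toContinuousLinearMap (b.coord i)).contMDiff.comp_contMDiffOn hg)
  choose f hf using hcoord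
  refine ⟨f, fun i => (hf i).self_of_nhds, fun i v => ?_, ?_⟩
  · rw [mvfderiv_congr (hf i)]
    exact mvfderiv_clm_comp (LinearMap.toContinuousLinearMap (b.coord i))
      ((hg.contMDiffAt (hu.mem_nhds hq)).mdifferentiableAt (by simp)) v
  · filter_upwards [eventually_all.2 hf, eventually_all.2 fun i => hS (b i),
      (trivializationAt F E q).open_baseSet.mem_nhds
        (FiberBundle.mem_baseSet_trivializationAt' q)] with x hfx hSx hx
    simp only [sum_smulSec_apply, hfx, hSx, Basis.coord_apply, sum_repr_smul_constSec b hx]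

theorem LieAlgebroid.exists_bilin_localBracket_constSec (A : LieAlgebroid n F E) (q : Q) :
    ∃ B : F →ₗ[ℝ] F →ₗ[ℝ] E q, ∀ u, IsOpen u → q ∈ u → ∀ g h : Q → F,
      ContMDiffOn (𝓡 n) 𝓘(ℝ, F) ∞ g u → ContMDiffOn (𝓡 n) 𝓘(ℝ, F) ∞ h u →
      A.localBracket (fun x => constSec q (g x) x) (fun x => constSec q (h x) x) q
        = constSec q (mvfderiv (𝓡 n) h q (A.anchor q (constSec q (g q) q))
            - mvfderiv (𝓡 n) g q (A.anchor q (constSec q (h q) q))) q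
          + B (g q) (h q) := by
  have hq := FiberBundle.mem_baseSet_trivializationAt' (F := F) (E := E) q
  obtain ⟨S, hS⟩ := exists_linearMap_sec_eventuallyEq_constSec (n := n) (F := F) (E := E) q
  refine ⟨(A.bracket.compl₁₂ S S).compr₂ (evalSec q), fun u hu hqu g h hg hh => ?_⟩
  let b := Module.finBasis ℝ F
  obtain ⟨g', hg'q, hg', hgS⟩ := exists_repr_eventuallyEq b hS hu hqu hg
  obtain ⟨h', hh'q, hh', hhS⟩ := exists_repr_eventuallyEq b hS hu hqu hh
  have hSb : ∀ i, S (b i) q = constSec q (b i) q := fun i => (hS (b i)).self_of_nhds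
  rw [A.localBracket_eq_bracket hgS hhS, A.bracket_sum_smulSec]
  simp only [hSb, hg'q, hh'q, hg', hh', sum_repr_smul_constSec b hq]
  congr 1
  · simp only [← sum_repr_smul_constSec b hq (_ - _), map_sub, Finsupp.sub_apply]
  · conv_rhs => rw [← b.sum_repr (g q), ← b.sum_repr (h q)]
    simp only [map_sum, map_smul, LinearMap.sum_apply, LinearMap.smul_apply, Finset.smul_sum,
      smul_smul]
    rw [Finset.sum_comm]
    simp only [mul_comm]
    rfl

theorem LieAlgebroid.exists_bilin_localBracket (A : LieAlgebroid n F E) (q : Q) :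
    ∃ B : F →ₗ[ℝ] F →ₗ[ℝ] E q, ∀ (u : Set Q), IsOpen u → q ∈ u → ∀ σ τ : ∀ q, E q,
      ContMDiffOn (𝓡 n) ((𝓡 n).prod 𝓘(ℝ, F)) ∞ (fun x => (⟨x, σ x⟩ : TotalSpace F E)) u →
      ContMDiffOn (𝓡 n) ((𝓡 n).prod 𝓘(ℝ, F)) ∞ (fun x => (⟨x, τ x⟩ : TotalSpace F E)) u →
      A.localBracket σ τ q
        = constSec q (mvfderiv (𝓡 n) (secRep F τ q) q (A.anchor q (σ q))
            - mvfderiv (𝓡 n) (secRep F σ q) q (A.anchor q (τ q))) q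
          + B (secRep F σ q q) (secRep F τ q q) := by
  have hq := FiberBundle.mem_baseSet_trivializationAt' (F := F) (E := E) q
  have ho := (trivializationAt F E q).open_baseSet
  obtain ⟨B, hB⟩ := A.exists_bilin_localBracket_constSec q
  refine ⟨B, fun u hu hqu σ τ hσ hτ => ?_⟩
  have hσ' : ∀ σ : ∀ q, E q, ∀ᶠ x in 𝓝 q, σ x = constSec q (secRep F σ q x) x := fun σ => by
    filter_upwards [ho.mem_nhds hq] with x hx using (constSec_secRep hx σ).symm
  rw [A.localBracket_congr (hσ' σ) (hσ' τ), hB _ (ho.inter hu) ⟨hq, hqu⟩ _ _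
    (contMDiffOn_secRep hσ) (contMDiffOn_secRep hτ), constSec_secRep hq, constSec_secRep hq]

end LocalBracket

section Commutator

variable {V H P : Type*} [NormedAddCommGroup V] [NormedSpace ℝ V] [TopologicalSpace H]
  {J : ModelWithCorners ℝ V H} [TopologicalSpace P] [ChartedSpace H P]

variable (J) in
/-- A vector field, written in the preferred chart at `p` as a map from the model space to
itself. -/
def chartField (p : P) (X : ∀ x : P, TangentSpace J x) : V → V :=
  VectorField.mpullbackWithin 𝓘(ℝ, V) J (extChartAt J p).symm X (range J)

variable [IsManifold J ∞ P]

theorem chartField_extChartAt_self (p : P) (X : ∀ x : P, TangentSpace J x) :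
    chartField J p X (extChartAt J p p) = X p := by
  have hX : ∀ x, x = p → (X x : V) = X p := by
    rintro _ rfl
    rfl
  exact (congrArg (mfderivWithin 𝓘(ℝ, V) J (extChartAt J p).symm (range J) _).inverse
    (hX _ (extChartAt_to_inv p))).trans (mfderivWithin_extChartAt_symm_inverse_apply (X p))

variable [J.Boundaryless]

omit [IsManifold J ∞ P] in
theorem mvfderiv_eq_fderiv {g : P → ℝ} {p : P} (hg : MDifferentiableAt J 𝓘(ℝ, ℝ) g p) (v : V) :
    mvfderiv J g p v = fderiv ℝ (g ∘ (extChartAt J p).symm) (extChartAt J p p) v := by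
  rw [hg.mvfderiv, J.range_eq_univ, fderivWithin_univ]
  rfl

theorem differentiableAt_chartField [CompleteSpace V] {X : ∀ x : P, TangentSpace J x} {p : P}
    (hX : MDifferentiableAt J J.tangent (fun x => (⟨x, X x⟩ : TangentBundle J P)) p) :
    DifferentiableAt ℝ (chartField J p X) (extChartAt J p p) := by
  have : IsManifold J 2 P := IsManifold.of_le (n := ∞) (by norm_cast)
  have hchart :=
    (hX.mdifferentiableWithinAt (s := univ)).differentiableWithinAt_mpullbackWithin_vectorField
  rw [preimage_univ, univ_inter] at hchart
  exact hchart.differentiableAt (by rw [J.range_eq_univ]; exact univ_mem)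

theorem fderiv_chartField {g : P → ℝ} (hg : MDifferentiable J 𝓘(ℝ, ℝ) g)
    (X : ∀ x : P, TangentSpace J x) (p : P) {y : V} (hy : y ∈ (extChartAt J p).target) :
    fderiv ℝ (g ∘ (extChartAt J p).symm) y (chartField J p X y)
      = mvfderiv J g ((extChartAt J p).symm y) (X ((extChartAt J p).symm y)) := by
  have hsymm := mdifferentiableWithinAt_extChartAt_symm (I := J) hy
  have hinv := isInvertible_mfderivWithin_extChartAt_symm (I := J) hy
  rw [chartField, VectorField.mpullbackWithin_apply]
  rw [J.range_eq_univ, mdifferentiableWithinAt_univ] at hsymm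
  rw [J.range_eq_univ, mfderivWithin_univ] at *
  rw [← mfderiv_eq_fderiv, mfderiv_comp _ (hg _) hsymm]
  obtain ⟨e, he⟩ := hinv
  change mfderiv J 𝓘(ℝ, ℝ) g _ (mfderiv 𝓘(ℝ, V) J (extChartAt J p).symm y _) = _
  rw [← he, ContinuousLinearMap.inverse_equiv]
  exact congrArg (mfderiv J 𝓘(ℝ, ℝ) g _) (e.apply_symm_apply _)

omit [J.Boundaryless] in
theorem mdifferentiableAt_of_comp_extChartAt_symm {h : P → ℝ} {p : P}
    (hh : DifferentiableAt ℝ (h ∘ (extChartAt J p).symm) (extChartAt J p p)) :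
    MDifferentiableAt J 𝓘(ℝ, ℝ) h p := by
  have : IsManifold J 1 P := IsManifold.of_le (n := ∞) (by norm_cast)
  refine (hh.mdifferentiableAt.comp p
    (mdifferentiableAt_extChartAt (mem_chart_source H p))).congr_of_eventuallyEq ?_
  filter_upwards [extChartAt_source_mem_nhds (I := J) p] with x hx
  exact congrArg h ((extChartAt J p).left_inv hx).symm

theorem contDiffAt_comp_extChartAt_symm {g : P → ℝ} (hg : ContMDiff J 𝓘(ℝ, ℝ) ∞ g) (p : P) :
    ContDiffAt ℝ ∞ (g ∘ (extChartAt J p).symm) (extChartAt J p p) :=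
  (hg.contMDiffAt.comp _ ((contMDiffOn_extChartAt_symm p).contMDiffAt
    (extChartAt_target_mem_nhds p))).contDiffAt

theorem mvfderiv_mvfderiv [CompleteSpace V] {g : P → ℝ} (hg : ContMDiff J 𝓘(ℝ, ℝ) ∞ g)
    (X : ∀ x : P, TangentSpace J x) {Y : ∀ x : P, TangentSpace J x} {p : P}
    (hY : MDifferentiableAt J J.tangent (fun x => (⟨x, Y x⟩ : TangentBundle J P)) p) :
    mvfderiv J (fun x => mvfderiv J g x (Y x)) p (X p)
      = fderiv ℝ (fderiv ℝ (g ∘ (extChartAt J p).symm)) (extChartAt J p p)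
          (chartField J p X (extChartAt J p p)) (chartField J p Y (extChartAt J p p))
        + fderiv ℝ (g ∘ (extChartAt J p).symm) (extChartAt J p p)
          (fderiv ℝ (chartField J p Y) (extChartAt J p p)
            (chartField J p X (extChartAt J p p))) := by
  set φ := extChartAt J p
  have hG := contDiffAt_comp_extChartAt_symm hg p
  have hchart : (fun x => mvfderiv J g x (Y x)) ∘ φ.symm
      =ᶠ[𝓝 (φ p)] fun y => fderiv ℝ (g ∘ φ.symm) y (chartField J p Y y) := by
    filter_upwards [extChartAt_target_mem_nhds p] with y hy
    exact (fderiv_chartField (hg.mdifferentiable (by simp)) Y p hy).symm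
  have hderiv := HasFDerivAt.clm_apply
    ((hG.fderiv_right (m := ∞) (by simp)).differentiableAt (by simp)).hasFDerivAt
    (differentiableAt_chartField hY).hasFDerivAt
  have hdiff := mdifferentiableAt_of_comp_extChartAt_symm
    (hderiv.congr_of_eventuallyEq hchart).differentiableAt
  rw [chartField_extChartAt_self p X]
  refine (mvfderiv_eq_fderiv hdiff _).trans ?_
  rw [hchart.fderiv_eq, hderiv.fderiv]
  exact add_comm _ _

theorem mlieBracket_eq_lieBracket_chartField (X Y : ∀ x : P, TangentSpace J x) (p : P) :
    (VectorField.mlieBracket J X Y p : V)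
      = VectorField.lieBracket ℝ (chartField J p X) (chartField J p Y) (extChartAt J p p) := by
  rw [← VectorField.mlieBracketWithin_univ, VectorField.mlieBracketWithin_apply,
    mfderiv_extChartAt_self, preimage_univ, univ_inter]
  change (ContinuousLinearMap.id ℝ V).inverse
    (VectorField.lieBracketWithin ℝ (chartField J p X) (chartField J p Y) (range J) _) = _
  rw [ContinuousLinearMap.inverse_id, J.range_eq_univ, VectorField.lieBracketWithin_univ]
  rfl

theorem mvfderiv_mlieBracket [CompleteSpace V] {g : P → ℝ} (hg : ContMDiff J 𝓘(ℝ, ℝ) ∞ g)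
    {X Y : ∀ x : P, TangentSpace J x} {p : P}
    (hX : MDifferentiableAt J J.tangent (fun x => (⟨x, X x⟩ : TangentBundle J P)) p)
    (hY : MDifferentiableAt J J.tangent (fun x => (⟨x, Y x⟩ : TangentBundle J P)) p) :
    mvfderiv J g p (VectorField.mlieBracket J X Y p)
      = mvfderiv J (fun x => mvfderiv J g x (Y x)) p (X p)
        - mvfderiv J (fun x => mvfderiv J g x (X x)) p (Y p) := by
  have hsymm : IsSymmSndFDerivAt ℝ (g ∘ (extChartAt J p).symm) (extChartAt J p p) :=
    (contDiffAt_comp_extChartAt_symm hg p).isSymmSndFDerivAt (by simp; norm_cast)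
  rw [mvfderiv_mvfderiv hg X hY, mvfderiv_mvfderiv hg Y hX, hsymm.eq, add_sub_add_left_eq_sub,
    ← map_sub]
  refine (mvfderiv_eq_fderiv (hg.mdifferentiableAt (by simp)) _).trans ?_
  rw [mlieBracket_eq_lieBracket_chartField, VectorField.lieBracket]

end Commutator

section Coordinates

variable {n : ℕ} {Q : Type*} [TopologicalSpace Q] [ChartedSpace (EuclideanSpace ℝ (Fin n)) Q]
  {F : Type*} [NormedAddCommGroup F] [NormedSpace ℝ F]
  {E : Q → Type*} [∀ q, AddCommGroup (E q)] [∀ q, Module ℝ (E q)]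
  [∀ q, TopologicalSpace (E q)] [TopologicalSpace (TotalSpace F E)]
  [FiberBundle F E]

namespace LocalCoords

variable (κ : LocalCoords n F E)

/-- The coefficients of a vector in the local frame. -/
abbrev coeff (α : Fin (finrank ℝ F)) (q : Q) : E q →ₗ[ℝ] ℝ := κ.isLocalFrameOn.coeff α q

theorem coeff_eq_equivFun {q : Q} (hq : q ∈ κ.chart.source) (v : E q) (α : Fin (finrank ℝ F)) :
    κ.coeff α q v = (κ.isLocalFrameOn.toBasisAt hq).equivFun v α := by
  simp [coeff, IsLocalFrameOn.coeff, hq]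

theorem sum_coeff_smul {q : Q} (hq : q ∈ κ.chart.source) (v : E q) :
    ∑ α, κ.coeff α q v • κ.frame α q = v := by
  simp only [κ.coeff_eq_equivFun hq, ← κ.isLocalFrameOn.toBasisAt_coe hq, Basis.sum_equivFun]

theorem coeff_sum_smul {q : Q} (hq : q ∈ κ.chart.source) (a : Fin (finrank ℝ F) → ℝ)
    (α : Fin (finrank ℝ F)) : κ.coeff α q (∑ β, a β • κ.frame β q) = a α := by
  simp only [κ.coeff_eq_equivFun hq, ← κ.isLocalFrameOn.toBasisAt_coe hq,
    ← Basis.equivFun_symm_apply, LinearEquiv.apply_symm_apply]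

theorem coeff_frame {q : Q} (hq : q ∈ κ.chart.source) (α β : Fin (finrank ℝ F)) :
    κ.coeff α q (κ.frame β q) = if β = α then 1 else 0 := by
  simpa [Pi.single_apply, eq_comm] using κ.coeff_sum_smul hq (Pi.single β 1) α

theorem mem_nhds_baseSet_inter_source {q : Q} (hq : q ∈ κ.chart.source) :
    (trivializationAt F E q).baseSet ∩ κ.chart.source ∈ 𝓝 q :=
  ((trivializationAt F E q).open_baseSet.inter κ.chart.open_source).mem_nhds
    ⟨FiberBundle.mem_baseSet_trivializationAt' q, hq⟩

/-- The linear map `y ↦ y^α e_α(q)`, written in the trivialization of `E` around `q₀`. -/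
def frameMap (q₀ q : Q) : (Fin (finrank ℝ F) → ℝ) →L[ℝ] F :=
  ∑ α, (ContinuousLinearMap.proj (R := ℝ) (φ := fun _ : Fin (finrank ℝ F) => ℝ) α).smulRight
    (secRep F (κ.frame α) q₀ q)

theorem frameMap_apply (q₀ q : Q) (y : Fin (finrank ℝ F) → ℝ) :
    κ.frameMap q₀ q y = ∑ α, y α • secRep F (κ.frame α) q₀ q := by
  simp [frameMap]

variable [VectorBundle ℝ F E]

/-- The isomorphism of coordinate spaces underlying `frameMap`. -/
def frameEquiv {q₀ q : Q} (hq₀ : q ∈ (trivializationAt F E q₀).baseSet)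
    (hq : q ∈ κ.chart.source) : (Fin (finrank ℝ F) → ℝ) ≃L[ℝ] F :=
  ((κ.isLocalFrameOn.toBasisAt hq).equivFun.symm.trans
    ((trivializationAt F E q₀).linearEquivAt ℝ q hq₀)).toContinuousLinearEquiv

theorem coe_frameEquiv {q₀ q : Q} (hq₀ : q ∈ (trivializationAt F E q₀).baseSet)
    (hq : q ∈ κ.chart.source) :
    (κ.frameEquiv hq₀ hq : (Fin (finrank ℝ F) → ℝ) →L[ℝ] F) = κ.frameMap q₀ q := by
  ext y
  change (trivializationAt F E q₀).linearEquivAt ℝ q hq₀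
    ((κ.isLocalFrameOn.toBasisAt hq).equivFun.symm y) = _
  rw [frameMap_apply, Basis.equivFun_symm_apply, map_sum]
  simp only [map_smul, IsLocalFrameOn.toBasisAt_coe]
  rfl

theorem frameEquiv_symm_apply {q₀ q : Q} (hq₀ : q ∈ (trivializationAt F E q₀).baseSet)
    (hq : q ∈ κ.chart.source) (v : E q) (α : Fin (finrank ℝ F)) :
    (κ.frameEquiv hq₀ hq).symm (trivializationAt F E q₀ ⟨q, v⟩).2 α = κ.coeff α q v := by
  rw [κ.coeff_eq_equivFun hq]
  exact congrFun (congrArg (κ.isLocalFrameOn.toBasisAt hq).equivFun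
    (((trivializationAt F E q₀).linearEquivAt ℝ q hq₀).symm_apply_apply v)) α

/-- The inverse of `frameMap` (the zero map where the frame or the trivialization is not
defined). -/
def coframeMap (q₀ q : Q) : F →L[ℝ] (Fin (finrank ℝ F) → ℝ) := (κ.frameMap q₀ q).inverse

theorem coframeMap_apply {q₀ q : Q} (hq₀ : q ∈ (trivializationAt F E q₀).baseSet)
    (hq : q ∈ κ.chart.source) (v : E q) (α : Fin (finrank ℝ F)) :
    κ.coframeMap q₀ q (trivializationAt F E q₀ ⟨q, v⟩).2 α = κ.coeff α q v := by
  rw [coframeMap, ← κ.coe_frameEquiv hq₀ hq, ContinuousLinearMap.inverse_equiv]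
  exact κ.frameEquiv_symm_apply hq₀ hq v α

theorem contMDiffOn_frameMap [ContMDiffVectorBundle ∞ F E (𝓡 n)] (q₀ : Q) :
    ContMDiffOn (𝓡 n) 𝓘(ℝ, (Fin (finrank ℝ F) → ℝ) →L[ℝ] F) ∞ (κ.frameMap q₀)
      ((trivializationAt F E q₀).baseSet ∩ κ.chart.source) :=
  contMDiffOn_finsetSum fun α _ =>
    (ContinuousLinearMap.smulRightL ℝ (Fin (finrank ℝ F) → ℝ) F
      (ContinuousLinearMap.proj (R := ℝ) (φ := fun _ : Fin (finrank ℝ F) => ℝ) α)).contMDiff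
      |>.comp_contMDiffOn (contMDiffOn_secRep (κ.isLocalFrameOn.contMDiffOn α))

variable {V H P : Type*} [NormedAddCommGroup V] [NormedSpace ℝ V] [TopologicalSpace H]
  {J : ModelWithCorners ℝ V H} [TopologicalSpace P] [ChartedSpace H P] {p : P}

theorem contMDiffAt_apply_frame {f : P → TotalSpace (F →L[ℝ] ℝ) (DualBundle E)}
    (hf : ContMDiffAt J ((𝓡 n).prod 𝓘(ℝ, F →L[ℝ] ℝ)) ∞ f p) (hp : (f p).proj ∈ κ.chart.source)
    (α : Fin (finrank ℝ F)) :
    ContMDiffAt J 𝓘(ℝ, ℝ) ∞ (fun x => (f x).2 (κ.frame α (f x).proj)) p := by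
  have hproj : ContMDiffAt J (𝓡 n) ∞ (fun x => (f x).proj) p :=
    ((contMDiffAt_hom_bundle _).1 hf).1
  have hframe := (κ.isLocalFrameOn.contMDiffAt κ.chart.open_source hp α).comp p hproj
  exact (contMDiffAt_totalSpace.1 (ContMDiffAt.clm_bundle_apply (F₂ := ℝ)
    (E₂ := Bundle.Trivial Q ℝ) (b := fun x => (f x).proj) (ϕ := fun x => (f x).2) hf hframe)).2

section ToDual

variable [FiniteDimensional ℝ F]

theorem toDual_sum_smul_coeff_apply (q : Q) (y : Fin (finrank ℝ F) → ℝ) (v : E q) :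
    toDual (F := F) q (∑ α, y α • κ.coeff α q) v = ∑ α, y α * κ.coeff α q v := by
  change (∑ α, y α • κ.coeff α q) v = _
  simp

theorem toDual_apply_frame {q : Q} (hq : q ∈ κ.chart.source) (y : Fin (finrank ℝ F) → ℝ)
    (α : Fin (finrank ℝ F)) :
    toDual (F := F) q (∑ β, y β • κ.coeff β q) (κ.frame α q) = y α := by
  simp [toDual_sum_smul_coeff_apply, κ.coeff_frame hq]

theorem toDual_sum_apply_frame {q : Q} (hq : q ∈ κ.chart.source) (l : DualBundle E q) :
    toDual (F := F) q (∑ β, l (κ.frame β q) • κ.coeff β q) = l := by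
  ext v
  rw [toDual_sum_smul_coeff_apply]
  conv_rhs => rw [← κ.sum_coeff_smul hq v]
  simp [mul_comm]

theorem inCoordinates_toDual {q₀ q : Q} (hq₀ : q ∈ (trivializationAt F E q₀).baseSet)
    (hq : q ∈ κ.chart.source) (y : Fin (finrank ℝ F) → ℝ) (c : F) :
    ContinuousLinearMap.inCoordinates F E ℝ (Bundle.Trivial Q ℝ) q₀ q q₀ q
      (toDual (F := F) q (∑ α, y α • κ.coeff α q)) c = ∑ α, y α * κ.coframeMap q₀ q c α := by
  have hc : (trivializationAt F E q₀ ⟨q, (trivializationAt F E q₀).symmL ℝ q c⟩).2 = c := by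
    rw [Trivialization.symmL_apply _ hq₀, Trivialization.apply_mk_symm _ hq₀]
  conv_rhs => rw [← hc]
  simp only [κ.coframeMap_apply hq₀ hq, ← κ.toDual_sum_smul_coeff_apply]
  simp [ContinuousLinearMap.inCoordinates]

end ToDual

variable [ContMDiffVectorBundle ∞ F E (𝓡 n)]

theorem contMDiffAt_coframeMap {q : Q} (hq : q ∈ κ.chart.source) :
    ContMDiffAt (𝓡 n) 𝓘(ℝ, F →L[ℝ] (Fin (finrank ℝ F) → ℝ)) ∞ (κ.coframeMap q) q := by
  have hinv : ContDiffAt ℝ ∞ ContinuousLinearMap.inverse (κ.frameMap q q) :=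
    κ.coe_frameEquiv (FiberBundle.mem_baseSet_trivializationAt' q) hq ▸ contDiffAt_map_inverse _
  exact hinv.contMDiffAt.comp q
    ((κ.contMDiffOn_frameMap q).contMDiffAt (κ.mem_nhds_baseSet_inter_source hq))

theorem contMDiffAt_coeff {f : P → TotalSpace F E}
    (hf : ContMDiffAt J ((𝓡 n).prod 𝓘(ℝ, F)) ∞ f p) (hp : (f p).proj ∈ κ.chart.source) :
    ContMDiffAt J 𝓘(ℝ, Fin (finrank ℝ F) → ℝ) ∞
      (fun x => fun α => κ.coeff α (f x).proj (f x).2) p := by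
  obtain ⟨hproj, hfib⟩ := contMDiffAt_totalSpace.1 hf
  refine (((κ.contMDiffAt_coframeMap hp).comp p hproj).clm_apply hfib).congr_of_eventuallyEq ?_
  filter_upwards [hproj.continuousAt.eventually_mem (κ.mem_nhds_baseSet_inter_source hp)] with x hx
  exact funext fun α => (κ.coframeMap_apply hx.1 hx.2 (f x).2 α).symm

theorem contMDiffAt_sum_smul_frame {b : P → Q} {y : P → Fin (finrank ℝ F) → ℝ}
    (hb : ContMDiffAt J (𝓡 n) ∞ b p) (hp : b p ∈ κ.chart.source)
    (hy : ContMDiffAt J 𝓘(ℝ, Fin (finrank ℝ F) → ℝ) ∞ y p) :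
    ContMDiffAt J ((𝓡 n).prod 𝓘(ℝ, F)) ∞
      (fun x => (⟨b x, ∑ α, y x α • κ.frame α (b x)⟩ : TotalSpace F E)) p := by
  refine contMDiffAt_totalSpace.2 ⟨hb, ?_⟩
  have hn := κ.mem_nhds_baseSet_inter_source hp
  refine ((((κ.contMDiffOn_frameMap (b p)).contMDiffAt hn).comp p hb).clm_apply
    hy).congr_of_eventuallyEq ?_
  filter_upwards [hb.continuousAt.eventually_mem hn] with x hx
  exact (secRep_sum_smul _ hx.1 (y x) κ.frame).trans (κ.frameMap_apply (b p) (b x) (y x)).symm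

theorem contMDiffAt_toDual [FiniteDimensional ℝ F] {b : P → Q} {y : P → Fin (finrank ℝ F) → ℝ}
    (hb : ContMDiffAt J (𝓡 n) ∞ b p) (hp : b p ∈ κ.chart.source)
    (hy : ContMDiffAt J 𝓘(ℝ, Fin (finrank ℝ F) → ℝ) ∞ y p) :
    ContMDiffAt J ((𝓡 n).prod 𝓘(ℝ, F →L[ℝ] ℝ)) ∞
      (fun x => (⟨b x, toDual (F := F) (b x) (∑ α, y x α • κ.coeff α (b x))⟩ :
        TotalSpace (F →L[ℝ] ℝ) (DualBundle E))) p := by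
  refine (contMDiffAt_hom_bundle _).2 ⟨hb, ?_⟩
  let dot : (Fin (finrank ℝ F) → ℝ) →L[ℝ] ((Fin (finrank ℝ F) → ℝ) →L[ℝ] ℝ) :=
    ∑ α, (ContinuousLinearMap.proj (R := ℝ) (φ := fun _ : Fin (finrank ℝ F) => ℝ) α).smulRight
      (ContinuousLinearMap.proj (R := ℝ) (φ := fun _ : Fin (finrank ℝ F) => ℝ) α)
  refine ((dot.contMDiff.contMDiffAt.comp p hy).clm_comp
    ((κ.contMDiffAt_coframeMap hp).comp p hb)).congr_of_eventuallyEq ?_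
  filter_upwards [hb.continuousAt.eventually_mem (κ.mem_nhds_baseSet_inter_source hp)] with x hx
  ext c
  refine (κ.inCoordinates_toDual hx.1 hx.2 (y x) c).trans ?_
  simp [dot]

end LocalCoords

theorem exists_localCoords [IsManifold (𝓡 n) ∞ Q] [FiniteDimensional ℝ F] [VectorBundle ℝ F E]
    [ContMDiffVectorBundle ∞ F E (𝓡 n)] (q : Q) :
    ∃ κ : LocalCoords n F E, q ∈ κ.chart.source := by
  let e := trivializationAt F E q
  let φ := (chartAt (EuclideanSpace ℝ (Fin n)) q).restr e.baseSet
  have hs : φ.source = (chartAt (EuclideanSpace ℝ (Fin n)) q).source ∩ e.baseSet := by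
    simp [φ, e.open_baseSet.interior_eq]
  refine ⟨⟨φ, ?_, e.localFrame (Module.finBasis ℝ F), ?_⟩, ?_⟩
  · exact restr_mem_maximalAtlas _ (IsManifold.chart_mem_maximalAtlas q) e.open_baseSet
  · exact (e.isLocalFrameOn_localFrame_baseSet (𝓡 n) ∞ _).mono (hs ▸ inter_subset_right)
  · change q ∈ φ.source
    rw [hs]
    exact ⟨mem_chart_source _ q, FiberBundle.mem_baseSet_trivializationAt' q⟩

end Coordinates

section TangentMap

variable {V H : Type*} [NormedAddCommGroup V] [NormedSpace ℝ V] [TopologicalSpace H]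
  {J : ModelWithCorners ℝ V H}
  {P : Type*} [TopologicalSpace P] [ChartedSpace H P] [IsManifold J ∞ P]
  {V' H' : Type*} [NormedAddCommGroup V'] [NormedSpace ℝ V'] [TopologicalSpace H']
  {J' : ModelWithCorners ℝ V' H'}
  {P' : Type*} [TopologicalSpace P'] [ChartedSpace H' P']
  {V₂ H₂ : Type*} [NormedAddCommGroup V₂] [NormedSpace ℝ V₂] [TopologicalSpace H₂]
  {J₂ : ModelWithCorners ℝ V₂ H₂} {P₂ : Type*} [TopologicalSpace P₂] [ChartedSpace H₂ P₂]
  {G : Type*} [NormedAddCommGroup G] [NormedSpace ℝ G]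
  {u : Set P} {b : P₂ → P} {v : ∀ x, TangentSpace J (b x)} {x : P₂}

theorem contMDiffAt_mfderiv_apply [IsManifold J' ∞ P'] {g : P → P'} (hu : IsOpen u)
    (hg : ContMDiffOn J J' ∞ g u) (hx : b x ∈ u)
    (hv : ContMDiffAt J₂ J.tangent ∞ (fun x => (⟨b x, v x⟩ : TangentBundle J P)) x) :
    ContMDiffAt J₂ J'.tangent ∞
      (fun x => (⟨g (b x), mfderiv J J' g (b x) (v x)⟩ : TangentBundle J' P')) x := by
  have htangent := hg.contMDiffOn_tangentMapWithin (m := ∞) (by simp) hu.uniqueMDiffOn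
  have hb : ContMDiffAt J₂ J ∞ b x := (contMDiffAt_totalSpace.1 hv).1
  have hn : π V (TangentSpace J) ⁻¹' u ∈ 𝓝 (⟨b x, v x⟩ : TangentBundle J P) :=
    (hu.preimage (FiberBundle.continuous_proj V _)).mem_nhds hx
  refine ((htangent.contMDiffAt hn).comp x hv).congr_of_eventuallyEq ?_
  filter_upwards [hb.continuousAt.eventually_mem (hu.mem_nhds hx)] with y hy
  simp only [Function.comp, tangentMapWithin]
  rw [mfderivWithin_of_isOpen hu hy]

theorem contMDiffAt_mvfderiv_apply {g : P → G} (hu : IsOpen u)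
    (hg : ContMDiffOn J 𝓘(ℝ, G) ∞ g u) (hx : b x ∈ u)
    (hv : ContMDiffAt J₂ J.tangent ∞ (fun x => (⟨b x, v x⟩ : TangentBundle J P)) x) :
    ContMDiffAt J₂ 𝓘(ℝ, G) ∞ (fun x => mvfderiv J g (b x) (v x)) x :=
  ((contMDiff_snd_tangentBundle_modelSpace G 𝓘(ℝ, G)).contMDiffAt).comp x
    (contMDiffAt_mfderiv_apply hu hg hx hv)

end TangentMap

section ExtDeriv

variable {n : ℕ} {Q : Type*} [TopologicalSpace Q] [ChartedSpace (EuclideanSpace ℝ (Fin n)) Q]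
  [IsManifold (𝓡 n) ∞ Q]
  {F : Type*} [NormedAddCommGroup F] [NormedSpace ℝ F]
  {E : Q → Type*} [∀ q, AddCommGroup (E q)] [∀ q, Module ℝ (E q)]
  [∀ q, TopologicalSpace (E q)] [TopologicalSpace (TotalSpace F E)]
  [FiberBundle F E] [VectorBundle ℝ F E] [ContMDiffVectorBundle ∞ F E (𝓡 n)]

theorem LocalCoords.localBracket_sum_smul_constSec [T2Space Q] [FiniteDimensional ℝ F]
    (κ : LocalCoords n F E) (A : LieAlgebroid n F E) {q : Q} (hq : q ∈ κ.chart.source)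
    (a b : Fin (finrank ℝ F) → ℝ) :
    A.localBracket (constSec q (∑ α, a α • secRep F (κ.frame α) q q))
        (constSec q (∑ α, b α • secRep F (κ.frame α) q q)) q
      = ∑ α, ∑ β, (a α * b β) • A.localBracket (κ.frame α) (κ.frame β) q
        - constSec q (∑ α, b α • mvfderiv (𝓡 n) (secRep F (κ.frame α) q) q
            (A.anchor q (∑ β, a β • κ.frame β q))
          - ∑ α, a α • mvfderiv (𝓡 n) (secRep F (κ.frame α) q) q
            (A.anchor q (∑ β, b β • κ.frame β q))) q := by
  have hm := FiberBundle.mem_baseSet_trivializationAt' (F := F) (E := E) q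
  obtain ⟨B, hB⟩ := A.exists_bilin_localBracket q
  have hframe := fun α β => hB _ κ.chart.open_source hq (κ.frame α) (κ.frame β)
    (κ.isLocalFrameOn.contMDiffOn α) (κ.isLocalFrameOn.contMDiffOn β)
  have hconst : ∀ c : F, secRep F (constSec q c : ∀ x, E x) q =ᶠ[𝓝 q] fun _ => c := fun c => by
    filter_upwards [(trivializationAt F E q).open_baseSet.mem_nhds hm] with x hx
    simp [secRep, constSec, hx]
  have hconst_deriv : ∀ (c : F) v, mvfderiv (𝓡 n) (secRep F (constSec q c : ∀ x, E x) q) q v = 0 :=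
    fun c v => by rw [mvfderiv_congr (hconst c), mvfderiv_const, zero_apply]
  rw [hB _ (trivializationAt F E q).open_baseSet hm _ _ (contMDiffOn_constSec q _)
    (contMDiffOn_constSec q _), hconst_deriv, hconst_deriv, sub_zero, constSec_eq_symmL hm,
    map_zero, zero_add, (hconst _).self_of_nhds, (hconst _).self_of_nhds]
  simp only [hframe, constSec_eq_symmL hm, smul_add, Finset.sum_add_distrib, map_sub, map_sum,
    map_smul, LinearMap.sum_apply, LinearMap.smul_apply, Finset.smul_sum, smul_sub,
    Finset.sum_sub_distrib, smul_smul]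
  rw [Finset.sum_comm (f := fun α β => (b α * a β) • _),
    Finset.sum_comm (f := fun α β => (b α * a β) • _)]
  simp only [mul_comm (b _)]
  abel

variable {V H : Type*} [NormedAddCommGroup V] [NormedSpace ℝ V] [TopologicalSpace H]
  {J : ModelWithCorners ℝ V H}
  {P : Type*} [TopologicalSpace P] [ChartedSpace H P] [IsManifold J ∞ P]
  {A : LieAlgebroid n F E} {pr : P → Q}

namespace ProlSec

variable (κ : LocalCoords n F E) (Z W : ProlSec J A pr)

/-- The coefficients of the first component of a section of the prolongation in a local frame. -/
def coeff (α : Fin (finrank ℝ F)) (p : P) : ℝ := κ.coeff α (pr p) (Z p).1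

variable {p : P} (hp : pr p ∈ κ.chart.source)
include hp

theorem contMDiffAt_coeff (α : Fin (finrank ℝ F)) :
    ContMDiffAt J 𝓘(ℝ, ℝ) ∞ (Z.coeff κ α) p :=
  contMDiffAt_pi_space.1 (κ.contMDiffAt_coeff (Z.contMDiff_fst p) hp) α

theorem mdifferentiableAt_coeff (α : Fin (finrank ℝ F)) :
    MDifferentiableAt J 𝓘(ℝ, ℝ) (Z.coeff κ α) p :=
  (Z.contMDiffAt_coeff κ hp α).mdifferentiableAt (by simp)

omit [ContMDiffVectorBundle ∞ F E (𝓡 n)] in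
theorem sum_coeff_smul : ∑ α, Z.coeff κ α p • κ.frame α (pr p) = (Z p).1 :=
  κ.sum_coeff_smul hp _

variable (hpr : MDifferentiable J (𝓡 n) pr)
include hpr

omit [ContMDiffVectorBundle ∞ F E (𝓡 n)] in
theorem localRep_eventuallyEq :
    Z.localRep p =ᶠ[𝓝 p]
      fun x => ∑ α, Z.coeff κ α x • secRep F (κ.frame α) (pr p) (pr x) := by
  filter_upwards [hpr.continuous.continuousAt.eventually_mem
    (κ.mem_nhds_baseSet_inter_source hp)] with x hx
  rw [← secRep_sum_smul _ hx.1, secRep, Z.sum_coeff_smul κ hx.2]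
  rfl

theorem mvfderiv_localRep (v : TangentSpace J p) :
    mvfderiv J (Z.localRep p) p v =
      ∑ α, mvfderiv J (Z.coeff κ α) p v • secRep F (κ.frame α) (pr p) (pr p)
        + ∑ α, Z.coeff κ α p • mvfderiv (𝓡 n) (secRep F (κ.frame α) (pr p)) (pr p)
          (mfderiv J (𝓡 n) pr p v) := by
  have hframe : ∀ α, MDifferentiableAt (𝓡 n) 𝓘(ℝ, F) (secRep F (κ.frame α) (pr p)) (pr p) :=
    fun α => ((contMDiffOn_secRep (κ.isLocalFrameOn.contMDiffOn α)).contMDiffAt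
      (κ.mem_nhds_baseSet_inter_source hp)).mdifferentiableAt (by simp)
  have hframe_pr : ∀ α, MDifferentiableAt J 𝓘(ℝ, F)
      (fun x => secRep F (κ.frame α) (pr p) (pr x)) p := fun α => (hframe α).comp p (hpr p)
  have hsmul : ∀ α, MDifferentiableAt J 𝓘(ℝ, F)
      (fun x => Z.coeff κ α x • secRep F (κ.frame α) (pr p) (pr x)) p :=
    fun α => (Z.mdifferentiableAt_coeff κ hp α).smul (hframe_pr α)
  have hchain : ∀ α, mvfderiv J (fun x => secRep F (κ.frame α) (pr p) (pr x)) p v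
      = mvfderiv (𝓡 n) (secRep F (κ.frame α) (pr p)) (pr p) (mfderiv J (𝓡 n) pr p v) :=
    fun α => mfderiv_comp_apply p (hframe α) (hpr p) v
  rw [mvfderiv_congr (Z.localRep_eventuallyEq κ hp hpr),
    mvfderiv_finset_sum _ fun α _ => hsmul α, ← Finset.sum_add_distrib]
  refine Finset.sum_congr rfl fun α _ => ?_
  rw [mvfderiv_fun_smul (Z.mdifferentiableAt_coeff κ hp α) (hframe_pr α), ← hchain]
  exact add_comm _ _

variable [T2Space Q] [FiniteDimensional ℝ F]

theorem prolBracket_fst :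
    (prolBracket Z W p).1 =
      ∑ α, (mvfderiv J (W.coeff κ α) p (Z p).2 - mvfderiv J (Z.coeff κ α) p (W p).2)
        • κ.frame α (pr p)
      + ∑ α, ∑ β, (Z.coeff κ α p * W.coeff κ β p)
        • A.localBracket (κ.frame α) (κ.frame β) (pr p) := by
  have hm := FiberBundle.mem_baseSet_trivializationAt' (F := F) (E := E) (pr p)
  have hanchor : ∀ Z : ProlSec J A pr, mfderiv J (𝓡 n) pr p (Z p).2
      = A.anchor (pr p) (∑ α, Z.coeff κ α p • κ.frame α (pr p)) := fun Z => by
    rw [Z.sum_coeff_smul κ hp, Z.mem p]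
  have hframe : ∀ α, constSec (pr p) (secRep F (κ.frame α) (pr p) (pr p)) (pr p)
      = κ.frame α (pr p) := fun α => constSec_secRep hm _
  change constSec (pr p) (mvfderiv J (W.localRep p) p (Z p).2
    - mvfderiv J (Z.localRep p) p (W p).2) (pr p) + _ = _
  rw [(Z.localRep_eventuallyEq κ hp hpr).self_of_nhds,
    (W.localRep_eventuallyEq κ hp hpr).self_of_nhds, κ.localBracket_sum_smul_constSec A hp,
    W.mvfderiv_localRep κ hp hpr, Z.mvfderiv_localRep κ hp hpr, hanchor, hanchor]
  simp only [constSec_eq_symmL hm, map_sub, map_add, map_sum, map_smul] at hframe ⊢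
  simp only [hframe, sub_smul, Finset.sum_sub_distrib]
  abel

end ProlSec

/-- The `1`-section `ds - λ`, where `λ` is a family of covectors of `E` along `pr`. Both `η_L` and
`η` are of this form. -/
def contactForm (J : ModelWithCorners ℝ V H) (s : P → ℝ) (l : ∀ p, DualBundle E (pr p)) :
    OneSec E J pr := fun p =>
  (mvfderiv J s p).toLinearMap ∘ₗ LinearMap.snd ℝ _ _ - (l p).toLinearMap ∘ₗ LinearMap.fst ℝ _ _

variable (κ : LocalCoords n F E) (hpr : MDifferentiable J (𝓡 n) pr) {s : P → ℝ}
  (hs : ContMDiff J 𝓘(ℝ, ℝ) ∞ s) {l : ∀ p, DualBundle E (pr p)} (Z W : ProlSec J A pr) {p : P}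
  (hp : pr p ∈ κ.chart.source)
  (hl : ∀ α, MDifferentiableAt J 𝓘(ℝ, ℝ) (fun x => l x (κ.frame α (pr x))) p)
include hpr hs hp hl

theorem mvfderiv_contactForm_apply (v : TangentSpace J p) :
    mvfderiv J (fun x => contactForm J s l x (Z x)) p v =
      mvfderiv J (fun x => mvfderiv J s x (Z x).2) p v
      - ∑ α, (Z.coeff κ α p * mvfderiv J (fun x => l x (κ.frame α (pr x))) p v
        + l p (κ.frame α (pr p)) * mvfderiv J (Z.coeff κ α) p v) := by
  have hrepr : (fun x => contactForm J s l x (Z x)) =ᶠ[𝓝 p] fun x =>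
      mvfderiv J s x (Z x).2 - ∑ α, Z.coeff κ α x * l x (κ.frame α (pr x)) := by
    filter_upwards [hpr.continuous.continuousAt.eventually_mem
      (κ.chart.open_source.mem_nhds hp)] with x hx
    change _ - l x (Z x).1 = _
    rw [← Z.sum_coeff_smul κ hx, map_sum]
    simp only [map_smul, smul_eq_mul]
    rfl
  have hds : MDifferentiableAt J 𝓘(ℝ, ℝ) (fun x => mvfderiv J s x (Z x).2) p :=
    (contMDiffAt_mvfderiv_apply isOpen_univ hs.contMDiffOn (b := id) (mem_univ p)
      Z.contMDiff_snd.contMDiffAt).mdifferentiableAt (by simp)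
  have hmul : ∀ α, MDifferentiableAt J 𝓘(ℝ, ℝ)
      (fun x => Z.coeff κ α x * l x (κ.frame α (pr x))) p :=
    fun α => (Z.mdifferentiableAt_coeff κ hp α).mul (hl α)
  have hsum : MDifferentiableAt J 𝓘(ℝ, ℝ)
      (fun x => ∑ α, Z.coeff κ α x * l x (κ.frame α (pr x))) p :=
    Finset.sum_fn Finset.univ (fun α x => Z.coeff κ α x * l x (κ.frame α (pr x))) ▸
      MDifferentiableAt.sum fun α _ => hmul α
  rw [mvfderiv_congr hrepr, mvfderiv_fun_sub hds hsum]
  change _ - mvfderiv J (fun x => ∑ α, Z.coeff κ α x * l x (κ.frame α (pr x))) p v = _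
  rw [mvfderiv_finset_sum _ fun α _ => (hmul α :)]
  congr 1
  refine Finset.sum_congr rfl fun α _ => ?_
  rw [mvfderiv_fun_mul (Z.mdifferentiableAt_coeff κ hp α) (hl α)]
  rfl

variable [T2Space Q] [FiniteDimensional ℝ F] [J.Boundaryless] [CompleteSpace V]

theorem extDeriv_contactForm :
    extDeriv (contactForm J s l) Z W p =
      ∑ α, (Z.coeff κ α p * mvfderiv J (fun x => l x (κ.frame α (pr x))) p (W p).2
        - W.coeff κ α p * mvfderiv J (fun x => l x (κ.frame α (pr x))) p (Z p).2)
      + ∑ α, ∑ β, Z.coeff κ α p * W.coeff κ β p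
        * l p (A.localBracket (κ.frame α) (κ.frame β) (pr p)) := by
  have hds : mvfderiv J s p (prolBracket Z W p).2
      = mvfderiv J (fun x => mvfderiv J s x (W x).2) p (Z p).2
        - mvfderiv J (fun x => mvfderiv J s x (Z x).2) p (W p).2 :=
    mvfderiv_mlieBracket hs (Z.contMDiff_snd.mdifferentiableAt (by simp))
      (W.contMDiff_snd.mdifferentiableAt (by simp))
  change _ - _ - (mvfderiv J s p (prolBracket Z W p).2 - l p (prolBracket Z W p).1) = _
  rw [hds, Z.prolBracket_fst κ W hp hpr]
  simp only [ProlSec.deriv, ProlSec.vectorField, mvfderiv_contactForm_apply κ hpr hs _ hp hl,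
    map_add, map_sum, map_smul, smul_eq_mul, Finset.sum_add_distrib, sub_mul,
    Finset.sum_sub_distrib, mul_comm (l p _)]
  ring

end ExtDeriv

section LocalInverse

variable {V H P C G : Type*} [NormedAddCommGroup V] [NormedSpace ℝ V] [TopologicalSpace H]
  {J : ModelWithCorners ℝ V H} [TopologicalSpace P] [ChartedSpace H P]
  [NormedAddCommGroup C] [NormedSpace ℝ C] [NormedAddCommGroup G] [NormedSpace ℝ G]
  {Φ : P → C} {Ψ : C → P} {p : P}

theorem mfderiv_mvfderiv_of_leftInverse (hΦ : MDifferentiableAt J 𝓘(ℝ, C) Φ p)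
    (hΨ : MDifferentiableAt 𝓘(ℝ, C) J Ψ (Φ p)) (h : ∀ᶠ x in 𝓝 p, Ψ (Φ x) = x)
    (v : TangentSpace J p) : mfderiv 𝓘(ℝ, C) J Ψ (Φ p) (mvfderiv J Φ p v) = v := by
  have hid : Ψ ∘ Φ =ᶠ[𝓝 p] id := h
  refine (mfderiv_comp_apply p hΨ hΦ v).symm.trans ?_
  rw [hid.mfderiv_eq, mfderiv_id]
  rfl

theorem mvfderiv_mfderiv_of_rightInverse (hΦ : MDifferentiableAt J 𝓘(ℝ, C) Φ p)
    (hΨ : MDifferentiableAt 𝓘(ℝ, C) J Ψ (Φ p)) (hp : Ψ (Φ p) = p)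
    (h : ∀ᶠ z in 𝓝 (Φ p), Φ (Ψ z) = z) (w : C) :
    mvfderiv J Φ p (mfderiv 𝓘(ℝ, C) J Ψ (Φ p) w : V) = w := by
  have hid : Φ ∘ Ψ =ᶠ[𝓝 (Φ p)] id := h
  have hbase : ∀ p' (v : V), p' = p →
      (mfderiv J 𝓘(ℝ, C) Φ p v : C) = mfderiv J 𝓘(ℝ, C) Φ p' v := by
    rintro _ v rfl
    rfl
  refine (hbase _ _ hp).trans ((mfderiv_comp_apply (Φ p) (hp.symm ▸ hΦ) hΨ w).symm.trans ?_)
  rw [hid.mfderiv_eq, mfderiv_id]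
  rfl

theorem mvfderiv_eq_fderiv_comp {g : P → G} (hg : MDifferentiableAt J 𝓘(ℝ, G) g p)
    (hΦ : MDifferentiableAt J 𝓘(ℝ, C) Φ p)
    (hΨ : MDifferentiableAt 𝓘(ℝ, C) J Ψ (Φ p)) (h : ∀ᶠ x in 𝓝 p, Ψ (Φ x) = x)
    (v : TangentSpace J p) :
    mvfderiv J g p v = fderiv ℝ (fun z => g (Ψ z)) (Φ p) (mvfderiv J Φ p v) := by
  have hg' : MDifferentiableAt J 𝓘(ℝ, G) g (Ψ (Φ p)) := h.self_of_nhds.symm ▸ hg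
  have hcoord : MDifferentiableAt 𝓘(ℝ, C) 𝓘(ℝ, G) (fun z => g (Ψ z)) (Φ p) := hg'.comp (Φ p) hΨ
  rw [mvfderiv_congr (h.mono fun x hx => (congrArg g hx).symm) v]
  refine (mfderiv_comp_apply p hcoord hΦ v).trans ?_
  rw [mfderiv_eq_fderiv]
  rfl

end LocalInverse

section PhaseCoordinates

variable {n : ℕ} {Q : Type*} [TopologicalSpace Q] [ChartedSpace (EuclideanSpace ℝ (Fin n)) Q]
  {F : Type*} [NormedAddCommGroup F] [NormedSpace ℝ F]

theorem fderiv_eq_sum_partial (f : CoordSpace n F → ℝ) (z w : CoordSpace n F) :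
    fderiv ℝ f z w = ∑ i, w.1 i * partialQ f i z + ∑ α, w.2.1 α * partialY f α z
      + w.2.2 * partialS f z := by
  have hw : w = ∑ i, w.1 i • ((EuclideanSpace.single i 1, 0, 0) : CoordSpace n F)
      + ∑ α, w.2.1 α • ((0, Pi.single α 1, 0) : CoordSpace n F)
      + w.2.2 • ((0, 0, 1) : CoordSpace n F) := by
    refine Prod.ext ?_ (Prod.ext ?_ ?_)
    · ext i
      simp [Prod.fst_sum, Finset.sum_apply, Pi.single_apply]
    · ext α
      simp [Prod.fst_sum, Prod.snd_sum, Finset.sum_apply, Pi.single_apply]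
    · simp [Prod.snd_sum]
  conv_lhs => rw [hw]
  simp only [map_add, map_sum, map_smul, smul_eq_mul]
  rfl

theorem contDiffAt_partialQ {f : CoordSpace n F → ℝ} {z : CoordSpace n F} (hf : ContDiffAt ℝ ∞ f z)
    (i : Fin n) : ContDiffAt ℝ ∞ (partialQ f i) z :=
  (hf.fderiv_right (m := ∞) (by simp)).clm_apply contDiffAt_const

theorem contDiffAt_partialY {f : CoordSpace n F → ℝ} {z : CoordSpace n F} (hf : ContDiffAt ℝ ∞ f z)
    (α : Fin (finrank ℝ F)) : ContDiffAt ℝ ∞ (partialY f α) z :=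
  (hf.fderiv_right (m := ∞) (by simp)).clm_apply contDiffAt_const

theorem contDiffAt_partialS {f : CoordSpace n F → ℝ} {z : CoordSpace n F}
    (hf : ContDiffAt ℝ ∞ f z) : ContDiffAt ℝ ∞ (partialS f) z :=
  (hf.fderiv_right (m := ∞) (by simp)).clm_apply contDiffAt_const

variable {E : Q → Type*} [∀ q, AddCommGroup (E q)] [∀ q, Module ℝ (E q)]
  [∀ q, TopologicalSpace (E q)] [TopologicalSpace (TotalSpace F E)]
  [FiberBundle F E]

namespace LocalCoords

variable (κ : LocalCoords n F E) {z : CoordSpace n F}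

theorem contMDiffAt_chart [IsManifold (𝓡 n) ∞ Q] {q : Q} (hq : q ∈ κ.chart.source) :
    ContMDiffAt (𝓡 n) (𝓡 n) ∞ κ.chart q :=
  contMDiffAt_of_mem_maximalAtlas κ.chart_mem hq

theorem contMDiffAt_chart_symm [IsManifold (𝓡 n) ∞ Q] {x : EuclideanSpace ℝ (Fin n)}
    (hx : x ∈ κ.chart.target) : ContMDiffAt (𝓡 n) (𝓡 n) ∞ κ.chart.symm x :=
  contMDiffAt_symm_of_mem_maximalAtlas κ.chart_mem hx

theorem eventually_mem_target (hz : z.1 ∈ κ.chart.target) : ∀ᶠ w in 𝓝 z, w.1 ∈ κ.chart.target :=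
  continuous_fst.continuousAt.eventually_mem (κ.chart.open_target.mem_nhds hz)

section Lagrangian

theorem lagPoint_lagCoords {p : LagSpace F E} (hp : p.1.proj ∈ κ.chart.source) :
    κ.lagPoint (κ.lagCoords p) = p := by
  obtain ⟨⟨q, v⟩, s⟩ := p
  have hfib : ∀ q', q' = q →
      (⟨q', ∑ α, κ.coeff α q v • κ.frame α q'⟩ : TotalSpace F E) = ⟨q, v⟩ := by
    rintro _ rfl
    rw [κ.sum_coeff_smul hp]
  exact Prod.ext (hfib _ (κ.chart.left_inv hp)) rfl

theorem lagCoords_lagPoint (hz : z.1 ∈ κ.chart.target) : κ.lagCoords (κ.lagPoint z) = z :=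
  Prod.ext (κ.chart.right_inv hz)
    (Prod.ext (funext fun α => κ.coeff_sum_smul (κ.chart.map_target hz) z.2.1 α) rfl)

theorem eventually_proj_mem_source {p : LagSpace F E} (hp : p.1.proj ∈ κ.chart.source) :
    ∀ᶠ x : LagSpace F E in 𝓝 p, x.1.proj ∈ κ.chart.source :=
  ((FiberBundle.continuous_proj F E).comp continuous_fst).continuousAt.eventually_mem
    (κ.chart.open_source.mem_nhds hp)

variable [IsManifold (𝓡 n) ∞ Q] [VectorBundle ℝ F E] [ContMDiffVectorBundle ∞ F E (𝓡 n)]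

theorem contMDiffAt_lagCoords {p : LagSpace F E} (hp : p.1.proj ∈ κ.chart.source) :
    ContMDiffAt (lagModel n F) 𝓘(ℝ, CoordSpace n F) ∞ κ.lagCoords p := by
  have hfst : ContMDiffAt (lagModel n F) ((𝓡 n).prod 𝓘(ℝ, F)) ∞
      (fun x : LagSpace F E => x.1) p := contMDiffAt_fst
  exact ((κ.contMDiffAt_chart hp).comp p (contMDiffAt_totalSpace.1 hfst).1).prodMk_space
    ((κ.contMDiffAt_coeff hfst hp).prodMk_space contMDiffAt_snd)

theorem contMDiffAt_lagPoint (hz : z.1 ∈ κ.chart.target) :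
    ContMDiffAt 𝓘(ℝ, CoordSpace n F) (lagModel n F) ∞ (κ.lagPoint (E := E)) z := by
  have hbase : ContMDiffAt 𝓘(ℝ, CoordSpace n F) (𝓡 n) ∞
      (fun z : CoordSpace n F => κ.chart.symm z.1) z :=
    (κ.contMDiffAt_chart_symm hz).comp z contDiff_fst.contMDiff.contMDiffAt
  exact (κ.contMDiffAt_sum_smul_frame hbase (κ.chart.map_target hz)
    (contDiff_fst.comp contDiff_snd).contMDiff.contMDiffAt).prodMk
    (contDiff_snd.comp contDiff_snd).contMDiff.contMDiffAt

end Lagrangian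

section Hamiltonian

variable [VectorBundle ℝ F E] [FiniteDimensional ℝ F]

theorem hamPoint_hamCoords {p : HamSpace F E} (hp : p.1.proj ∈ κ.chart.source) :
    κ.hamPoint (κ.hamCoords p) = p := by
  obtain ⟨⟨q, l⟩, s⟩ := p
  have hfib : ∀ q', q' = q → (⟨q', toDual (F := F) q' (∑ α, l (κ.frame α q) • κ.coeff α q')⟩ :
      TotalSpace (F →L[ℝ] ℝ) (DualBundle E)) = ⟨q, l⟩ := by
    rintro _ rfl
    rw [κ.toDual_sum_apply_frame hp]
  exact Prod.ext (hfib _ (κ.chart.left_inv hp)) rfl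

theorem hamCoords_hamPoint (hz : z.1 ∈ κ.chart.target) : κ.hamCoords (κ.hamPoint z) = z :=
  Prod.ext (κ.chart.right_inv hz)
    (Prod.ext (funext fun α => κ.toDual_apply_frame (κ.chart.map_target hz) z.2.1 α) rfl)

omit [FiniteDimensional ℝ F] in
theorem eventually_dual_proj_mem_source {p : HamSpace F E} (hp : p.1.proj ∈ κ.chart.source) :
    ∀ᶠ x : HamSpace F E in 𝓝 p, x.1.proj ∈ κ.chart.source :=
  ((FiberBundle.continuous_proj (F →L[ℝ] ℝ) (DualBundle E)).comp
    continuous_fst).continuousAt.eventually_mem (κ.chart.open_source.mem_nhds hp)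

variable [IsManifold (𝓡 n) ∞ Q]

omit [FiniteDimensional ℝ F] in
theorem contMDiffAt_hamCoords {p : HamSpace F E} (hp : p.1.proj ∈ κ.chart.source) :
    ContMDiffAt (hamModel n F) 𝓘(ℝ, CoordSpace n F) ∞ κ.hamCoords p := by
  have hfst : ContMDiffAt (hamModel n F) ((𝓡 n).prod 𝓘(ℝ, F →L[ℝ] ℝ)) ∞
      (fun x : HamSpace F E => x.1) p := contMDiffAt_fst
  exact ((κ.contMDiffAt_chart hp).comp p (contMDiffAt_totalSpace.1 hfst).1).prodMk_space
    ((contMDiffAt_pi_space.2 fun α => κ.contMDiffAt_apply_frame hfst hp α).prodMk_space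
      contMDiffAt_snd)

theorem contMDiffAt_hamPoint [ContMDiffVectorBundle ∞ F E (𝓡 n)] (hz : z.1 ∈ κ.chart.target) :
    ContMDiffAt 𝓘(ℝ, CoordSpace n F) (hamModel n F) ∞ (κ.hamPoint (E := E)) z := by
  have hbase : ContMDiffAt 𝓘(ℝ, CoordSpace n F) (𝓡 n) ∞
      (fun z : CoordSpace n F => κ.chart.symm z.1) z :=
    (κ.contMDiffAt_chart_symm hz).comp z contDiff_fst.contMDiff.contMDiffAt
  exact (κ.contMDiffAt_toDual hbase (κ.chart.map_target hz)
    (contDiff_fst.comp contDiff_snd).contMDiff.contMDiffAt).prodMk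
    (contDiff_snd.comp contDiff_snd).contMDiff.contMDiffAt

end Hamiltonian

end LocalCoords

end PhaseCoordinates

section CoordLegendre

variable {n : ℕ} {F : Type*} [NormedAddCommGroup F] [NormedSpace ℝ F]

/-- The Legendre transformation `(q, y, s) ↦ (q, ∂f/∂y, s)` of a function of the coordinates. -/
def coordLegendre (f : CoordSpace n F → ℝ) (z : CoordSpace n F) : CoordSpace n F :=
  (z.1, fun α => partialY f α z, z.2.2)

variable {f : CoordSpace n F → ℝ} {z : CoordSpace n F}

theorem hasFDerivAt_coordLegendre (hf : ContDiffAt ℝ ∞ f z) :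
    HasFDerivAt (coordLegendre f) ((ContinuousLinearMap.fst ℝ _ _).prod
      ((ContinuousLinearMap.pi fun α => fderiv ℝ (partialY f α) z).prod
        ((ContinuousLinearMap.snd ℝ _ _).comp (ContinuousLinearMap.snd ℝ _ _)))) z :=
  hasFDerivAt_fst.prodMk ((hasFDerivAt_pi.2 fun α =>
    ((contDiffAt_partialY hf α).differentiableAt (by simp)).hasFDerivAt).prodMk
      (hasFDerivAt_snd.comp z hasFDerivAt_snd))

theorem fderiv_sum_mul_partialY_sub (hf : ContDiffAt ℝ ∞ f z) (w : CoordSpace n F) :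
    fderiv ℝ (fun z => ∑ α, z.2.1 α * partialY f α z - f z) z w =
      ∑ α, z.2.1 α * fderiv ℝ (partialY f α) z w - ∑ i, w.1 i * partialQ f i z
        - w.2.2 * partialS f z := by
  let pY : Fin (finrank ℝ F) → CoordSpace n F →L[ℝ] ℝ := fun α =>
    (ContinuousLinearMap.proj (R := ℝ) (φ := fun _ : Fin (finrank ℝ F) => ℝ) α).comp
      ((ContinuousLinearMap.fst ℝ _ _).comp (ContinuousLinearMap.snd ℝ _ _))
  have hderiv : HasFDerivAt (fun z : CoordSpace n F => ∑ α, z.2.1 α * partialY f α z - f z)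
      (∑ α, (z.2.1 α • fderiv ℝ (partialY f α) z + partialY f α z • pY α) - fderiv ℝ f z) z :=
    (HasFDerivAt.fun_sum fun α _ => HasFDerivAt.mul (pY α).hasFDerivAt
      ((contDiffAt_partialY hf α).differentiableAt (by simp)).hasFDerivAt).sub
        (hf.differentiableAt (by simp)).hasFDerivAt
  have hpY : ∀ α, pY α w = w.2.1 α := fun _ => rfl
  rw [hderiv.fderiv]
  simp only [sub_apply, sum_apply, add_apply, smul_apply, smul_eq_mul, hpY,
    fderiv_eq_sum_partial f z w, Finset.sum_add_distrib, mul_comm (partialY f _ z)]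
  ring

/-- Differentiating `g ∘ Leg = y^α ∂f/∂y^α - f`, the second derivatives of `f` cancel; the right
inverse makes the differential of `Leg` surjective, so this determines the differential of `g`. -/
theorem fderiv_of_comp_coordLegendre {g : CoordSpace n F → ℝ} (hf : ContDiffAt ℝ ∞ f z)
    (hg : DifferentiableAt ℝ g (coordLegendre f z))
    (hfg : g ∘ coordLegendre f =ᶠ[𝓝 z] fun z => ∑ α, z.2.1 α * partialY f α z - f z)
    {r : CoordSpace n F → CoordSpace n F} (hr : DifferentiableAt ℝ r (coordLegendre f z))
    (hrz : r (coordLegendre f z) = z)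
    (hright : coordLegendre f ∘ r =ᶠ[𝓝 (coordLegendre f z)] id) (u : CoordSpace n F) :
    fderiv ℝ g (coordLegendre f z) u = ∑ α, z.2.1 α * u.2.1 α - ∑ i, u.1 i * partialQ f i z
      - u.2.2 * partialS f z := by
  have hLeg := hasFDerivAt_coordLegendre hf
  obtain ⟨w, rfl⟩ : ∃ w, fderiv ℝ (coordLegendre f) z w = u := by
    have hcomp := (hrz.symm ▸ hLeg.differentiableAt :
      DifferentiableAt ℝ (coordLegendre f) (r (coordLegendre f z))).hasFDerivAt.comp _
        hr.hasFDerivAt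
    have hid := hcomp.unique ((hasFDerivAt_id _).congr_of_eventuallyEq hright)
    rw [hrz] at hid
    exact ⟨_, congrArg (fun l => l u) hid⟩
  have hchain := congrArg (fun l => l w) (hg.hasFDerivAt.comp z hLeg).fderiv
  rw [hfg.fderiv_eq, fderiv_sum_mul_partialY_sub hf] at hchain
  rw [hLeg.fderiv]
  exact hchain.symm

end CoordLegendre

section Legendre

variable {n : ℕ} {Q : Type*} [TopologicalSpace Q] [ChartedSpace (EuclideanSpace ℝ (Fin n)) Q]
  {F : Type*} [NormedAddCommGroup F] [NormedSpace ℝ F]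
  {E : Q → Type*} [∀ q, AddCommGroup (E q)] [∀ q, Module ℝ (E q)]
  [∀ q, TopologicalSpace (E q)] [TopologicalSpace (TotalSpace F E)]
  [FiberBundle F E]

/-- The coordinate expression of a function on `E × ℝ`. -/
abbrev LocalCoords.lagRep (κ : LocalCoords n F E) (L : LagSpace F E → ℝ) : CoordSpace n F → ℝ :=
  fun z => L (κ.lagPoint z)

theorem LocalCoords.fiberLine_eq_lagPoint (κ : LocalCoords n F E) {p : LagSpace F E}
    (hp : p.1.proj ∈ κ.chart.source) (b : E p.1.proj) (t : ℝ) :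
    fiberLine p b t =
      κ.lagPoint (κ.lagCoords p + t • (0, fun α => κ.coeff α p.1.proj b, 0)) := by
  rw [← κ.lagPoint_lagCoords (p := fiberLine p b t) hp]
  congr 1
  refine Prod.ext ?_ (Prod.ext (funext fun α => ?_) ?_)
  · simp [LocalCoords.lagCoords, fiberLine]
  · exact (κ.coeff α p.1.proj).map_add _ _ |>.trans (by rw [map_smul]; rfl)
  · simp [LocalCoords.lagCoords, fiberLine]

variable [IsManifold (𝓡 n) ∞ Q] [VectorBundle ℝ F E] [ContMDiffVectorBundle ∞ F E (𝓡 n)]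
  (L : Lagrangian n F E) (κ : LocalCoords n F E)

theorem contDiffAt_lagRep {z : CoordSpace n F} (hz : z.1 ∈ κ.chart.target) :
    ContDiffAt ℝ ∞ (κ.lagRep L) z :=
  (L.contMDiff.contMDiffAt.comp z (κ.contMDiffAt_lagPoint hz)).contDiffAt

theorem legendreCovector_eq_mvfderiv (p : LagSpace F E) (b : E p.1.proj) :
    legendreCovector L p b = mvfderiv (lagModel n F) L p (vertLift p b) :=
  deriv_fiberLine L p b

theorem legendreCovector_eq_sum_partialY {p : LagSpace F E} (hp : p.1.proj ∈ κ.chart.source)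
    (b : E p.1.proj) :
    legendreCovector L p b =
      ∑ α, κ.coeff α p.1.proj b * partialY (κ.lagRep L) α (κ.lagCoords p) := by
  set w : CoordSpace n F := (0, fun α => κ.coeff α p.1.proj b, 0) with hw
  have hline : HasDerivAt (fun t : ℝ => κ.lagCoords p + t • w) w 0 := by
    simpa using! ((hasDerivAt_id (0 : ℝ)).smul_const w).const_add (κ.lagCoords p)
  have hL : HasFDerivAt (κ.lagRep L) (fderiv ℝ (κ.lagRep L) (κ.lagCoords p))
      (κ.lagCoords p + (0 : ℝ) • w) := by
    simpa using ((contDiffAt_lagRep L κ (z := κ.lagCoords p)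
      (κ.chart.map_source hp)).differentiableAt (by simp)).hasFDerivAt
  change deriv (fun t : ℝ => L (fiberLine p b t)) 0 = _
  simp only [κ.fiberLine_eq_lagPoint hp]
  refine (hL.comp_hasDerivAt (0 : ℝ) hline).deriv.trans ?_
  simp [fderiv_eq_sum_partial, hw]

theorem legendreCovector_frame {p : LagSpace F E} (hp : p.1.proj ∈ κ.chart.source)
    (α : Fin (finrank ℝ F)) :
    legendreCovector L p (κ.frame α p.1.proj) = partialY (κ.lagRep L) α (κ.lagCoords p) := by
  rw [legendreCovector_eq_sum_partialY L κ hp]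
  simp [κ.coeff_frame hp]

theorem hamCoords_legendre {p : LagSpace F E} (hp : p.1.proj ∈ κ.chart.source) :
    κ.hamCoords (legendre L p) = coordLegendre (κ.lagRep L) (κ.lagCoords p) :=
  Prod.ext rfl (Prod.ext (funext fun α => legendreCovector_frame L κ hp α) rfl)

theorem energy_eq_legendreCovector_sub (p : LagSpace F E) :
    energy L p = legendreCovector L p p.1.2 - L p := by
  rw [legendreCovector_eq_mvfderiv]
  rfl

theorem energy_eq_sum_mul_partialY_sub {p : LagSpace F E} (hp : p.1.proj ∈ κ.chart.source) :
    energy L p = ∑ α, (κ.lagCoords p).2.1 α * partialY (κ.lagRep L) α (κ.lagCoords p) - L p := by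
  rw [energy_eq_legendreCovector_sub, legendreCovector_eq_sum_partialY L κ hp]
  rfl

variable [FiniteDimensional ℝ F]

theorem contMDiff_energy : ContMDiff (lagModel n F) 𝓘(ℝ, ℝ) ∞ (energy L) := by
  intro p
  obtain ⟨κ, hp⟩ := exists_localCoords (n := n) (F := F) (E := E) p.1.proj
  have hsum : ContDiffAt ℝ ∞ (fun z : CoordSpace n F =>
      ∑ α, z.2.1 α * partialY (κ.lagRep L) α z) (κ.lagCoords p) := by
    refine ContDiffAt.sum fun α _ => ContDiffAt.mul ?_ (contDiffAt_partialY
      (contDiffAt_lagRep L κ (κ.chart.map_source hp)) α)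
    fun_prop
  refine ((hsum.contMDiffAt.comp p (κ.contMDiffAt_lagCoords hp)).sub
    L.contMDiff.contMDiffAt).congr_of_eventuallyEq ?_
  filter_upwards [κ.eventually_proj_mem_source hp] with x hx
  exact energy_eq_sum_mul_partialY_sub L κ hx

/-- The coordinate expression of a function on `E* × ℝ`. -/
abbrev LocalCoords.hamRep (κ : LocalCoords n F E) (H : HamSpace F E → ℝ) : CoordSpace n F → ℝ :=
  fun z => H (κ.hamPoint z)

variable {L} {Leg : Diffeomorph (lagModel n F) (hamModel n F) (LagSpace F E) (HamSpace F E) ∞}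
  (hLeg : ∀ p, Leg p = legendre L p)
include hLeg

omit [FiniteDimensional ℝ F] in
theorem proj_legendre_symm (p : HamSpace F E) : (Leg.symm p).1.proj = p.1.proj := by
  conv_rhs => rw [← Leg.apply_symm_apply p, hLeg]
  rfl

theorem hamRep_coordLegendre {z : CoordSpace n F} (hz : z.1 ∈ κ.chart.target) :
    κ.hamRep (energy L ∘ Leg.symm) (coordLegendre (κ.lagRep L) z) =
      ∑ α, z.2.1 α * partialY (κ.lagRep L) α z - κ.lagRep L z := by
  have hs : (κ.lagPoint (E := E) z).1.proj ∈ κ.chart.source := κ.chart.map_target hz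
  have henergy := energy_eq_sum_mul_partialY_sub L κ hs
  have hcoords := hamCoords_legendre L κ hs
  rw [κ.lagCoords_lagPoint hz] at henergy hcoords
  rw [LocalCoords.hamRep, ← hcoords,
    κ.hamPoint_hamCoords (p := legendre L (κ.lagPoint z)) hs, ← hLeg, Function.comp_apply,
    Leg.symm_apply_apply, henergy]

theorem coordLegendre_lagCoords_symm_hamPoint {z : CoordSpace n F} (hz : z.1 ∈ κ.chart.target) :
    coordLegendre (κ.lagRep L) (κ.lagCoords (Leg.symm (κ.hamPoint z))) = z := by
  rw [← hamCoords_legendre L κ, ← hLeg, Leg.apply_symm_apply, κ.hamCoords_hamPoint hz]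
  rw [proj_legendre_symm hLeg]
  exact κ.chart.map_target hz

theorem fderiv_hamRep {p : LagSpace F E} (hp : p.1.proj ∈ κ.chart.source)
    (u : CoordSpace n F) :
    fderiv ℝ (κ.hamRep (energy L ∘ Leg.symm)) (κ.hamCoords (legendre L p)) u =
      ∑ α, (κ.lagCoords p).2.1 α * u.2.1 α
        - ∑ i, u.1 i * partialQ (κ.lagRep L) i (κ.lagCoords p)
        - u.2.2 * partialS (κ.lagRep L) (κ.lagCoords p) := by
  have ht : (κ.lagCoords p).1 ∈ κ.chart.target := κ.chart.map_source hp
  have hpoint : κ.hamPoint (coordLegendre (κ.lagRep L) (κ.lagCoords p)) = Leg p := by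
    rw [← hamCoords_legendre L κ hp, κ.hamPoint_hamCoords (p := legendre L p) hp, hLeg]
  have hinv := Leg.symm.contMDiff.contMDiffAt.comp _ (κ.contMDiffAt_hamPoint (E := E)
    (z := coordLegendre (κ.lagRep L) (κ.lagCoords p)) ht)
  rw [hamCoords_legendre L κ hp]
  refine fderiv_of_comp_coordLegendre (contDiffAt_lagRep L κ ht) ?_ ?_
    (r := fun z => κ.lagCoords (Leg.symm (κ.hamPoint z))) ?_ ?_ ?_ u
  · exact ((contMDiff_energy L).contMDiffAt.comp _ hinv).contDiffAt.differentiableAt (by simp)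
  · filter_upwards [κ.eventually_mem_target ht] with z hz
    exact hamRep_coordLegendre κ hLeg hz
  · refine ((κ.contMDiffAt_lagCoords ?_).comp _ hinv).contDiffAt.differentiableAt (by simp)
    rw [Function.comp_apply, hpoint, Leg.symm_apply_apply]
    exact hp
  · rw [hpoint, Leg.symm_apply_apply]
  · filter_upwards [κ.eventually_mem_target (z := coordLegendre _ _) ht] with z hz
    exact coordLegendre_lagCoords_symm_hamPoint κ hLeg hz

variable {p : LagSpace F E} (hp : p.1.proj ∈ κ.chart.source)
include hp

theorem partialQ_hamRep (i : Fin n) :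
    partialQ (κ.hamRep (energy L ∘ Leg.symm)) i (κ.hamCoords (legendre L p)) =
      -partialQ (κ.lagRep L) i (κ.lagCoords p) := by
  simp [partialQ, fderiv_hamRep κ hLeg hp]

theorem partialY_hamRep (α : Fin (finrank ℝ F)) :
    partialY (κ.hamRep (energy L ∘ Leg.symm)) α (κ.hamCoords (legendre L p)) =
      (κ.lagCoords p).2.1 α := by
  rw [partialY, fderiv_hamRep κ hLeg hp]
  simp [Pi.single_apply]

theorem partialS_hamRep :
    partialS (κ.hamRep (energy L ∘ Leg.symm)) (κ.hamCoords (legendre L p)) =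
      -partialS (κ.lagRep L) (κ.lagCoords p) := by
  rw [partialS, fderiv_hamRep κ hLeg hp]
  simp

end Legendre

section Solutions

variable {n : ℕ} {Q : Type*} [TopologicalSpace Q] [ChartedSpace (EuclideanSpace ℝ (Fin n)) Q]
  [IsManifold (𝓡 n) ∞ Q]
  {F : Type*} [NormedAddCommGroup F] [NormedSpace ℝ F] [FiniteDimensional ℝ F]
  {E : Q → Type*} [∀ q, AddCommGroup (E q)] [∀ q, Module ℝ (E q)]
  [∀ q, TopologicalSpace (E q)] [TopologicalSpace (TotalSpace F E)]
  [FiberBundle F E] [VectorBundle ℝ F E] [ContMDiffVectorBundle ∞ F E (𝓡 n)]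
  {A : LieAlgebroid n F E} {L : Lagrangian n F E}
  {Leg : Diffeomorph (lagModel n F) (hamModel n F) (LagSpace F E) (HamSpace F E) ∞}
  (hLeg : ∀ p, Leg p = legendre L p)
include hLeg

omit [FiniteDimensional ℝ F] in
theorem contMDiffOn_legendre_comp_iff {I : Set ℝ} {c : ℝ → LagSpace F E} :
    ContMDiffOn 𝓘(ℝ, ℝ) (hamModel n F) ∞ (legendre L ∘ c) I ↔
      ContMDiffOn 𝓘(ℝ, ℝ) (lagModel n F) ∞ c I := by
  rw [← funext hLeg]
  refine ⟨fun h => ?_, Leg.contMDiff.comp_contMDiffOn⟩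
  exact (Leg.symm.contMDiff.comp_contMDiffOn h).congr fun t _ => by simp

section Coordinates

variable (κ : LocalCoords n F E) {p : LagSpace F E} (hp : p.1.proj ∈ κ.chart.source)
include hp

theorem sum_anchorCoeff_mul_partialY_hamRep (i : Fin n) :
    ∑ α, κ.anchorCoeff A i α p.1.proj
        * partialY (κ.hamRep (energy L ∘ Leg.symm)) α (κ.hamCoords (legendre L p)) =
      ∑ α, (κ.lagCoords p).2.1 α * κ.anchorCoeff A i α p.1.proj := by
  simp only [partialY_hamRep κ hLeg hp, mul_comm]

theorem sum_mul_partialY_hamRep_sub :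
    ∑ α, (κ.hamCoords (legendre L p)).2.1 α
        * partialY (κ.hamRep (energy L ∘ Leg.symm)) α (κ.hamCoords (legendre L p))
      - (energy L ∘ Leg.symm) (legendre L p) = L p := by
  rw [Function.comp_apply, ← hLeg, Leg.symm_apply_apply, energy_eq_sum_mul_partialY_sub L κ hp,
    hLeg]
  simp only [partialY_hamRep κ hLeg hp]
  simp only [hamCoords_legendre L κ hp, coordLegendre, mul_comm]
  ring

theorem hamilton_force_eq_herglotz_force (α : Fin (finrank ℝ F)) :
    -(∑ i, κ.anchorCoeff A i α p.1.proj
          * partialQ (κ.hamRep (energy L ∘ Leg.symm)) i (κ.hamCoords (legendre L p))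
        + ∑ β, ∑ γ, κ.structCoeff A γ α β p.1.proj * (κ.hamCoords (legendre L p)).2.1 γ
          * partialY (κ.hamRep (energy L ∘ Leg.symm)) β (κ.hamCoords (legendre L p))
        + (κ.hamCoords (legendre L p)).2.1 α
          * partialS (κ.hamRep (energy L ∘ Leg.symm)) (κ.hamCoords (legendre L p))) =
      ∑ i, κ.anchorCoeff A i α p.1.proj * partialQ (κ.lagRep L) i (κ.lagCoords p)
        - ∑ β, ∑ γ, (κ.lagCoords p).2.1 β * κ.structCoeff A γ α β p.1.proj
          * partialY (κ.lagRep L) γ (κ.lagCoords p)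
        + partialY (κ.lagRep L) α (κ.lagCoords p) * partialS (κ.lagRep L) (κ.lagCoords p) := by
  simp only [partialQ_hamRep κ hLeg hp, partialY_hamRep κ hLeg hp, partialS_hamRep κ hLeg hp]
  simp only [hamCoords_legendre L κ hp, coordLegendre, mul_neg, Finset.sum_neg_distrib]
  have hbracket : ∑ β, ∑ γ, κ.structCoeff A γ α β p.1.proj
        * partialY (κ.lagRep L) γ (κ.lagCoords p) * (κ.lagCoords p).2.1 β =
      ∑ β, ∑ γ, (κ.lagCoords p).2.1 β * κ.structCoeff A γ α β p.1.proj
        * partialY (κ.lagRep L) γ (κ.lagCoords p) :=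
    Finset.sum_congr rfl fun β _ => Finset.sum_congr rfl fun γ _ => by ring
  rw [hbracket]
  ring

end Coordinates

theorem isHamiltonSolution_legendre_comp_iff {I : Set ℝ} {c : ℝ → LagSpace F E} :
    IsHamiltonSolution A (energy L ∘ Leg.symm) I (legendre L ∘ c) ↔
      IsHerglotzSolution A L I c := by
  rw [IsHamiltonSolution, IsHerglotzSolution, contMDiffOn_legendre_comp_iff hLeg]
  refine and_congr_right fun hc => forall_congr' fun κ => forall₂_congr fun t ht =>
    forall_congr' fun (hq : (c t).1.proj ∈ κ.chart.source) => ?_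
  have hmomentum : ∀ r, (c r).1.proj ∈ κ.chart.source → ∀ α,
      (κ.hamCoords (legendre L (c r))).2.1 α = partialY (κ.lagRep L) α (κ.lagCoords (c r)) :=
    fun r hr α => legendreCovector_frame L κ hr α
  have hmomentum_nhds : ∀ α, (fun r => (κ.hamCoords (legendre L (c r))).2.1 α) =ᶠ[𝓝[I] t]
      fun r => partialY (κ.lagRep L) α (κ.lagCoords (c r)) := fun α => by
    filter_upwards [(hc t ht).continuousWithinAt.eventually (κ.eventually_proj_mem_source hq)]
      with r hr
    exact hmomentum r hr α
  refine and_left_comm.trans (and_congr (forall_congr' fun α => ?_) (and_congr ?_ ?_))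
  · refine (iff_of_eq (congrArg (HasDerivWithinAt _ · I t) ?_)).trans
      ((hmomentum_nhds α).hasDerivWithinAt_iff_of_mem ht)
    exact hamilton_force_eq_herglotz_force hLeg κ hq α
  · refine forall_congr' fun i => iff_of_eq (congrArg (HasDerivWithinAt _ · I t) ?_)
    exact sum_anchorCoeff_mul_partialY_hamRep hLeg κ hq i
  · exact iff_of_eq (congrArg (HasDerivWithinAt _ · I t) (sum_mul_partialY_hamRep_sub hLeg κ hq))

end Solutions

section PairFields

theorem contMDiffAt_totalSpace_smul {V H P V' H' B : Type*}
    [NormedAddCommGroup V] [NormedSpace ℝ V] [TopologicalSpace H] {J : ModelWithCorners ℝ V H}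
    [TopologicalSpace P] [ChartedSpace H P]
    [NormedAddCommGroup V'] [NormedSpace ℝ V'] [TopologicalSpace H'] {I : ModelWithCorners ℝ V' H'}
    [TopologicalSpace B] [ChartedSpace H' B]
    {F : Type*} [NormedAddCommGroup F] [NormedSpace ℝ F]
    {E : B → Type*} [∀ q, AddCommGroup (E q)] [∀ q, Module ℝ (E q)]
    [∀ q, TopologicalSpace (E q)] [TopologicalSpace (TotalSpace F E)]
    [FiberBundle F E] [VectorBundle ℝ F E] {b : P → B} {s : ∀ x, E (b x)} {f : P → ℝ} {x : P}
    (hf : ContMDiffAt J 𝓘(ℝ, ℝ) ∞ f x)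
    (hs : ContMDiffAt J (I.prod 𝓘(ℝ, F)) ∞ (fun x => (⟨b x, s x⟩ : TotalSpace F E)) x) :
    ContMDiffAt J (I.prod 𝓘(ℝ, F)) ∞ (fun x => (⟨b x, f x • s x⟩ : TotalSpace F E)) x := by
  obtain ⟨hb, hs⟩ := contMDiffAt_totalSpace.1 hs
  refine contMDiffAt_totalSpace.2 ⟨hb, (hf.smul hs).congr_of_eventuallyEq ?_⟩
  set e := trivializationAt F E (b x)
  filter_upwards [hb.continuousAt.eventually_mem (e.open_baseSet.mem_nhds
    (FiberBundle.mem_baseSet_trivializationAt' (b x)))] with y hy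
  exact (e.linear ℝ hy).2 _ _

variable {n : ℕ} {Q : Type*} [TopologicalSpace Q] [ChartedSpace (EuclideanSpace ℝ (Fin n)) Q]
  {F : Type*} [NormedAddCommGroup F] [NormedSpace ℝ F]
  {E : Q → Type*} [∀ q, AddCommGroup (E q)] [∀ q, Module ℝ (E q)]
  [∀ q, TopologicalSpace (E q)] [TopologicalSpace (TotalSpace F E)] [FiberBundle F E]
  {V H : Type*} [NormedAddCommGroup V] [NormedSpace ℝ V] [TopologicalSpace H]
  {J : ModelWithCorners ℝ V H}
  {P : Type*} [TopologicalSpace P] [ChartedSpace H P] [IsManifold J ∞ P] {pr : P → Q}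

variable (n F J) in
/-- Smoothness at `p` of a field `x ↦ (a, v) ∈ E_{pr(x)} × T_x P` of pairs, required of the two
components separately, as in `ProlSec`. -/
structure ContMDiffPairAt (X : ∀ p, E (pr p) × TangentSpace J p) (p : P) : Prop where
  fst : ContMDiffAt J ((𝓡 n).prod 𝓘(ℝ, F)) ∞ (fun x => (⟨pr x, (X x).1⟩ : TotalSpace F E)) p
  snd : ContMDiffAt J J.tangent ∞ (fun x => (⟨x, (X x).2⟩ : TangentBundle J P)) p

omit [∀ q, AddCommGroup (E q)] [∀ q, Module ℝ (E q)] in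
theorem ContMDiffPairAt.congr_of_eventuallyEq {X Y : ∀ p, E (pr p) × TangentSpace J p} {p : P}
    (hX : ContMDiffPairAt n F J X p) (h : ∀ᶠ x in 𝓝 p, Y x = X x) : ContMDiffPairAt n F J Y p where
  fst := hX.fst.congr_of_eventuallyEq (h.mono fun x hx => by simp only [hx])
  snd := hX.snd.congr_of_eventuallyEq (h.mono fun x hx => by simp only [hx])

variable [VectorBundle ℝ F E]

theorem ContMDiffPairAt.smul {X : ∀ p, E (pr p) × TangentSpace J p} {f : P → ℝ} {p : P}
    (hX : ContMDiffPairAt n F J X p) (hf : ContMDiffAt J 𝓘(ℝ, ℝ) ∞ f p) :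
    ContMDiffPairAt n F J (fun x => f x • X x) p where
  fst := contMDiffAt_totalSpace_smul hf hX.fst
  snd := contMDiffAt_totalSpace_smul hf hX.snd

theorem contMDiffPairAt_zero {p : P} (hpr : ContMDiffAt J (𝓡 n) ∞ pr p) :
    ContMDiffPairAt n F J (0 : ∀ p, E (pr p) × TangentSpace J p) p where
  fst := ((contMDiff_zeroSection ℝ E) (pr p)).comp p hpr
  snd := (contMDiff_zeroSection ℝ (TangentSpace J (M := P))) p

variable [IsManifold (𝓡 n) ∞ Q]

theorem exists_sec_eventuallyEq [T2Space Q] {s : ∀ q, E q} {u : Set Q} (hu : IsOpen u)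
    (hs : ContMDiffOn (𝓡 n) ((𝓡 n).prod 𝓘(ℝ, F)) ∞ (fun q => (⟨q, s q⟩ : TotalSpace F E)) u)
    {q : Q} (hq : q ∈ u) : ∃ σ : Sec n F E, ∀ᶠ x in 𝓝 q, σ x = s x := by
  obtain ⟨f, hf, hfu⟩ := exists_contMDiffMap_eventuallyEq_one n (hu.mem_nhds hq)
  refine ⟨⟨fun x => f x • s x, fun x => ?_⟩, hf.mono fun x hx =>
    (congrArg (· • s x) hx).trans (one_smul ℝ _)⟩
  by_cases hx : x ∈ u
  · exact contMDiffAt_totalSpace_smul (f.contMDiff x) (hs.contMDiffAt (hu.mem_nhds hx))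
  · refine ((contMDiff_zeroSection ℝ E) x).congr_of_eventuallyEq ?_
    filter_upwards [(isClosed_tsupport f).isOpen_compl.mem_nhds fun h => hx (hfu h)] with y hy
    rw [image_eq_zero_of_notMem_tsupport hy, zero_smul]
    rfl

variable {A : LieAlgebroid n F E}

theorem ProlSec.ext {X Y : ProlSec J A pr} (h : ∀ p, X p = Y p) : X = Y := by
  obtain ⟨x, _, _, _⟩ := X
  obtain ⟨y, _, _, _⟩ := Y
  obtain rfl : x = y := funext h
  rfl

theorem ProlSec.exists_eventuallyEq [T2Space Q] (hpr : ContMDiff J (𝓡 n) ∞ pr) {u : Set Q}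
    (hu : IsOpen u) {X : ∀ p, E (pr p) × TangentSpace J p}
    (hX : ∀ x, pr x ∈ u → X x ∈ prolFiber J A pr x ∧ ContMDiffPairAt n F J X x) {p : P}
    (hp : pr p ∈ u) : ∃ Z : ProlSec J A pr, ∀ᶠ x in 𝓝 p, Z x = X x := by
  obtain ⟨f, hf, hfu⟩ := exists_contMDiffMap_eventuallyEq_one n (hu.mem_nhds hp)
  have hmem : ∀ x, f (pr x) • X x ∈ prolFiber J A pr x := fun x => by
    by_cases hx : pr x ∈ u
    · exact Submodule.smul_mem _ _ (hX x hx).1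
    · rw [image_eq_zero_of_notMem_tsupport fun h => hx (hfu h), zero_smul]
      exact Submodule.zero_mem _
  have hsmooth : ∀ x, ContMDiffPairAt n F J (fun y => f (pr y) • X y) x := fun x => by
    by_cases hx : pr x ∈ u
    · exact (hX x hx).2.smul (f.contMDiff.comp hpr x)
    · refine (contMDiffPairAt_zero (hpr x)).congr_of_eventuallyEq ?_
      filter_upwards [hpr.continuous.continuousAt.eventually_mem
        ((isClosed_tsupport f).isOpen_compl.mem_nhds fun h => hx (hfu h))] with y hy
      rw [image_eq_zero_of_notMem_tsupport hy, zero_smul]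
      rfl
  refine ⟨⟨fun x => f (pr x) • X x, hmem, fun x => (hsmooth x).fst, fun x => (hsmooth x).snd⟩, ?_⟩
  filter_upwards [hpr.continuous.continuousAt.eventually hf] with x hx
  exact (congrArg (· • X x) hx).trans (one_smul ℝ _)

end PairFields

section HamiltonCoordinates

variable {n : ℕ} {Q : Type*} [TopologicalSpace Q] [ChartedSpace (EuclideanSpace ℝ (Fin n)) Q]
  {F : Type*} [NormedAddCommGroup F] [NormedSpace ℝ F]
  {E : Q → Type*} [∀ q, AddCommGroup (E q)] [∀ q, Module ℝ (E q)]
  [∀ q, TopologicalSpace (E q)] [TopologicalSpace (TotalSpace F E)]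
  [FiberBundle F E]

namespace LocalCoords

theorem mvfderiv_chart_injective [IsManifold (𝓡 n) ∞ Q] [FiniteDimensional ℝ F]
    (κ : LocalCoords n F E) {q : Q} (hq : q ∈ κ.chart.source) :
    Function.Injective (mvfderiv (𝓡 n) κ.chart q) :=
  Function.LeftInverse.injective (mfderiv_mvfderiv_of_leftInverse
    ((κ.contMDiffAt_chart hq).mdifferentiableAt (by simp))
    ((κ.contMDiffAt_chart_symm (κ.chart.map_source hq)).mdifferentiableAt (by simp))
    (κ.chart.eventually_left_inverse hq))

end LocalCoords

variable [VectorBundle ℝ F E]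

theorem contMDiff_hamProj : ContMDiff (hamModel n F) (𝓡 n) ∞ (hamProj F E) :=
  (contMDiff_proj (DualBundle E)).comp contMDiff_fst

theorem mdifferentiable_hamProj : MDifferentiable (hamModel n F) (𝓡 n) (hamProj F E) :=
  contMDiff_hamProj.mdifferentiable (by simp)

namespace LocalCoords

theorem contMDiffAt_covector_frame (κ : LocalCoords n F E) {p : HamSpace F E}
    (hp : hamProj F E p ∈ κ.chart.source) (α : Fin (finrank ℝ F)) :
    ContMDiffAt (hamModel n F) 𝓘(ℝ, ℝ) ∞
      (fun x : HamSpace F E => x.1.2 (κ.frame α (hamProj F E x))) p :=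
  κ.contMDiffAt_apply_frame contMDiffAt_fst hp α

variable [IsManifold (𝓡 n) ∞ Q] (κ : LocalCoords n F E) (A : LieAlgebroid n F E)

/-- The coordinate expression of the vector field `ρ(e_α)`. -/
def anchorVec (α : Fin (finrank ℝ F)) (q : Q) : EuclideanSpace ℝ (Fin n) :=
  mvfderiv (𝓡 n) κ.chart q (A.anchor q (κ.frame α q))

/-- The coordinates of a tangent vector of `E* × ℝ`. -/
def tangentCoords (p : HamSpace F E) (v : TangentSpace (hamModel n F) p) : CoordSpace n F :=
  mvfderiv (hamModel n F) κ.hamCoords p v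

section TangentCoords

variable {κ} {p : HamSpace F E} (hp : hamProj F E p ∈ κ.chart.source)
include hp

theorem mdifferentiableAt_hamCoords :
    MDifferentiableAt (hamModel n F) 𝓘(ℝ, CoordSpace n F) κ.hamCoords p :=
  (κ.contMDiffAt_hamCoords hp).mdifferentiableAt (by simp)

theorem tangentCoords_fst (v : TangentSpace (hamModel n F) p) :
    (κ.tangentCoords p v).1 = mvfderiv (𝓡 n) κ.chart (hamProj F E p)
      (mfderiv (hamModel n F) (𝓡 n) (hamProj F E) p v) :=
  (mvfderiv_clm_comp (ContinuousLinearMap.fst ℝ (EuclideanSpace ℝ (Fin n))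
    ((Fin (finrank ℝ F) → ℝ) × ℝ)) (mdifferentiableAt_hamCoords hp) v).symm.trans
    (mfderiv_comp_apply p ((κ.contMDiffAt_chart hp).mdifferentiableAt (by simp))
      (mdifferentiable_hamProj p) v)

theorem tangentCoords_snd_fst (v : TangentSpace (hamModel n F) p) (α : Fin (finrank ℝ F)) :
    (κ.tangentCoords p v).2.1 α =
      mvfderiv (hamModel n F) (fun x : HamSpace F E => x.1.2 (κ.frame α (hamProj F E x))) p v :=
  (mvfderiv_clm_comp ((ContinuousLinearMap.proj (R := ℝ) (φ := fun _ : Fin (finrank ℝ F) => ℝ) α) ∘L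
    (ContinuousLinearMap.fst ℝ (Fin (finrank ℝ F) → ℝ) ℝ) ∘L
    (ContinuousLinearMap.snd ℝ (EuclideanSpace ℝ (Fin n)) ((Fin (finrank ℝ F) → ℝ) × ℝ)))
    (mdifferentiableAt_hamCoords hp) v).symm

theorem tangentCoords_snd_snd (v : TangentSpace (hamModel n F) p) :
    (κ.tangentCoords p v).2.2 = mvfderiv (hamModel n F) (fun x : HamSpace F E => x.2) p v :=
  (mvfderiv_clm_comp ((ContinuousLinearMap.snd ℝ (Fin (finrank ℝ F) → ℝ) ℝ) ∘L
    (ContinuousLinearMap.snd ℝ (EuclideanSpace ℝ (Fin n)) ((Fin (finrank ℝ F) → ℝ) × ℝ)))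
    (mdifferentiableAt_hamCoords hp) v).symm

theorem tangentCoords_fst_of_mem {z : E (hamProj F E p) × TangentSpace (hamModel n F) p}
    (hz : z ∈ prolFiber (hamModel n F) A (hamProj F E) p) :
    (κ.tangentCoords p z.2).1
      = ∑ α, κ.coeff α (hamProj F E p) z.1 • κ.anchorVec A α (hamProj F E p) := by
  have hanchor : A.anchor (hamProj F E p) z.1
      = mfderiv (hamModel n F) (𝓡 n) (hamProj F E) p z.2 := hz
  rw [tangentCoords_fst hp, ← hanchor]
  conv_lhs => rw [← κ.sum_coeff_smul hp z.1]
  simp only [map_sum, map_smul, anchorVec]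

theorem contMDiffAt_anchorVec (α : Fin (finrank ℝ F)) :
    ContMDiffAt (𝓡 n) (𝓡 n) ∞ (κ.anchorVec A α) (hamProj F E p) :=
  contMDiffAt_mvfderiv_apply (b := id) κ.chart.open_source
    (fun _ hx => (κ.contMDiffAt_chart hx).contMDiffWithinAt) hp <|
    (A.contMDiff_anchor _).comp _
      ((κ.isLocalFrameOn.contMDiffOn α).contMDiffAt (κ.chart.open_source.mem_nhds hp))

end TangentCoords

variable [FiniteDimensional ℝ F]

/-- The element `(a^α e_α, a^α ρ^i_α ∂/∂q^i + b_α ∂/∂y_α + r ∂/∂s)` of the prolongation. -/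
def prolVec (p : HamSpace F E) (a b : Fin (finrank ℝ F) → ℝ) (r : ℝ) :
    E (hamProj F E p) × TangentSpace (hamModel n F) p :=
  (∑ α, a α • κ.frame α (hamProj F E p),
    mfderiv 𝓘(ℝ, CoordSpace n F) (hamModel n F) (κ.hamPoint (E := E)) (κ.hamCoords p)
      ((∑ α, a α • κ.anchorVec A α (hamProj F E p), b, r) : CoordSpace n F))

variable {κ} {p : HamSpace F E} (hp : hamProj F E p ∈ κ.chart.source)
include hp

omit [IsManifold (𝓡 n) ∞ Q] in
theorem eventually_hamPoint_hamCoords :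
    ∀ᶠ x : HamSpace F E in 𝓝 p, κ.hamPoint (κ.hamCoords x) = x :=
  (κ.eventually_dual_proj_mem_source hp).mono fun _ hx => κ.hamPoint_hamCoords hx

theorem coeff_prolVec (a b : Fin (finrank ℝ F) → ℝ) (r : ℝ) (α : Fin (finrank ℝ F)) :
    κ.coeff α (hamProj F E p) (κ.prolVec A p a b r).1 = a α :=
  κ.coeff_sum_smul hp a α

variable [ContMDiffVectorBundle ∞ F E (𝓡 n)]

theorem mdifferentiableAt_hamPoint : MDifferentiableAt 𝓘(ℝ, CoordSpace n F) (hamModel n F)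
    (κ.hamPoint (E := E)) (κ.hamCoords p) :=
  (κ.contMDiffAt_hamPoint (κ.chart.map_source hp)).mdifferentiableAt (by simp)

theorem tangentCoords_prolVec (a b : Fin (finrank ℝ F) → ℝ) (r : ℝ) :
    κ.tangentCoords p (κ.prolVec A p a b r).2 =
      (∑ α, a α • κ.anchorVec A α (hamProj F E p), b, r) :=
  mvfderiv_mfderiv_of_rightInverse (mdifferentiableAt_hamCoords hp) (mdifferentiableAt_hamPoint hp)
    (κ.hamPoint_hamCoords hp)
    ((κ.eventually_mem_target (κ.chart.map_source hp)).mono fun _ hz => κ.hamCoords_hamPoint hz) _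

theorem prolVec_mem (a b : Fin (finrank ℝ F) → ℝ) (r : ℝ) :
    κ.prolVec A p a b r ∈ prolFiber (hamModel n F) A (hamProj F E) p := by
  refine κ.mvfderiv_chart_injective hp (Eq.trans ?_ (tangentCoords_fst hp _))
  rw [tangentCoords_prolVec A hp]
  simp only [prolVec, map_sum, map_smul, anchorVec]

theorem eq_prolVec_of_mem {z : E (hamProj F E p) × TangentSpace (hamModel n F) p}
    (hz : z ∈ prolFiber (hamModel n F) A (hamProj F E) p) :
    z = κ.prolVec A p (fun α => κ.coeff α (hamProj F E p) z.1) (κ.tangentCoords p z.2).2.1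
      (κ.tangentCoords p z.2).2.2 := by
  refine Prod.ext (κ.sum_coeff_smul hp z.1).symm ?_
  have htangent : mvfderiv (hamModel n F) κ.hamCoords p z.2 =
    ((∑ α, κ.coeff α (hamProj F E p) z.1 • κ.anchorVec A α (hamProj F E p),
      (κ.tangentCoords p z.2).2.1, (κ.tangentCoords p z.2).2.2) : CoordSpace n F) :=
    Prod.ext (tangentCoords_fst_of_mem A hp hz) rfl
  exact (mfderiv_mvfderiv_of_leftInverse (mdifferentiableAt_hamCoords hp)
    (mdifferentiableAt_hamPoint hp) (eventually_hamPoint_hamCoords hp) z.2).symm.trans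
    (congrArg _ htangent)

theorem contMDiffPairAt_prolVec {a b : HamSpace F E → Fin (finrank ℝ F) → ℝ}
    {r : HamSpace F E → ℝ}
    (ha : ContMDiffAt (hamModel n F) 𝓘(ℝ, Fin (finrank ℝ F) → ℝ) ∞ a p)
    (hb : ContMDiffAt (hamModel n F) 𝓘(ℝ, Fin (finrank ℝ F) → ℝ) ∞ b p)
    (hr : ContMDiffAt (hamModel n F) 𝓘(ℝ, ℝ) ∞ r p) :
    ContMDiffPairAt n F (hamModel n F) (fun x => κ.prolVec A x (a x) (b x) (r x)) p := by
  refine ⟨κ.contMDiffAt_sum_smul_frame contMDiff_hamProj.contMDiffAt hp ha, ?_⟩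
  let w : HamSpace F E → CoordSpace n F := fun x =>
    (∑ α, a x α • κ.anchorVec A α (hamProj F E x), b x, r x)
  have hw : ContMDiffAt (hamModel n F) 𝓘(ℝ, CoordSpace n F) ∞ w p :=
    (ContMDiffAt.sum fun α _ => (contMDiffAt_pi_space.1 ha α).smul
      ((contMDiffAt_anchorVec A hp α).comp p contMDiff_hamProj.contMDiffAt)).prodMk_space
      (hb.prodMk_space hr)
  have hv : ContMDiffAt (hamModel n F) 𝓘(ℝ, CoordSpace n F).tangent ∞ (fun x : HamSpace F E =>
      (⟨κ.hamCoords x, w x⟩ : TangentBundle 𝓘(ℝ, CoordSpace n F) (CoordSpace n F))) p :=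
    (contMDiffAt_totalSpace (F := CoordSpace n F)).2 ⟨κ.contMDiffAt_hamCoords hp,
      hw.congr_of_eventuallyEq (Eventually.of_forall fun x => by
        simp only [trivializationAt_model_space_apply])⟩
  refine (contMDiffAt_mfderiv_apply (κ.chart.open_target.preimage continuous_fst)
    (fun z hz => (κ.contMDiffAt_hamPoint (E := E) hz).contMDiffWithinAt)
    (κ.chart.map_source hp) hv).congr_of_eventuallyEq ?_
  have hbase : ∀ {x x' : HamSpace F E} (v : TangentSpace (hamModel n F) x'), x' = x →
      (⟨x, v⟩ : TangentBundle (hamModel n F) (HamSpace F E)) = ⟨x', v⟩ := by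
    rintro x _ v rfl
    rfl
  filter_upwards [eventually_hamPoint_hamCoords hp] with x hx using hbase _ hx

end LocalCoords

end HamiltonCoordinates

section ContactForm

variable {n : ℕ} {Q : Type*} [TopologicalSpace Q] [ChartedSpace (EuclideanSpace ℝ (Fin n)) Q]
  [IsManifold (𝓡 n) ∞ Q]
  {F : Type*} [NormedAddCommGroup F] [NormedSpace ℝ F] [FiniteDimensional ℝ F]
  {E : Q → Type*} [∀ q, AddCommGroup (E q)] [∀ q, Module ℝ (E q)]
  [∀ q, TopologicalSpace (E q)] [TopologicalSpace (TotalSpace F E)]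
  [FiberBundle F E] [VectorBundle ℝ F E]

namespace LocalCoords

variable (κ : LocalCoords n F E) (A : LieAlgebroid n F E)

/-- The functions `C^γ_{αβ} y_γ`. -/
def dualBracket (α β : Fin (finrank ℝ F)) (p : HamSpace F E) : ℝ :=
  p.1.2 (A.localBracket (κ.frame α) (κ.frame β) (hamProj F E p))

/-- The coordinate expression `e^α ∧ dy_α + ½ C^γ_{αβ} y_γ e^α ∧ e^β` of `dη`. -/
def hamForm (p : HamSpace F E) (z w : E (hamProj F E p) × TangentSpace (hamModel n F) p) : ℝ :=
  ∑ α, (κ.coeff α (hamProj F E p) z.1 * (κ.tangentCoords p w.2).2.1 α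
    - κ.coeff α (hamProj F E p) w.1 * (κ.tangentCoords p z.2).2.1 α)
  + ∑ α, ∑ β, κ.coeff α (hamProj F E p) z.1 * κ.coeff β (hamProj F E p) w.1 * κ.dualBracket A α β p

/-- The `1`-form `u_α e^α + v^α dy_α` on the prolongation. -/
def semibasicForm (p : HamSpace F E) (u v : Fin (finrank ℝ F) → ℝ)
    (w : E (hamProj F E p) × TangentSpace (hamModel n F) p) : ℝ :=
  ∑ α, (κ.coeff α (hamProj F E p) w.1 * u α + (κ.tangentCoords p w.2).2.1 α * v α)

/-- The solution `z` of `i_z η = h`, `i_z dη = u_α e^α + v^α dy_α`. -/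
def contactVec (p : HamSpace F E) (h : ℝ) (u v : Fin (finrank ℝ F) → ℝ) :
    E (hamProj F E p) × TangentSpace (hamModel n F) p :=
  κ.prolVec A p v (fun β => ∑ α, v α * κ.dualBracket A α β p - u β)
    (h + ∑ α, v α * p.1.2 (κ.frame α (hamProj F E p)))

section Pointwise

variable {κ} {p : HamSpace F E} (hp : hamProj F E p ∈ κ.chart.source)
include hp

theorem extDeriv_hamContact [ContMDiffVectorBundle ∞ F E (𝓡 n)] [T2Space Q]
    (Z W : ProlSec (hamModel n F) A (hamProj F E)) :
    extDeriv (hamContact n F E) Z W p = κ.hamForm A p (Z p) (W p) := by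
  refine (extDeriv_contactForm κ mdifferentiable_hamProj (s := fun x : HamSpace F E => x.2)
    contMDiff_snd (l := fun x => x.1.2) Z W hp
    fun α => (κ.contMDiffAt_covector_frame hp α).mdifferentiableAt (by simp)).trans ?_
  simp only [hamForm, tangentCoords_snd_fst hp]
  rfl

omit [FiniteDimensional ℝ F] in
theorem hamContact_eq (z : E (hamProj F E p) × TangentSpace (hamModel n F) p) :
    hamContact n F E p z = (κ.tangentCoords p z.2).2.2
      - ∑ α, κ.coeff α (hamProj F E p) z.1 * p.1.2 (κ.frame α (hamProj F E p)) := by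
  have hcovector : p.1.2 z.1
      = ∑ α, κ.coeff α (hamProj F E p) z.1 * p.1.2 (κ.frame α (hamProj F E p)) := by
    conv_lhs => rw [← κ.sum_coeff_smul hp z.1]
    simp only [map_sum, map_smul, smul_eq_mul]
  rw [tangentCoords_snd_snd hp, ← hcovector]
  rfl

variable [ContMDiffVectorBundle ∞ F E (𝓡 n)]

theorem contactVec_mem (h : ℝ) (u v : Fin (finrank ℝ F) → ℝ) :
    κ.contactVec A p h u v ∈ prolFiber (hamModel n F) A (hamProj F E) p :=
  prolVec_mem A hp _ _ _

theorem hamContact_contactVec (h : ℝ) (u v : Fin (finrank ℝ F) → ℝ) :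
    hamContact n F E p (κ.contactVec A p h u v) = h := by
  rw [contactVec, hamContact_eq hp, tangentCoords_prolVec A hp]
  simp only [coeff_prolVec A hp]
  ring

theorem hamForm_contactVec (h : ℝ) (u v : Fin (finrank ℝ F) → ℝ)
    (w : E (hamProj F E p) × TangentSpace (hamModel n F) p) :
    κ.hamForm A p (κ.contactVec A p h u v) w = κ.semibasicForm p u v w := by
  rw [contactVec, hamForm, tangentCoords_prolVec A hp, semibasicForm]
  simp only [coeff_prolVec A hp]
  rw [Finset.sum_comm (f := fun α β => v α * κ.coeff β (hamProj F E p) w.1 * κ.dualBracket A α β p),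
    ← Finset.sum_add_distrib]
  refine Finset.sum_congr rfl fun β _ => ?_
  have hcomm : ∑ α, κ.coeff β (hamProj F E p) w.1 * (v α * κ.dualBracket A α β p)
      = ∑ α, v α * κ.coeff β (hamProj F E p) w.1 * κ.dualBracket A α β p :=
    Finset.sum_congr rfl fun α _ => by ring
  rw [mul_sub, Finset.mul_sum, hcomm]
  ring

theorem eq_contactVec {z : E (hamProj F E p) × TangentSpace (hamModel n F) p}
    (hz : z ∈ prolFiber (hamModel n F) A (hamProj F E) p) {h : ℝ} {u v : Fin (finrank ℝ F) → ℝ}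
    (hh : hamContact n F E p z = h)
    (hw : ∀ w ∈ prolFiber (hamModel n F) A (hamProj F E) p,
      κ.hamForm A p z w = κ.semibasicForm p u v w) :
    z = κ.contactVec A p h u v := by
  have hcoeff : ∀ α, κ.coeff α (hamProj F E p) z.1 = v α := fun α => by
    have hdy := hw _ (prolVec_mem A hp 0 (Pi.single α 1) 0)
    rw [hamForm, semibasicForm, tangentCoords_prolVec A hp] at hdy
    simpa [coeff_prolVec A hp, Pi.single_apply] using hdy
  have hmomentum : ∀ β,
      (κ.tangentCoords p z.2).2.1 β = ∑ α, v α * κ.dualBracket A α β p - u β := fun β => by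
    have he := hw _ (prolVec_mem A hp (Pi.single β 1) 0 0)
    rw [hamForm, semibasicForm, tangentCoords_prolVec A hp] at he
    have hu : -(κ.tangentCoords p z.2).2.1 β + ∑ α, v α * κ.dualBracket A α β p = u β := by
      simpa [coeff_prolVec A hp, hcoeff, Pi.single_apply] using he
    linarith
  have hreeb : (κ.tangentCoords p z.2).2.2
      = h + ∑ α, v α * p.1.2 (κ.frame α (hamProj F E p)) := by
    rw [hamContact_eq hp] at hh
    simp only [hcoeff] at hh
    linarith
  rw [eq_prolVec_of_mem A hp hz, contactVec, hreeb, funext hcoeff, funext hmomentum]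

variable [T2Space Q]

omit [FiniteDimensional ℝ F] [ContMDiffVectorBundle ∞ F E (𝓡 n)] in
theorem contMDiffAt_dualBracket (α β : Fin (finrank ℝ F)) :
    ContMDiffAt (hamModel n F) 𝓘(ℝ, ℝ) ∞ (κ.dualBracket A α β) p := by
  obtain ⟨s, hs⟩ := exists_sec_eventuallyEq κ.chart.open_source (κ.isLocalFrameOn.contMDiffOn α) hp
  obtain ⟨t, ht⟩ := exists_sec_eventuallyEq κ.chart.open_source (κ.isLocalFrameOn.contMDiffOn β) hp
  have hbracket : ContMDiffAt (hamModel n F) ((𝓡 n).prod 𝓘(ℝ, F)) ∞ (fun x : HamSpace F E =>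
      (⟨hamProj F E x, A.bracket s t (hamProj F E x)⟩ : TotalSpace F E)) p :=
    (A.bracket s t).contMDiff.contMDiffAt.comp p contMDiff_hamProj.contMDiffAt
  have happly := ContMDiffAt.clm_bundle_apply (F₂ := ℝ) (E₂ := Bundle.Trivial Q ℝ)
    (b := hamProj F E) (ϕ := fun x : HamSpace F E => x.1.2) (contMDiffAt_fst (p := p)) hbracket
  refine (contMDiffAt_totalSpace.1 happly).2.congr_of_eventuallyEq ?_
  filter_upwards [(contMDiff_hamProj (n := n)).continuous.continuousAt.eventually
    (hs.eventually_nhds.and ht.eventually_nhds)] with x hx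
  rw [dualBracket, A.localBracket_eq_bracket hx.1 hx.2]
  rfl

theorem contMDiffPairAt_contactVec {h : HamSpace F E → ℝ}
    {u v : HamSpace F E → Fin (finrank ℝ F) → ℝ}
    (hh : ContMDiffAt (hamModel n F) 𝓘(ℝ, ℝ) ∞ h p)
    (hu : ContMDiffAt (hamModel n F) 𝓘(ℝ, Fin (finrank ℝ F) → ℝ) ∞ u p)
    (hv : ContMDiffAt (hamModel n F) 𝓘(ℝ, Fin (finrank ℝ F) → ℝ) ∞ v p) :
    ContMDiffPairAt n F (hamModel n F) (fun x => κ.contactVec A x (h x) (u x) (v x)) p := by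
  have hv' := contMDiffAt_pi_space.1 hv
  refine contMDiffPairAt_prolVec A hp hv (contMDiffAt_pi_space.2 fun β => ?_)
    (hh.add (ContMDiffAt.sum fun α _ => (hv' α).mul (κ.contMDiffAt_covector_frame hp α)))
  exact (ContMDiffAt.sum fun α _ => (hv' α).mul (contMDiffAt_dualBracket A hp α β)).sub
    (contMDiffAt_pi_space.1 hu β)

theorem exists_prolSec_eq {z : E (hamProj F E p) × TangentSpace (hamModel n F) p}
    (hz : z ∈ prolFiber (hamModel n F) A (hamProj F E) p) :
    ∃ Z : ProlSec (hamModel n F) A (hamProj F E), Z p = z := by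
  obtain ⟨Z, hZ⟩ := ProlSec.exists_eventuallyEq contMDiff_hamProj κ.chart.open_source
    (fun x hx => ⟨prolVec_mem A hx _ _ _, contMDiffPairAt_prolVec A hx
      (contMDiffAt_const (c := fun α => κ.coeff α (hamProj F E p) z.1))
      (contMDiffAt_const (c := (κ.tangentCoords p z.2).2.1))
      (contMDiffAt_const (c := (κ.tangentCoords p z.2).2.2))⟩) hp
  exact ⟨Z, hZ.self_of_nhds.trans (eq_prolVec_of_mem A hp hz).symm⟩

theorem eq_contactVec_iff {X : ProlSec (hamModel n F) A (hamProj F E)}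
    {θ : E (hamProj F E p) × TangentSpace (hamModel n F) p → ℝ} {h : ℝ}
    {u v : Fin (finrank ℝ F) → ℝ}
    (hθ : ∀ w ∈ prolFiber (hamModel n F) A (hamProj F E) p, θ w = κ.semibasicForm p u v w) :
    X p = κ.contactVec A p h u v ↔ hamContact n F E p (X p) = h ∧
      ∀ Z : ProlSec (hamModel n F) A (hamProj F E),
        extDeriv (hamContact n F E) X Z p = θ (Z p) := by
  refine ⟨fun hX => ⟨hX ▸ hamContact_contactVec A hp h u v, fun Z => ?_⟩, fun ⟨hh, hX⟩ =>
    eq_contactVec A hp (X.mem p) hh fun w hw => ?_⟩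
  · rw [extDeriv_hamContact A hp, hX, hamForm_contactVec A hp, hθ _ (Z.mem p)]
  · obtain ⟨W, rfl⟩ := exists_prolSec_eq A hp hw
    rw [← extDeriv_hamContact A hp, hX, hθ _ hw]

end Pointwise

end LocalCoords

/-- In local coordinates, `θ = u_α e^α + v^α dy_α` on the prolongation, with smooth `u` and `v`. -/
def IsSmoothSemibasic (A : LieAlgebroid n F E)
    (θ : OneSec E (hamModel n F) (hamProj F E)) : Prop :=
  ∀ κ : LocalCoords n F E, ∃ u v : HamSpace F E → Fin (finrank ℝ F) → ℝ,
    ∀ p : HamSpace F E, hamProj F E p ∈ κ.chart.source →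
      ContMDiffAt (hamModel n F) 𝓘(ℝ, Fin (finrank ℝ F) → ℝ) ∞ u p ∧
      ContMDiffAt (hamModel n F) 𝓘(ℝ, Fin (finrank ℝ F) → ℝ) ∞ v p ∧
      ∀ w ∈ prolFiber (hamModel n F) A (hamProj F E) p, θ p w = κ.semibasicForm p (u p) (v p) w

variable [ContMDiffVectorBundle ∞ F E (𝓡 n)] [T2Space Q] {A : LieAlgebroid n F E}

theorem existsUnique_prolSec {θ : OneSec E (hamModel n F) (hamProj F E)}
    (hθ : IsSmoothSemibasic A θ) {h : HamSpace F E → ℝ}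
    (hh : ContMDiff (hamModel n F) 𝓘(ℝ, ℝ) ∞ h) :
    ∃! X : ProlSec (hamModel n F) A (hamProj F E), (∀ p, hamContact n F E p (X p) = h p) ∧
      ∀ (Z : ProlSec (hamModel n F) A (hamProj F E)) p,
        extDeriv (hamContact n F E) X Z p = θ p (Z p) := by
  choose u v hu hv huv using hθ
  choose κ hκ using fun p : HamSpace F E =>
    exists_localCoords (n := n) (F := F) (E := E) (hamProj F E p)
  let X₀ : ∀ p : HamSpace F E, E (hamProj F E p) × TangentSpace (hamModel n F) p :=
    fun p => (κ p).contactVec A p (h p) (u (κ p) p) (v (κ p) p)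
  have hmem : ∀ p, X₀ p ∈ prolFiber (hamModel n F) A (hamProj F E) p :=
    fun p => LocalCoords.contactVec_mem A (hκ p) _ _ _
  have hX₀ : ∀ (κ' : LocalCoords n F E) (p : HamSpace F E), hamProj F E p ∈ κ'.chart.source →
      X₀ p = κ'.contactVec A p (h p) (u κ' p) (v κ' p) := fun κ' p hp => by
    obtain ⟨X, hX⟩ := LocalCoords.exists_prolSec_eq A hp (hmem p)
    exact hX.symm.trans ((LocalCoords.eq_contactVec_iff A hp (huv κ' p hp)).2
      ((LocalCoords.eq_contactVec_iff A (hκ p) (huv (κ p) p (hκ p))).1 hX))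
  have hsmooth : ∀ p, ContMDiffPairAt n F (hamModel n F) X₀ p := fun p =>
    (LocalCoords.contMDiffPairAt_contactVec A (hκ p) (hh p) (hu (κ p) p (hκ p))
      (hv (κ p) p (hκ p))).congr_of_eventuallyEq
      (((κ p).eventually_dual_proj_mem_source (hκ p)).mono fun x hx => hX₀ (κ p) x hx)
  let X : ProlSec (hamModel n F) A (hamProj F E) :=
    ⟨X₀, hmem, fun p => (hsmooth p).fst, fun p => (hsmooth p).snd⟩
  have hX := fun p => (LocalCoords.eq_contactVec_iff A (hκ p) (huv (κ p) p (hκ p)) (X := X)).1 rfl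
  exact ⟨X, ⟨fun p => (hX p).1, fun Z p => (hX p).2 Z⟩, fun Y hY => ProlSec.ext fun p =>
    (LocalCoords.eq_contactVec_iff A (hκ p) (huv (κ p) p (hκ p))).2 ⟨hY.1 p, fun Z => hY.2 Z p⟩⟩

end ContactForm

section HamiltonianSection

variable {n : ℕ} {Q : Type*} [TopologicalSpace Q] [ChartedSpace (EuclideanSpace ℝ (Fin n)) Q]
  [IsManifold (𝓡 n) ∞ Q]
  {F : Type*} [NormedAddCommGroup F] [NormedSpace ℝ F] [FiniteDimensional ℝ F]
  {E : Q → Type*} [∀ q, AddCommGroup (E q)] [∀ q, Module ℝ (E q)]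
  [∀ q, TopologicalSpace (E q)] [TopologicalSpace (TotalSpace F E)]
  [FiberBundle F E] [VectorBundle ℝ F E] [ContMDiffVectorBundle ∞ F E (𝓡 n)]
  {A : LieAlgebroid n F E}

namespace LocalCoords

section Derivative

variable {κ : LocalCoords n F E} {p : HamSpace F E} (hp : hamProj F E p ∈ κ.chart.source)
  {H : HamSpace F E → ℝ} (hH : ContMDiff (hamModel n F) 𝓘(ℝ, ℝ) ∞ H)
include hp hH

theorem mvfderiv_eq_sum_partial (v : TangentSpace (hamModel n F) p) :
    mvfderiv (hamModel n F) H p v =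
      ∑ i, (κ.tangentCoords p v).1 i * partialQ (fun w => H (κ.hamPoint w)) i (κ.hamCoords p)
      + ∑ α, (κ.tangentCoords p v).2.1 α * partialY (fun w => H (κ.hamPoint w)) α (κ.hamCoords p)
      + (κ.tangentCoords p v).2.2 * partialS (fun w => H (κ.hamPoint w)) (κ.hamCoords p) :=
  (mvfderiv_eq_fderiv_comp (hH.mdifferentiable (by simp) p) (mdifferentiableAt_hamCoords hp)
    (mdifferentiableAt_hamPoint hp) (eventually_hamPoint_hamCoords hp) v).trans
    (fderiv_eq_sum_partial _ _ _)

theorem contDiffAt_comp_hamPoint :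
    ContDiffAt ℝ ∞ (fun w => H (κ.hamPoint w)) (κ.hamCoords p) :=
  (hH.contMDiffAt.comp _ (κ.contMDiffAt_hamPoint (κ.chart.map_source hp))).contDiffAt

end Derivative

variable (κ : LocalCoords n F E) (A) (H : HamSpace F E → ℝ)

/-- The coefficients `ρ^i_α ∂H/∂q^i + y_α ∂H/∂s` of `e^α` in `dH - (∂H/∂s) η`. -/
def baseCoeff (p : HamSpace F E) (α : Fin (finrank ℝ F)) : ℝ :=
  ∑ i, κ.anchorVec A α (hamProj F E p) i
      * partialQ (fun w => H (κ.hamPoint w)) i (κ.hamCoords p)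
    + partialS (fun w => H (κ.hamPoint w)) (κ.hamCoords p) * p.1.2 (κ.frame α (hamProj F E p))

/-- The coefficients `∂H/∂y_α` of `dy_α` in `dH - (∂H/∂s) η`. -/
def fiberCoeff (p : HamSpace F E) (α : Fin (finrank ℝ F)) : ℝ :=
  partialY (fun w => H (κ.hamPoint w)) α (κ.hamCoords p)

variable {κ H} {p : HamSpace F E} (hp : hamProj F E p ∈ κ.chart.source)
  (hH : ContMDiff (hamModel n F) 𝓘(ℝ, ℝ) ∞ H)
include hp hH

theorem contMDiffAt_fiberCoeff :
    ContMDiffAt (hamModel n F) 𝓘(ℝ, Fin (finrank ℝ F) → ℝ) ∞ (κ.fiberCoeff H) p :=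
  contMDiffAt_pi_space.2 fun α => (contDiffAt_partialY
    (contDiffAt_comp_hamPoint hp hH) α).contMDiffAt.comp p (κ.contMDiffAt_hamCoords hp)

theorem contMDiffAt_baseCoeff :
    ContMDiffAt (hamModel n F) 𝓘(ℝ, Fin (finrank ℝ F) → ℝ) ∞ (κ.baseCoeff A H) p := by
  have hH' := contDiffAt_comp_hamPoint hp hH
  have hcoords := κ.contMDiffAt_hamCoords hp
  refine contMDiffAt_pi_space.2 fun α => (ContMDiffAt.sum fun i _ => ?_).add
    (((contDiffAt_partialS hH').contMDiffAt.comp p hcoords).mul (κ.contMDiffAt_covector_frame hp α))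
  exact ((EuclideanSpace.proj (𝕜 := ℝ) i).contMDiff.contMDiffAt.comp p
    ((contMDiffAt_anchorVec A hp α).comp p contMDiff_hamProj.contMDiffAt)).mul
    ((contDiffAt_partialQ hH' i).contMDiffAt.comp p hcoords)

theorem mvfderiv_sub_hamContact_eq_semibasicForm
    {w : E (hamProj F E p) × TangentSpace (hamModel n F) p}
    (hw : w ∈ prolFiber (hamModel n F) A (hamProj F E) p) :
    mvfderiv (hamModel n F) H p w.2
        - partialS (fun w => H (κ.hamPoint w)) (κ.hamCoords p) * hamContact n F E p w
      = κ.semibasicForm p (κ.baseCoeff A H p) (κ.fiberCoeff H p) w := by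
  set a := fun α => κ.coeff α (hamProj F E p) w.1
  set ρ := fun α => κ.anchorVec A α (hamProj F E p)
  set Hq := fun i => partialQ (fun w => H (κ.hamPoint w)) i (κ.hamCoords p)
  have hanchor : ∑ i, (∑ α, a α • ρ α) i * Hq i = ∑ α, a α * ∑ i, ρ α i * Hq i := by
    simp only [Finset.mul_sum, WithLp.ofLp_sum, PiLp.smul_apply, Finset.sum_apply,
      smul_eq_mul, Finset.sum_mul, mul_assoc]
    exact Finset.sum_comm
  rw [mvfderiv_eq_sum_partial hp hH, hamContact_eq hp, tangentCoords_fst_of_mem A hp hw, hanchor]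
  simp only [semibasicForm, baseCoeff, fiberCoeff, mul_add, Finset.sum_add_distrib, mul_sub,
    mul_left_comm _ (partialS _ _), ← Finset.mul_sum]
  ring

end LocalCoords

variable [T2Space Q]

theorem existsUnique_isReeb :
    ∃! R : ProlSec (hamModel n F) A (hamProj F E), IsReeb (hamContact n F E) R := by
  have hzero : IsSmoothSemibasic A (0 : OneSec E (hamModel n F) (hamProj F E)) := fun κ =>
    ⟨0, 0, fun p _ => ⟨contMDiffAt_const, contMDiffAt_const, fun w _ => by
      simp [LocalCoords.semibasicForm]⟩⟩
  exact (existsUnique_congr fun R => and_comm).1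
    (existsUnique_prolSec hzero (h := fun _ => 1) contMDiff_const)

section Reeb

variable {R : ProlSec (hamModel n F) A (hamProj F E)} (hR : IsReeb (hamContact n F E) R)
  {κ : LocalCoords n F E} {p : HamSpace F E} (hp : hamProj F E p ∈ κ.chart.source)
include hR hp

theorem IsReeb.eq_prolVec : R p = κ.prolVec A p 0 0 1 := by
  have hcontact : R p = κ.contactVec A p 1 0 0 :=
    (LocalCoords.eq_contactVec_iff A hp (θ := 0)
      fun w _ => by simp [LocalCoords.semibasicForm]).2 ⟨hR.2 p, fun Z => hR.1 Z p⟩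
  rw [hcontact, LocalCoords.contactVec]
  congr 1 <;> simp
  rfl

theorem IsReeb.deriv_eq_partialS {H : HamSpace F E → ℝ}
    (hH : ContMDiff (hamModel n F) 𝓘(ℝ, ℝ) ∞ H) :
    R.deriv H p = partialS (fun w => H (κ.hamPoint w)) (κ.hamCoords p) := by
  rw [ProlSec.deriv, ProlSec.vectorField, LocalCoords.mvfderiv_eq_sum_partial hp hH,
    hR.eq_prolVec hp, LocalCoords.tangentCoords_prolVec A hp]
  simp

end Reeb

theorem isSmoothSemibasic_mvfderiv_sub_hamContact {R : ProlSec (hamModel n F) A (hamProj F E)}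
    (hR : IsReeb (hamContact n F E) R) {H : HamSpace F E → ℝ}
    (hH : ContMDiff (hamModel n F) 𝓘(ℝ, ℝ) ∞ H) :
    IsSmoothSemibasic A (fun p => (mvfderiv (hamModel n F) H p).toLinearMap ∘ₗ
      LinearMap.snd ℝ (E (hamProj F E p)) (TangentSpace (hamModel n F) p)
      - R.deriv H p • hamContact n F E p) :=
  fun κ => ⟨κ.baseCoeff A H, κ.fiberCoeff H, fun _ hp =>
    ⟨LocalCoords.contMDiffAt_baseCoeff A hp hH, LocalCoords.contMDiffAt_fiberCoeff hp hH,
      fun w hw => (congrArg (fun r => mvfderiv (hamModel n F) H _ w.2 - r * hamContact n F E _ w)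
        (hR.deriv_eq_partialS hp hH)).trans
        (LocalCoords.mvfderiv_sub_hamContact_eq_semibasicForm A hp hH hw)⟩⟩

theorem existsUnique_isHamiltonianSection {H : HamSpace F E → ℝ}
    (hH : ContMDiff (hamModel n F) 𝓘(ℝ, ℝ) ∞ H) : ∃! ξ, IsHamiltonianSection A H ξ := by
  obtain ⟨R, hR, hR_unique⟩ := existsUnique_isReeb (A := A)
  refine (existsUnique_congr fun ξ => and_congr_right fun _ => ⟨fun hξ => ⟨R, hR, hξ⟩, ?_⟩).1
    (existsUnique_prolSec (isSmoothSemibasic_mvfderiv_sub_hamContact hR hH) hH.neg)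
  rintro ⟨R', hR', hξ⟩
  exact hR_unique R' hR' ▸ hξ

end HamiltonianSection

section Transport

variable {n : ℕ} {Q : Type*} [TopologicalSpace Q] [ChartedSpace (EuclideanSpace ℝ (Fin n)) Q]
  [IsManifold (𝓡 n) ∞ Q]
  {F : Type*} [NormedAddCommGroup F] [NormedSpace ℝ F]
  {E : Q → Type*} [∀ q, AddCommGroup (E q)] [∀ q, Module ℝ (E q)]
  [∀ q, TopologicalSpace (E q)] [TopologicalSpace (TotalSpace F E)]
  [FiberBundle F E] [VectorBundle ℝ F E]
  {V H : Type*} [NormedAddCommGroup V] [NormedSpace ℝ V] [TopologicalSpace H]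
  {J : ModelWithCorners ℝ V H}
  {P : Type*} [TopologicalSpace P] [ChartedSpace H P] [IsManifold J ∞ P]
  {V' H' : Type*} [NormedAddCommGroup V'] [NormedSpace ℝ V'] [TopologicalSpace H']
  {J' : ModelWithCorners ℝ V' H'}
  {P' : Type*} [TopologicalSpace P'] [ChartedSpace H' P'] [IsManifold J' ∞ P']
  {A : LieAlgebroid n F E} {pr : P' → Q} (hpr : MDifferentiable J' (𝓡 n) pr)
  (Φ : Diffeomorph J J' P P' ∞)

omit [IsManifold J ∞ P] [IsManifold J' ∞ P'] in
theorem mfderiv_diffeomorph_mfderiv_symm (p : P) (w : TangentSpace J' (Φ p)) :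
    (mfderiv J J' Φ p (mfderiv J' J Φ.symm (Φ p) w : V) : V') = w := by
  have hcomp := mfderiv_comp_apply_of_eq (Φ p) (Φ.mdifferentiable (by simp) p)
    (Φ.symm.mdifferentiable (by simp) (Φ p)) (Φ.symm_apply_apply p) w
  have hid : Φ ∘ Φ.symm = id := funext Φ.apply_symm_apply
  rw [hid, mfderiv_id] at hcomp
  exact hcomp.symm

omit [IsManifold J ∞ P] [IsManifold J' ∞ P'] in
include hpr in
theorem mem_prolFiber_comp_iff {p : P} {a : E (pr (Φ p))} {v : TangentSpace J p} :
    (a, v) ∈ prolFiber J A (fun x => pr (Φ x)) p ↔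
      (a, (mfderiv J J' Φ p v : TangentSpace J' (Φ p))) ∈ prolFiber J' A pr (Φ p) := by
  have hchain := mfderiv_comp_apply p (hpr (Φ p)) (Φ.mdifferentiable (by simp) p) v
  exact ⟨fun h => Eq.trans h hchain, fun h => Eq.trans h hchain.symm⟩

namespace ProlSec

/-- The pullback of a section of the prolongation over `pr` along a diffeomorphism `Φ`: the section
`p ↦ (a, (Φ⁻¹)_* w)`, where `(a, w)` is the value at `Φ p`. -/
def pullback (W : ProlSec J' A pr) : ProlSec J A (fun p => pr (Φ p)) where
  toFun p := ((W (Φ p)).1, mfderiv J' J Φ.symm (Φ p) (W (Φ p)).2)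
  mem p := by
    refine (mem_prolFiber_comp_iff hpr Φ).2 ?_
    rw [mfderiv_diffeomorph_mfderiv_symm]
    exact W.mem (Φ p)
  contMDiff_fst := W.contMDiff_fst.comp Φ.contMDiff
  contMDiff_snd p := by
    refine (contMDiffAt_mfderiv_apply isOpen_univ Φ.symm.contMDiff.contMDiffOn (mem_univ _)
      (W.contMDiff_snd.comp Φ.contMDiff).contMDiffAt).congr_of_eventuallyEq
        (Eventually.of_forall fun x => ?_)
    have hbase : ∀ (x' : P) (u : V), x' = x →
        (⟨x, u⟩ : TangentBundle J P) = ⟨x', u⟩ := by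
      rintro _ u rfl
      rfl
    exact hbase _ _ (Φ.symm_apply_apply x)

theorem mfderiv_pullback_snd (W : ProlSec J' A pr) (p : P) :
    (mfderiv J J' Φ p (W.pullback hpr Φ p).2 : V') = (W (Φ p)).2 :=
  mfderiv_diffeomorph_mfderiv_symm Φ p _

theorem pullback_injective : Function.Injective (pullback (A := A) hpr Φ) := by
  refine fun W W' h => ProlSec.ext fun x => ?_
  obtain ⟨p, rfl⟩ := EquivLike.surjective Φ x
  refine Prod.ext (congrArg (fun Z : ProlSec J A fun p => pr (Φ p) => (Z p).1) h) ?_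
  rw [← mfderiv_pullback_snd hpr, h, mfderiv_pullback_snd]

theorem pullback_surjective : Function.Surjective (pullback (A := A) hpr Φ) := by
  intro Z
  let X := Equiv.piCongrLeft (fun x => E (pr x) × TangentSpace J' x) Φ.toEquiv
    fun p => ((Z p).1, mfderiv J J' Φ p (Z p).2)
  have hX : ∀ p, X (Φ p) = ((Z p).1, mfderiv J J' Φ p (Z p).2) :=
    Equiv.piCongrLeft_apply_apply _ Φ.toEquiv _
  have hfst : (fun x => (⟨pr x, (X x).1⟩ : TotalSpace F E))
      = (fun p => ⟨pr (Φ p), (Z p).1⟩) ∘ Φ.symm := funext fun x => by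
    obtain ⟨p, rfl⟩ := EquivLike.surjective Φ x
    rw [Function.comp_apply, Φ.symm_apply_apply, hX]
  have hsnd : (fun x => (⟨x, (X x).2⟩ : TangentBundle J' P'))
      = (fun p => ⟨Φ p, mfderiv J J' Φ p (Z p).2⟩) ∘ Φ.symm := funext fun x => by
    obtain ⟨p, rfl⟩ := EquivLike.surjective Φ x
    rw [Function.comp_apply, Φ.symm_apply_apply, hX]
  have htangent : ContMDiff J J'.tangent ∞
      (fun p => (⟨Φ p, mfderiv J J' Φ p (Z p).2⟩ : TangentBundle J' P')) := fun p =>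
    contMDiffAt_mfderiv_apply isOpen_univ Φ.contMDiff.contMDiffOn (mem_univ _)
      Z.contMDiff_snd.contMDiffAt
  refine ⟨⟨X, fun x => ?_, hfst ▸ Z.contMDiff_fst.comp Φ.symm.contMDiff,
    hsnd ▸ htangent.comp Φ.symm.contMDiff⟩, ProlSec.ext fun p => ?_⟩
  · obtain ⟨p, rfl⟩ := EquivLike.surjective Φ x
    rw [hX]
    exact (mem_prolFiber_comp_iff hpr Φ).1 (Z.mem p)
  · have hpush := (mfderiv_diffeomorph_mfderiv_symm Φ p (X (Φ p)).2).trans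
      (congrArg Prod.snd (hX p))
    have hXfst : (X (Φ p)).1 = (Z p).1 := congrArg Prod.fst (hX p)
    exact Prod.ext hXfst ((Φ.mfderivToContinuousLinearEquiv (by simp) p).injective hpush)

theorem pullback_bijective : Function.Bijective (pullback (A := A) hpr Φ) :=
  ⟨pullback_injective hpr Φ, pullback_surjective hpr Φ⟩

theorem deriv_pullback (W : ProlSec J' A pr) {f : P' → ℝ} (hf : ContMDiff J' 𝓘(ℝ, ℝ) ∞ f) (p : P) :
    (W.pullback hpr Φ).deriv (f ∘ Φ) p = W.deriv f (Φ p) := by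
  refine (mfderiv_comp_apply p (hf.mdifferentiable (by simp) _) (Φ.mdifferentiable (by simp) p)
    _).trans ?_
  exact congrArg (mfderiv J' 𝓘(ℝ, ℝ) f (Φ p)) (W.mfderiv_pullback_snd hpr Φ p)

end ProlSec

variable {s : P' → ℝ} (hs : ContMDiff J' 𝓘(ℝ, ℝ) ∞ s) {l : ∀ x, DualBundle E (pr x)}
include hs

theorem contactForm_pullback (W : ProlSec J' A pr) (p : P) :
    contactForm J (s ∘ Φ) (fun x => l (Φ x)) p (W.pullback hpr Φ p)
      = contactForm J' s l (Φ p) (W (Φ p)) :=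
  congrArg (· - l (Φ p) (W (Φ p)).1) (W.deriv_pullback hpr Φ hs p)

variable [FiniteDimensional ℝ F] [T2Space Q] [ContMDiffVectorBundle ∞ F E (𝓡 n)]
  [J.Boundaryless] [CompleteSpace V] [J'.Boundaryless] [CompleteSpace V']
  (hl : ContMDiff J' ((𝓡 n).prod 𝓘(ℝ, F →L[ℝ] ℝ)) ∞
    (fun x => (⟨pr x, l x⟩ : TotalSpace (F →L[ℝ] ℝ) (DualBundle E))))
include hl

theorem extDeriv_contactForm_pullback (X Y : ProlSec J' A pr) (p : P) :
    extDeriv (contactForm J (s ∘ Φ) (fun x => l (Φ x))) (X.pullback hpr Φ) (Y.pullback hpr Φ) p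
      = extDeriv (contactForm J' s l) X Y (Φ p) := by
  obtain ⟨κ, hp⟩ := exists_localCoords (n := n) (F := F) (E := E) (pr (Φ p))
  have hΦ : MDifferentiable J J' Φ := Φ.mdifferentiable (by simp)
  have hframe : ∀ α, MDifferentiableAt J' 𝓘(ℝ, ℝ) (fun x => l x (κ.frame α (pr x))) (Φ p) :=
    fun α => (κ.contMDiffAt_apply_frame hl.contMDiffAt hp α).mdifferentiableAt (by simp)
  have hchain : ∀ α (W : ProlSec J' A pr),
      mvfderiv J (fun x => l (Φ x) (κ.frame α (pr (Φ x)))) p (W.pullback hpr Φ p).2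
        = mvfderiv J' (fun x => l x (κ.frame α (pr x))) (Φ p) (W (Φ p)).2 := fun α W =>
    (mfderiv_comp_apply p (hframe α) (hΦ p) _).trans
      (congrArg (mfderiv J' 𝓘(ℝ, ℝ) _ (Φ p)) (W.mfderiv_pullback_snd hpr Φ p))
  rw [extDeriv_contactForm (pr := fun x => pr (Φ x)) κ (hpr.comp hΦ) (hs.comp Φ.contMDiff) _ _ hp
      fun α => (hframe α).comp p (hΦ p),
    extDeriv_contactForm κ hpr hs _ _ hp hframe]
  simp only [hchain]
  rfl

theorem isReeb_pullback_iff {R : ProlSec J' A pr} :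
    IsReeb (contactForm J (s ∘ Φ) fun x => l (Φ x)) (R.pullback hpr Φ)
      ↔ IsReeb (contactForm J' s l) R := by
  refine and_congr ((ProlSec.pullback_surjective hpr Φ).forall.trans
    (forall_congr' fun Z => ?_)) ?_
  · simp only [extDeriv_contactForm_pullback hpr Φ hs hl]
    rw [(EquivLike.surjective Φ).forall]
  · simp only [contactForm_pullback hpr Φ hs]
    rw [(EquivLike.surjective Φ).forall]

theorem isContactSection_pullback_iff {f : P' → ℝ} (hf : ContMDiff J' 𝓘(ℝ, ℝ) ∞ f)
    {X : ProlSec J' A pr} :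
    IsContactSection (contactForm J (s ∘ Φ) fun x => l (Φ x)) (f ∘ Φ) (X.pullback hpr Φ)
      ↔ IsContactSection (contactForm J' s l) f X := by
  refine and_congr ?_ ((ProlSec.pullback_surjective hpr Φ).exists.trans (exists_congr fun R =>
    and_congr (isReeb_pullback_iff hpr Φ hs hl) ((ProlSec.pullback_surjective hpr Φ).forall.trans
      (forall_congr' fun Z => ?_))))
  · simp only [contactForm_pullback hpr Φ hs, Function.comp_apply]
    rw [(EquivLike.surjective Φ).forall]
  · simp only [extDeriv_contactForm_pullback hpr Φ hs hl, contactForm_pullback hpr Φ hs,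
      ProlSec.deriv_pullback hpr Φ _ hf]
    rw [(EquivLike.surjective Φ).forall]

end Transport

section Hyperregular

variable {n : ℕ} {Q : Type*} [TopologicalSpace Q] [ChartedSpace (EuclideanSpace ℝ (Fin n)) Q]
  [IsManifold (𝓡 n) ∞ Q]
  {F : Type*} [NormedAddCommGroup F] [NormedSpace ℝ F]
  {E : Q → Type*} [∀ q, AddCommGroup (E q)] [∀ q, Module ℝ (E q)]
  [∀ q, TopologicalSpace (E q)] [TopologicalSpace (TotalSpace F E)]
  [FiberBundle F E] [VectorBundle ℝ F E] [ContMDiffVectorBundle ∞ F E (𝓡 n)]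
  {A : LieAlgebroid n F E} {L : Lagrangian n F E}
  {Leg : Diffeomorph (lagModel n F) (hamModel n F) (LagSpace F E) (HamSpace F E) ∞}
  (hLeg : ∀ p, Leg p = legendre L p)

/-- The Legendre transformation of a hyperregular Lagrangian as a diffeomorphism whose underlying
map is definitionally `legendre L`, so that it commutes definitionally with the projections
to `Q`. -/
def legendreDiffeo : Diffeomorph (lagModel n F) (hamModel n F) (LagSpace F E) (HamSpace F E) ∞ where
  toFun := legendre L
  invFun := Leg.symm
  left_inv p := by rw [← hLeg, Leg.symm_apply_apply]
  right_inv x := by rw [← hLeg, Leg.apply_symm_apply]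
  contMDiff_toFun := (funext hLeg : ⇑Leg = legendre L) ▸ Leg.contMDiff
  contMDiff_invFun := Leg.symm.contMDiff

theorem energy_comp_symm_comp_legendreDiffeo :
    (energy L ∘ Leg.symm) ∘ legendreDiffeo hLeg = energy L :=
  funext fun p => congrArg (energy L) ((legendreDiffeo hLeg).symm_apply_apply p)

theorem lagContact_eq_contactForm_legendreDiffeo :
    lagContact L = contactForm (lagModel n F) ((fun x : HamSpace F E => x.2) ∘ legendreDiffeo hLeg)
      (fun p => (legendreDiffeo hLeg p).1.2) := by
  funext p
  refine LinearMap.ext fun z => ?_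
  exact congrArg (mvfderiv (lagModel n F) (fun x : LagSpace F E => x.2) p z.2 - ·)
    (legendreCovector_eq_mvfderiv L p z.1).symm

theorem prolLegendre_pullback (ξ : ProlSec (hamModel n F) A (hamProj F E)) (p : LagSpace F E) :
    prolLegendre L p (ξ.pullback mdifferentiable_hamProj (legendreDiffeo hLeg) p)
      = ξ (legendre L p) :=
  Prod.ext rfl (ξ.mfderiv_pullback_snd mdifferentiable_hamProj (legendreDiffeo hLeg) p)

include hLeg

theorem legendre_comp_symm_comp (σ : ℝ → HamSpace F E) : legendre L ∘ (Leg.symm ∘ σ) = σ :=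
  funext fun t => (legendreDiffeo hLeg).apply_symm_apply (σ t)

omit hLeg

variable [FiniteDimensional ℝ F]

theorem contMDiff_energy_comp_symm :
    ContMDiff (hamModel n F) 𝓘(ℝ, ℝ) ∞ (energy L ∘ Leg.symm) :=
  (contMDiff_energy L).comp Leg.symm.contMDiff

include hLeg

theorem isHerglotzSolution_symm_comp_iff {I : Set ℝ} {σ : ℝ → HamSpace F E} :
    IsHerglotzSolution A L I (Leg.symm ∘ σ) ↔ IsHamiltonSolution A (energy L ∘ Leg.symm) I σ := by
  rw [← isHamiltonSolution_legendre_comp_iff hLeg, legendre_comp_symm_comp hLeg]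

theorem bijOn_legendre_comp (I : Set ℝ) :
    BijOn (fun c => legendre L ∘ c) {c | IsHerglotzSolution A L I c}
      {σ | IsHamiltonSolution A (energy L ∘ Leg.symm) I σ} :=
  ⟨fun _ hc => (isHamiltonSolution_legendre_comp_iff hLeg).2 hc,
    ((legendreDiffeo hLeg).injective.comp_left).injOn,
    fun σ hσ => ⟨Leg.symm ∘ σ, (isHerglotzSolution_symm_comp_iff hLeg).2 hσ,
      legendre_comp_symm_comp hLeg σ⟩⟩

variable [T2Space Q]

theorem isLagrangianSection_pullback_iff {ξ : ProlSec (hamModel n F) A (hamProj F E)} :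
    IsLagrangianSection A L (ξ.pullback mdifferentiable_hamProj (legendreDiffeo hLeg))
      ↔ IsHamiltonianSection A (energy L ∘ Leg.symm) ξ := by
  have htransport := isContactSection_pullback_iff mdifferentiable_hamProj (legendreDiffeo hLeg)
    (s := fun x : HamSpace F E => x.2) (l := fun x => x.1.2) (X := ξ) contMDiff_snd contMDiff_fst
    (contMDiff_energy_comp_symm (L := L) (Leg := Leg))
  rwa [energy_comp_symm_comp_legendreDiffeo, ← lagContact_eq_contactForm_legendreDiffeo]
    at htransport

theorem existsUnique_isLagrangianSection :
    ∃! Γ : ProlSec (lagModel n F) A (lagProj F E), IsLagrangianSection A L Γ := by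
  refine ((ProlSec.pullback_bijective (A := A) mdifferentiable_hamProj
    (legendreDiffeo hLeg)).existsUnique_iff).2 ?_
  simp only [isLagrangianSection_pullback_iff hLeg]
  exact existsUnique_isHamiltonianSection contMDiff_energy_comp_symm

theorem IsLagrangianSection.prolLegendre_eq {Γ : ProlSec (lagModel n F) A (lagProj F E)}
    {ξ : ProlSec (hamModel n F) A (hamProj F E)} (hΓ : IsLagrangianSection A L Γ)
    (hξ : IsHamiltonianSection A (energy L ∘ Leg.symm) ξ) (p : LagSpace F E) :
    prolLegendre L p (Γ p) = ξ (legendre L p) := by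
  rw [(existsUnique_isLagrangianSection hLeg).unique hΓ
    ((isLagrangianSection_pullback_iff hLeg).2 hξ)]
  exact prolLegendre_pullback hLeg ξ p

end Hyperregular

end ContactAlgebroid

end

open ContactAlgebroid in
theorem mainTheorem4_general {n : ℕ} {Q : Type*} [TopologicalSpace Q] [T2Space Q]
    [ChartedSpace (EuclideanSpace ℝ (Fin n)) Q] [IsManifold (𝓡 n) ∞ Q]
    {F : Type*} [NormedAddCommGroup F] [NormedSpace ℝ F] [FiniteDimensional ℝ F]
    {E : Q → Type*} [∀ q, AddCommGroup (E q)] [∀ q, Module ℝ (E q)]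
    [∀ q, TopologicalSpace (E q)] [TopologicalSpace (TotalSpace F E)]
    [FiberBundle F E] [VectorBundle ℝ F E] [ContMDiffVectorBundle ∞ F E (𝓡 n)]
    (A : LieAlgebroid n F E) (L : Lagrangian n F E)
    (Leg : Diffeomorph (lagModel n F) (hamModel n F) (LagSpace F E) (HamSpace F E) ∞)
    (hLeg : ∀ p, Leg p = legendre L p) (H : HamSpace F E → ℝ) (hH : H = energy L ∘ Leg.symm) :
    (∃! Γ, IsLagrangianSection A L Γ) ∧
    (∃! ξ, IsHamiltonianSection A H ξ) ∧
    (∀ Γ ξ, IsLagrangianSection A L Γ → IsHamiltonianSection A H ξ →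
      ∀ p, ξ (legendre L p) = prolLegendre L p (Γ p)) ∧
    ∀ I : Set ℝ,
      (∀ c, IsHerglotzSolution A L I c → IsHamiltonSolution A H I (legendre L ∘ c)) ∧
      (∀ σ, IsHamiltonSolution A H I σ → IsHerglotzSolution A L I (Leg.symm ∘ σ)) ∧
      Set.BijOn (fun c => legendre L ∘ c) {c | IsHerglotzSolution A L I c}
        {σ | IsHamiltonSolution A H I σ} := by
  subst hH
  refine ⟨existsUnique_isLagrangianSection hLeg,
    existsUnique_isHamiltonianSection contMDiff_energy_comp_symm,
    fun Γ ξ hΓ hξ p => (hΓ.prolLegendre_eq hLeg hξ p).symm, fun I => ⟨fun c => ?_, fun σ => ?_, ?_⟩⟩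
  · exact (isHamiltonSolution_legendre_comp_iff hLeg).2
  · exact (isHerglotzSolution_symm_comp_iff hLeg).2
  · exact bijOn_legendre_comp hLeg I

theorem mainTheorem4 {n : ℕ} {Q : Type*} [TopologicalSpace Q] [T2Space Q]
    [SecondCountableTopology Q] [ChartedSpace (EuclideanSpace ℝ (Fin n)) Q] [IsManifold (𝓡 n) ∞ Q]
    {F : Type*} [NormedAddCommGroup F] [NormedSpace ℝ F] [FiniteDimensional ℝ F]
    {E : Q → Type*} [∀ q, AddCommGroup (E q)] [∀ q, Module ℝ (E q)]
    [∀ q, TopologicalSpace (E q)] [TopologicalSpace (TotalSpace F E)]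
    [FiberBundle F E] [VectorBundle ℝ F E] [ContMDiffVectorBundle ∞ F E (𝓡 n)]
    (A : ContactAlgebroid.LieAlgebroid n F E)
    (L : ContactAlgebroid.Lagrangian n F E)
    (Leg : Diffeomorph (ContactAlgebroid.lagModel n F) (ContactAlgebroid.hamModel n F)
      (ContactAlgebroid.LagSpace F E) (ContactAlgebroid.HamSpace F E) ∞)
    (hLeg : ∀ p, Leg p = ContactAlgebroid.legendre L p)
    (H : ContactAlgebroid.HamSpace F E → ℝ)
    (hH : H = ContactAlgebroid.energy L ∘ Leg.symm) :
    (∃! Γ, ContactAlgebroid.IsLagrangianSection A L Γ) ∧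
    (∃! ξ, ContactAlgebroid.IsHamiltonianSection A H ξ) ∧
    (∀ Γ ξ, ContactAlgebroid.IsLagrangianSection A L Γ →
      ContactAlgebroid.IsHamiltonianSection A H ξ →
      ∀ p, ξ (ContactAlgebroid.legendre L p) = ContactAlgebroid.prolLegendre L p (Γ p)) ∧
    ∀ I : Set ℝ, I.OrdConnected → I.Nontrivial →
      (∀ c, ContactAlgebroid.IsHerglotzSolution A L I c →
        ContactAlgebroid.IsHamiltonSolution A H I (ContactAlgebroid.legendre L ∘ c)) ∧
      (∀ σ, ContactAlgebroid.IsHamiltonSolution A H I σ →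
        ContactAlgebroid.IsHerglotzSolution A L I (Leg.symm ∘ σ)) ∧
      Set.BijOn (fun c => ContactAlgebroid.legendre L ∘ c)
        {c | ContactAlgebroid.IsHerglotzSolution A L I c}
        {σ | ContactAlgebroid.IsHamiltonSolution A H I σ} := by
  obtain ⟨hLag, hHam, hrel, hsol⟩ := mainTheorem4_general A L Leg hLeg H hH
  exact ⟨hLag, hHam, hrel, fun I _ _ => hsol I⟩
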